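/- Let $d\le 3$, $p\in[2,\infty)$, $t_0\in\mathbb R$ and $\varphi\in H^2(\mathbb R^d)$. Let $\gamma:\mathbb R\to\mathbb R$ be the $1$-periodic dispersion map with $\gamma(t)=\gamma_+$ for $0<t\le t_+$ and $\gamma(t)=-\gamma_-$ for $t_+<t\le 1$, where $\gamma_\pm>0$ and $t_+\in(0,1)$, and assume that its average vanishes: $\langle\gamma\rangle=\int_0^1\gamma(\tau)\,d\tau=0$. For every $\varepsilon>0$ let $J_\varepsilon\ni t_0$ be an interval and $u_\varepsilon\in C(J_\varepsilon;H^2(\mathbb R^d))$ a maximal solution (one that cannot be extended to a strictly larger interval, forward or backward in time) of $$ i\partial_t u_\varepsilon+\gamma\left(\tfrac t\varepsilon\right)\Delta u_\varepsilon+|u_\varepsilon|^{p-1}u_\varepsilon=0,\qquad u_\varepsilon(t_0,\cdot)=\varphi, $$ where $\partial_t u_\varepsilon$ is the derivative in $L^2(\mathbb R^d)$ and the equation holds at every $t\in J_\varepsilon$ at which $\gamma(\cdot/\varepsilon)$ is continuous. Put $$ u_0(t,x)=\varphi(x)\,e^{i(t-t_0)|\varphi(x)|^{p-1}},\qquad t\in\mathbb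 R,\ x\in\mathbb R^d . $$ Then, for every compact time interval $I\subset\mathbb R$, one has $I\subset J_\varepsilon$ for all sufficiently small $\varepsilon>0$, and $$ u_\varepsilon\longrightarrow u_0\quad\text{in } L^\infty(I;H^2(\mathbb R^d))\quad\text{as }\varepsilon\to0_+ . $$ Moreover, $u_0$ solves the ordinary differential equation $$ i\partial_t u_0+|u_0|^{p-1}u_0=0,\qquad u_0(t_0,x)=\varphi(x), $$ both pointwise for every $x\in\mathbb R^d$ and as a function $u_0\in C(\mathbb R;H^2(\mathbb R^d))$ that is differentiable in time with values in $L^2(\mathbb R^d)$. -/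

import Mathlib

open MeasureTheory Filter Topology
open scoped ENNReal FourierTransform SchwartzMap Laplacian

noncomputable section

namespace DispersionNLS

/-- Euclidean space `ℝ^d`. -/
abbrev Space (d : ℕ) : Type := EuclideanSpace ℝ (Fin d)

/-- The complex space `L²(ℝ^d)`. -/
abbrev L2 (d : ℕ) : Type := Lp ℂ 2 (volume : Measure (Space d))

/-- Membership in the Sobolev space `H²(ℝ^d)`. -/
def MemH2 {d : ℕ} (f : L2 d) : Prop :=
  TemperedDistribution.MemSobolev 2 2 (f : 𝓢'(Space d, ℂ))

/-- The norm `‖f‖_{H²} = ‖(1 - Δ) f‖_{L²}`, with values in `[0, ∞]`. It is computed on the Fourier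
side; since `𝓕 f (ξ) = ∫ f(x) e^{-2πi x·ξ} dx`, the symbol of `1 - Δ` is `1 + |2πξ|²`. -/
def eH2Norm {d : ℕ} (f : L2 d) : ℝ≥0∞ :=
  eLpNorm (fun ξ : Space d => (1 + (2 * Real.pi * ‖ξ‖) ^ 2) * ‖(𝓕 f : L2 d) ξ‖) 2 volume

/-- The 1-periodic piecewise constant dispersion map: `γ(t) = γ₊` for `0 < t ≤ t₊` and
`γ(t) = -γ₋` for `t₊ < t ≤ 1`. -/
def dispersionMap (γp γm tp : ℝ) (t : ℝ) : ℝ :=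
  if toIocMod (one_pos : (0 : ℝ) < 1) 0 t ≤ tp then γp else -γm

/-- The average `⟨γ⟩` of a 1-periodic function. -/
def average (γ : ℝ → ℝ) : ℝ := ∫ τ in (0 : ℝ)..1, γ τ

/-- `u ∈ C(J; H²(ℝ^d))` solves `i ∂ₜu + g(t) Δu + |u|^{p-1} u = 0`, `u(t₀) = φ` on the interval `J`
(a nonempty interval of any kind containing `t₀`), where `g` is a piecewise continuous real
coefficient. The time derivative is taken in `L²(ℝ^d)` and `Δ` is the distributional Laplacian. The
equation is required at all times except at the jumps of `g`, where `u` is only continuous. -/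
structure IsSolution {d : ℕ} (p : ℝ) (g : ℝ → ℝ) (t₀ : ℝ) (φ : L2 d)
    (J : Set ℝ) (u : ℝ → L2 d) : Prop where
  ordConnected : J.OrdConnected
  mem : t₀ ∈ J
  initial : u t₀ = φ
  memH2 : ∀ t ∈ J, MemH2 (u t)
  continuous : ∀ t ∈ J, Tendsto (fun s => eH2Norm (u s - u t)) (𝓝[J] t) (𝓝 0)
  equation : ∀ t ∈ J, ContinuousAt g t →
    ∃ u' N : L2 d, HasDerivWithinAt u u' J t ∧
      (∀ᵐ x, N x = ((‖u t x‖ ^ (p - 1) : ℝ) : ℂ) * u t x) ∧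
      Complex.I • (u' : 𝓢'(Space d, ℂ)) + (g t : ℂ) • Δ (u t : 𝓢'(Space d, ℂ))
        + (N : 𝓢'(Space d, ℂ)) = 0

/-- A solution on `J` which has no extension to a strictly larger interval. -/
def IsMaximalSolution {d : ℕ} (p : ℝ) (g : ℝ → ℝ) (t₀ : ℝ) (φ : L2 d)
    (J : Set ℝ) (u : ℝ → L2 d) : Prop :=
  IsSolution p g t₀ φ J u ∧
    ∀ (J' : Set ℝ) (v : ℝ → L2 d), IsSolution p g t₀ φ J' v → J ⊆ J' → Set.EqOn u v J → J' = J

/-- The profile `φ(x) exp(i (t - t₀) |φ(x)|^{p-1})`. -/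
def profile {d : ℕ} (p t₀ : ℝ) (φ : Space d → ℂ) (t : ℝ) (x : Space d) : ℂ :=
  φ x * Complex.exp (Complex.I * (((t - t₀) * ‖φ x‖ ^ (p - 1) : ℝ) : ℂ))

theorem memLp_profile {d : ℕ} (p t₀ : ℝ) (φ : L2 d) (t : ℝ) :
    MemLp (profile p t₀ φ t) 2 (volume : Measure (Space d)) := by
  have hm : AEStronglyMeasurable (φ : Space d → ℂ) volume := Lp.aestronglyMeasurable φ
  refine (Lp.memLp φ).of_le ?_ (Eventually.of_forall fun x => ?_)
  · have h1 : AEMeasurable (φ : Space d → ℂ) volume := hm.aemeasurable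
    have h2 : AEMeasurable (profile p t₀ φ t) (volume : Measure (Space d)) := by
      unfold profile
      fun_prop
    exact h2.aestronglyMeasurable
  · unfold profile
    rw [norm_mul, mul_comm Complex.I, Complex.norm_exp_ofReal_mul_I, mul_one]

/-- The profile as an element of `L²(ℝ^d)`. -/
def profileL2 {d : ℕ} (p t₀ : ℝ) (φ : L2 d) (t : ℝ) : L2 d :=
  (memLp_profile p t₀ φ t).toLp (profile p t₀ φ t)

end DispersionNLS

end

open MeasureTheory Filter Topology
open scoped ENNReal NNReal FourierTransform SchwartzMap Laplacian BoundedContinuousFunction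

noncomputable section

namespace DispersionNLS

variable {d : ℕ}

/-! Write N(u) = |u|^{p-1}u and let G be the primitive of γ(·/ε) that vanishes at t₀. Conjugating
with the Schrödinger group `U` turns the equation into the Duhamel formula u(t) = U(G(t)) (φ + i ∫
U(-G(s)) N(u(s)) ds), integrated from t₀ to t. Since γ has mean zero, its primitive is periodic,
hence bounded, and rescaling gives |G| ≤ const·ε (`exists_isPhase_dispersionMap`). So U(G) tends
strongly to the identity and the formula becomes u₀ = φ + i ∫ N(u₀), which the profile solves
because |u₀| is conserved at every point.

The obstacle is the continuity of N in H². At p = 2 the second derivative of N has no limit at 0, so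
a Lipschitz bound in H² is not to be expected. The substitute is `eH2Norm_nl_sub_le`: the H²
distance of N(v) and N(k) is at most C times that of v and k, plus an error κ that is arbitrary once
v and k are uniformly close; C does not depend on κ. No chain rule for weak derivatives is used. H²
is described by second differences (`norm_secondDiff_le`, `eH2Norm_le_of_secondDiff`), the Taylor
remainders of N are quadratic in first differences, and a discrete Gagliardo–Nirenberg inequality
(`integral_diff_pow_four_le`) controls these by second differences. Near the zeros of k its
localised form `setIntegral_diff_pow_four_le` supplies a small factor.

A solution near the profile comes from a contraction in an exponentially weighted L² space, with N
truncated to be globally Lipschitz. Staying close to the profile, both in L² and in H², is a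
constraint closed in L² and preserved by the Duhamel operator when G is small
(`duhamel_mem_nearProfile`); Sobolev embedding for d ≤ 3 makes the truncation inactive. By
uniqueness and gluing, the maximal solution extends this one (`IsMaximalSolution.subset_and_eqOn`),
so no a priori estimate on u_ε is needed. -/

/-! ### Fourier multipliers on L². -/

theorem norm_sq_eq_integral (f : L2 d) : ‖f‖ ^ 2 = ∫ x, ‖f x‖ ^ 2 := by
  have h := L2.inner_def (𝕜 := ℂ) f f
  have h1 : ‖f‖ ^ 2 = RCLike.re (inner ℂ f f) := by
    rw [inner_self_eq_norm_sq]
  rw [h1, h, ← integral_re (L2.integrable_inner f f)]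
  refine integral_congr_ae (Eventually.of_forall fun x => ?_)
  simp only [inner_self_eq_norm_sq]

/-- Multiplication of `L²` functions by a bounded continuous function. -/
def mulBdd (m : Space d →ᵇ ℂ) : L2 d →L[ℂ] L2 d :=
  (ContinuousLinearMap.mul ℂ ℂ).holderL volume ∞ 2 2 (m.memLp_top.toLp m)

theorem coeFn_mulBdd (m : Space d →ᵇ ℂ) (f : L2 d) : mulBdd m f =ᵐ[volume] fun ξ => m ξ * f ξ := by
  have h1 := (ContinuousLinearMap.mul ℂ ℂ).coeFn_holder (r := 2)
    (m.memLp_top.toLp m : Lp ℂ ∞ (volume : Measure (Space d))) f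
  have h2 := (m.memLp_top (μ := (volume : Measure (Space d)))).coeFn_toLp
  filter_upwards [h1, h2] with x hx hy
  simp only [ContinuousLinearMap.mul_apply'] at hx
  rw [← hy]
  exact hx

/-- The Fourier multiplier with a bounded continuous symbol. -/
def mult (m : Space d →ᵇ ℂ) : L2 d →L[ℂ] L2 d :=
  (Lp.fourierTransformₗᵢ (Space d) ℂ).symm.toContinuousLinearEquiv.toContinuousLinearMap ∘L
    mulBdd m ∘L (Lp.fourierTransformₗᵢ (Space d) ℂ).toContinuousLinearEquiv.toContinuousLinearMap

theorem fourier_mult_eq (m : Space d →ᵇ ℂ) (f : L2 d) : 𝓕 (mult m f) = mulBdd m (𝓕 f) :=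
  (Lp.fourierTransformₗᵢ (Space d) ℂ).apply_symm_apply _

theorem fourier_mult (m : Space d →ᵇ ℂ) (f : L2 d) :
    (𝓕 (mult m f) : L2 d) =ᵐ[volume] fun ξ => m ξ * (𝓕 f : L2 d) ξ := by
  rw [fourier_mult_eq]
  exact coeFn_mulBdd _ _

theorem fourier_injective {f g : L2 d} (h : (𝓕 f : L2 d) = 𝓕 g) : f = g :=
  (Lp.fourierTransformₗᵢ (Space d) ℂ).injective h

theorem ext_fourier {f g : L2 d} (h : (𝓕 f : L2 d) =ᵐ[volume] (𝓕 g : L2 d)) : f = g :=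
  fourier_injective (Lp.ext h)

theorem fourier_sub' (f g : L2 d) :
    (𝓕 (f - g) : L2 d) =ᵐ[volume] fun ξ => (𝓕 f : L2 d) ξ - (𝓕 g : L2 d) ξ := by
  have h : (𝓕 (f - g) : L2 d) = 𝓕 f - 𝓕 g := (Lp.fourierTransformₗᵢ (Space d) ℂ).map_sub f g
  rw [h]
  exact Lp.coeFn_sub _ _

theorem fourier_add' (f g : L2 d) :
    (𝓕 (f + g) : L2 d) =ᵐ[volume] fun ξ => (𝓕 f : L2 d) ξ + (𝓕 g : L2 d) ξ := by
  have h : (𝓕 (f + g) : L2 d) = 𝓕 f + 𝓕 g := (Lp.fourierTransformₗᵢ (Space d) ℂ).map_add f g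
  rw [h]
  exact Lp.coeFn_add _ _

theorem fourier_smul' (c : ℂ) (f : L2 d) :
    (𝓕 (c • f) : L2 d) =ᵐ[volume] fun ξ => c * (𝓕 f : L2 d) ξ := by
  have h : (𝓕 (c • f) : L2 d) = c • 𝓕 f := (Lp.fourierTransformₗᵢ (Space d) ℂ).map_smul c f
  rw [h]
  exact Lp.coeFn_smul _ _

theorem mult_mul (m n : Space d →ᵇ ℂ) (f : L2 d) : mult (m * n) f = mult m (mult n f) := by
  apply ext_fourier
  filter_upwards [fourier_mult (m * n) f, fourier_mult m (mult n f), fourier_mult n f]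
    with ξ h1 h2 h3
  rw [h1, h2, h3, BoundedContinuousFunction.mul_apply, mul_assoc]

theorem mult_comm (m n : Space d →ᵇ ℂ) (f : L2 d) : mult m (mult n f) = mult n (mult m f) := by
  rw [← mult_mul, mul_comm, mult_mul]

theorem mult_one (f : L2 d) : mult 1 f = f := by
  apply ext_fourier
  filter_upwards [fourier_mult 1 f] with ξ h1
  rw [h1]; simp

theorem mult_sub (m n : Space d →ᵇ ℂ) (f : L2 d) : mult (m - n) f = mult m f - mult n f := by
  apply ext_fourier
  filter_upwards [fourier_mult (m - n) f, fourier_sub' (mult m f) (mult n f), fourier_mult m f,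
    fourier_mult n f] with ξ h1 h2 h3 h4
  rw [h1, h2, h3, h4, BoundedContinuousFunction.sub_apply, sub_mul]

theorem mult_add (m n : Space d →ᵇ ℂ) (f : L2 d) : mult (m + n) f = mult m f + mult n f := by
  apply ext_fourier
  filter_upwards [fourier_mult (m + n) f, fourier_add' (mult m f) (mult n f), fourier_mult m f,
    fourier_mult n f] with ξ h1 h2 h3 h4
  rw [h1, h2, h3, h4, BoundedContinuousFunction.add_apply, add_mul]

theorem mult_smul (c : ℂ) (n : Space d →ᵇ ℂ) (f : L2 d) : mult (c • n) f = c • mult n f := by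
  apply ext_fourier
  filter_upwards [fourier_mult (c • n) f, fourier_smul' c (mult n f), fourier_mult n f]
    with ξ h1 h2 h3
  rw [h1, h2, h3, BoundedContinuousFunction.smul_apply, smul_eq_mul, mul_assoc]

theorem norm_fourier' (f : L2 d) : ‖(𝓕 f : L2 d)‖ = ‖f‖ :=
  (Lp.fourierTransformₗᵢ (Space d) ℂ).norm_map f

theorem norm_mult_le (m : Space d →ᵇ ℂ) {C : ℝ} (hC : ∀ ξ, ‖m ξ‖ ≤ C) (f : L2 d) :
    ‖mult m f‖ ≤ C * ‖f‖ := by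
  rw [← norm_fourier' (mult m f), ← norm_fourier' f]
  refine Lp.norm_le_mul_norm_of_ae_le_mul ?_
  filter_upwards [fourier_mult m f] with ξ h1
  rw [h1, norm_mul]
  gcongr
  exact hC ξ

theorem norm_mult_eq (m : Space d →ᵇ ℂ) (hC : ∀ ξ, ‖m ξ‖ = 1) (f : L2 d) :
    ‖mult m f‖ = ‖f‖ := by
  rw [← norm_fourier' (mult m f), ← norm_fourier' f]
  apply le_antisymm <;> refine Lp.norm_le_norm_of_ae_le ?_ <;>
  · filter_upwards [fourier_mult m f] with ξ h1
    rw [h1, norm_mul, hC, one_mul]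

/-- Dominated convergence on the Fourier side: pointwise convergence of uniformly bounded symbols is
enough for strong convergence. The continuity of the Schrödinger group, its derivative on H² and the
continuity of translations are all instances. -/
theorem tendsto_mult {ι : Type*} {l : Filter ι} [l.IsCountablyGenerated] (m : ι → Space d →ᵇ ℂ)
    (m₀ : Space d →ᵇ ℂ) (C : ℝ) (hC : ∀ i ξ, ‖m i ξ‖ ≤ C)
    (h : ∀ ξ, Tendsto (fun i => m i ξ) l (𝓝 (m₀ ξ))) (f : L2 d) :
    Tendsto (fun i => mult (m i) f) l (𝓝 (mult m₀ f)) := by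
  rw [tendsto_iff_norm_sub_tendsto_zero]
  have key : Tendsto (fun i => ‖mult (m i) f - mult m₀ f‖ ^ 2) l (𝓝 0) := by
    have e : ∀ i, ‖mult (m i) f - mult m₀ f‖ ^ 2 =
        ∫ ξ, ‖(m i ξ - m₀ ξ) * (𝓕 f : L2 d) ξ‖ ^ 2 := by
      intro i
      rw [← mult_sub, ← norm_fourier', norm_sq_eq_integral]
      refine integral_congr_ae ?_
      filter_upwards [fourier_mult (m i - m₀) f] with ξ h1
      rw [h1]; simp
    simp_rw [e]
    have : (0 : ℝ) = ∫ ξ : Space d, (0 : ℝ) := by simp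
    rw [this]
    refine tendsto_integral_filter_of_dominated_convergence
      (fun ξ => (C + ‖m₀‖) ^ 2 * ‖(𝓕 f : L2 d) ξ‖ ^ 2) ?_ ?_ ?_ ?_
    · refine Eventually.of_forall fun i => ?_
      have : AEStronglyMeasurable (𝓕 f : L2 d) volume := Lp.aestronglyMeasurable _
      exact (((((m i).continuous.sub m₀.continuous).aestronglyMeasurable).mul this).norm.pow 2)
    · refine Eventually.of_forall fun i => Eventually.of_forall fun ξ => ?_
      rw [Real.norm_of_nonneg (by positivity), norm_mul, mul_pow]
      gcongr
      exact (norm_sub_le _ _).trans (add_le_add (hC i ξ) (m₀.norm_coe_le_norm ξ))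
    · exact ((Lp.memLp (𝓕 f : L2 d)).integrable_norm_pow (by norm_num)).const_mul _
    · refine Eventually.of_forall fun ξ => ?_
      have h1 : Tendsto (fun i => ‖(m i ξ - m₀ ξ) * (𝓕 f : L2 d) ξ‖ ^ 2) l
          (𝓝 (‖(m₀ ξ - m₀ ξ) * (𝓕 f : L2 d) ξ‖ ^ 2)) :=
        ((((h ξ).sub_const _).mul_const _).norm.pow 2)
      simpa using h1
  have := key.sqrt
  simpa using this

/-! ### The H² norm on the Fourier side. -/

/-- The symbol of `1 - Δ`. -/
def wsym (ξ : Space d) : ℝ := 1 + (2 * Real.pi * ‖ξ‖) ^ 2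

theorem one_le_wsym (ξ : Space d) : 1 ≤ wsym ξ := by
  unfold wsym; nlinarith [sq_nonneg (2 * Real.pi * ‖ξ‖)]

theorem wsym_pos (ξ : Space d) : 0 < wsym ξ := zero_lt_one.trans_le (one_le_wsym ξ)

@[fun_prop]
theorem continuous_wsym : Continuous (wsym : Space d → ℝ) := by unfold wsym; fun_prop

theorem eH2Norm_eq (f : L2 d) :
    eH2Norm f = eLpNorm (fun ξ => (wsym ξ : ℂ) * (𝓕 f : L2 d) ξ) 2 volume := by
  unfold eH2Norm
  refine eLpNorm_congr_norm_ae (Eventually.of_forall fun ξ => ?_)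
  have := wsym_pos ξ
  rw [norm_mul, norm_mul, norm_norm, Complex.norm_real]
  rfl

theorem memLp_lift {f : L2 d} (hf : eH2Norm f < ∞) :
    MemLp (fun ξ => (wsym ξ : ℂ) * (𝓕 f : L2 d) ξ) 2 volume := by
  refine ⟨?_, by rwa [← eH2Norm_eq]⟩
  exact (by fun_prop : Continuous fun ξ : Space d => (wsym ξ : ℂ)).aestronglyMeasurable.mul
    (Lp.aestronglyMeasurable _)

open Classical in
/-- `(1 - Δ) f` for `f ∈ H²`. -/
def lift (f : L2 d) : L2 d :=
  if h : eH2Norm f < ∞ then 𝓕⁻ ((memLp_lift h).toLp _) else 0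

theorem fourier_lift {f : L2 d} (hf : eH2Norm f < ∞) :
    (𝓕 (lift f) : L2 d) =ᵐ[volume] fun ξ => (wsym ξ : ℂ) * (𝓕 f : L2 d) ξ := by
  have : (𝓕 (lift f) : L2 d) = (memLp_lift hf).toLp _ := by
    rw [lift, dif_pos hf]
    exact (Lp.fourierTransformₗᵢ (Space d) ℂ).apply_symm_apply _
  rw [this]
  exact (memLp_lift hf).coeFn_toLp

theorem enorm_eq_of_fourier (g : L2 d) {F : Space d → ℂ} (h : (𝓕 g : L2 d) =ᵐ[volume] F) :
    eLpNorm F 2 volume = ‖g‖ₑ := by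
  rw [← eLpNorm_congr_ae h, ← Lp.enorm_def, ← ofReal_norm, norm_fourier', ofReal_norm]

theorem eH2Norm_mult {f : L2 d} (hf : eH2Norm f < ∞) (m : Space d →ᵇ ℂ) :
    eH2Norm (mult m f) = ‖mult m (lift f)‖ₑ := by
  rw [eH2Norm_eq]
  apply enorm_eq_of_fourier
  filter_upwards [fourier_mult m f, fourier_mult m (lift f), fourier_lift hf] with ξ h1 h2 h3
  rw [h2, h3, h1]; ring

theorem eH2Norm_eq_lift {f : L2 d} (hf : eH2Norm f < ∞) : eH2Norm f = ‖lift f‖ₑ := by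
  have := eH2Norm_mult hf 1
  rwa [mult_one, mult_one] at this

theorem eH2Norm_add_le (f g : L2 d) : eH2Norm (f + g) ≤ eH2Norm f + eH2Norm g := by
  have h : eH2Norm (f + g) = eLpNorm ((fun ξ => (wsym ξ : ℂ) * (𝓕 f : L2 d) ξ) +
      (fun ξ => (wsym ξ : ℂ) * (𝓕 g : L2 d) ξ)) 2 volume := by
    rw [eH2Norm_eq]
    apply eLpNorm_congr_ae
    filter_upwards [fourier_add' f g] with ξ h
    simp only [Pi.add_apply]
    rw [h]; ring
  rw [h, eH2Norm_eq, eH2Norm_eq]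
  have hw : Continuous fun ξ : Space d => (wsym ξ : ℂ) := by fun_prop
  exact eLpNorm_add_le (hw.aestronglyMeasurable.mul (Lp.aestronglyMeasurable _))
    (hw.aestronglyMeasurable.mul (Lp.aestronglyMeasurable _)) (by norm_num)

theorem eH2Norm_smul (c : ℂ) (f : L2 d) : eH2Norm (c • f) = ‖c‖ₑ * eH2Norm f := by
  rw [eH2Norm_eq, eH2Norm_eq, ← eLpNorm_const_smul]
  apply eLpNorm_congr_ae
  filter_upwards [fourier_smul' c f] with ξ h
  simp only [Pi.smul_apply, smul_eq_mul]
  rw [h]; ring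

theorem eH2Norm_neg (f : L2 d) : eH2Norm (-f) = eH2Norm f := by
  have := eH2Norm_smul (-1) f
  simpa using this

theorem eH2Norm_sub_le (f g : L2 d) : eH2Norm (f - g) ≤ eH2Norm f + eH2Norm g := by
  rw [sub_eq_add_neg, ← eH2Norm_neg g]
  exact eH2Norm_add_le _ _

theorem lift_sub {f g : L2 d} (hf : eH2Norm f < ∞) (hg : eH2Norm g < ∞) :
    lift (f - g) = lift f - lift g := by
  have h : eH2Norm (f - g) < ∞ := (eH2Norm_sub_le f g).trans_lt (ENNReal.add_lt_top.2 ⟨hf, hg⟩)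
  apply ext_fourier
  filter_upwards [fourier_lift h, fourier_lift hf, fourier_lift hg, fourier_sub' f g,
    fourier_sub' (lift f) (lift g)] with ξ h1 h2 h3 h4 h5
  rw [h1, h5, h2, h3, h4]; ring

theorem enorm_le_eH2Norm (f : L2 d) : ‖f‖ₑ ≤ eH2Norm f := by
  rw [eH2Norm_eq, ← enorm_eq_of_fourier f (EventuallyEq.refl _ _)]
  refine eLpNorm_mono fun ξ => ?_
  have := one_le_wsym ξ
  rw [norm_mul, Complex.norm_real, Real.norm_of_nonneg (by linarith)]
  exact le_mul_of_one_le_left (norm_nonneg _) this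

theorem norm_le_of_eH2Norm_le {f : L2 d} {r : ℝ} (hr : 0 ≤ r)
    (h : eH2Norm f ≤ ENNReal.ofReal r) : ‖f‖ ≤ r := by
  have := (enorm_le_eH2Norm f).trans h
  rw [← ofReal_norm] at this
  exact (ENNReal.ofReal_le_ofReal_iff hr).1 this

/-- The bounded symbols `min (1 + |2πξ|²) n`. -/
def wtrunc (n : ℕ) : Space d →ᵇ ℂ :=
  BoundedContinuousFunction.ofNormedAddCommGroup (fun ξ => ((min (wsym ξ) n : ℝ) : ℂ))
    (by fun_prop) n (fun ξ => by
      rw [Complex.norm_real, Real.norm_of_nonneg (le_min (wsym_pos ξ).le n.cast_nonneg)]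
      exact min_le_right _ _)

@[simp]
theorem wtrunc_apply (n : ℕ) (ξ : Space d) : wtrunc n ξ = ((min (wsym ξ) n : ℝ) : ℂ) := rfl

/-- Fatou's lemma, as the truncated symbols increase to `wsym`. An H² bound thus becomes a family of
bounds on continuous operators of L²: H² balls are closed in L², and H² estimates pass through
integrals taken in L². -/
theorem eH2Norm_le_iff (f : L2 d) (r : ℝ≥0∞) :
    eH2Norm f ≤ r ↔ ∀ n, ‖mult (wtrunc n) f‖ₑ ≤ r := by
  constructor
  · intro h n
    refine le_trans ?_ h
    rw [← enorm_eq_of_fourier _ (fourier_mult (wtrunc n) f), eH2Norm_eq]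
    refine eLpNorm_mono fun ξ => ?_
    rw [norm_mul, norm_mul]
    gcongr
    rw [wtrunc_apply, Complex.norm_real, Complex.norm_real,
      Real.norm_of_nonneg (le_min (wsym_pos ξ).le n.cast_nonneg),
      Real.norm_of_nonneg (wsym_pos ξ).le]
    exact min_le_left _ _
  · intro h
    rw [eH2Norm_eq]
    have hlim := Lp.eLpNorm_lim_le_liminf_eLpNorm (μ := volume) (p := 2)
      (f := fun (n : ℕ) (ξ : Space d) => wtrunc n ξ * (𝓕 f : L2 d) ξ) (fun n =>
        (wtrunc n).continuous.aestronglyMeasurable.mul (Lp.aestronglyMeasurable _))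
      (fun ξ => (wsym ξ : ℂ) * (𝓕 f : L2 d) ξ)
      (Eventually.of_forall fun ξ => by
        apply Tendsto.congr' _ tendsto_const_nhds
        filter_upwards [eventually_ge_atTop ⌈wsym ξ⌉₊] with n hn
        rw [wtrunc_apply, min_eq_left ((Nat.le_ceil _).trans (by exact_mod_cast hn))])
    refine hlim.trans ?_
    have : ∀ n : ℕ, eLpNorm (fun (ξ : Space d) => wtrunc n ξ * (𝓕 f : L2 d) ξ) 2 volume ≤ r :=
      fun n => by
        rw [enorm_eq_of_fourier _ (fourier_mult (wtrunc n) f)]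
        exact h n
    exact (liminf_le_liminf (Eventually.of_forall this)).trans (by simp)

theorem eH2Norm_le_ofReal_iff (f : L2 d) {r : ℝ} (hr : 0 ≤ r) :
    eH2Norm f ≤ ENNReal.ofReal r ↔ ∀ n, ‖mult (wtrunc n) f‖ ≤ r := by
  rw [eH2Norm_le_iff]
  refine forall_congr' fun n => ?_
  rw [← ofReal_norm, ENNReal.ofReal_le_ofReal_iff hr]

theorem isClosed_eH2Norm_le (r : ℝ≥0∞) : IsClosed {f : L2 d | eH2Norm f ≤ r} := by
  simp_rw [eH2Norm_le_iff, Set.ofPred_forall]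
  exact isClosed_iInter fun n =>
    isClosed_le (continuous_enorm.comp (mult (wtrunc n)).continuous) continuous_const

theorem eH2Norm_mult_le {m : Space d →ᵇ ℂ} (hm : ∀ ξ, ‖m ξ‖ ≤ 1) (f : L2 d) :
    eH2Norm (mult m f) ≤ eH2Norm f := by
  rw [eH2Norm_le_iff]
  intro n
  rw [mult_comm, ← ofReal_norm]
  refine le_trans (ENNReal.ofReal_le_ofReal ((norm_mult_le m hm _).trans_eq (one_mul _))) ?_
  rw [ofReal_norm]
  exact (eH2Norm_le_iff _ _).1 le_rfl n

theorem toTempered_injective {f g : L2 d} (h : (f : 𝓢'(Space d, ℂ)) = (g : 𝓢'(Space d, ℂ))) :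
    f = g := by
  have := LinearMap.ker_eq_bot.1
    (Lp.ker_toTemperedDistributionCLM_eq_bot (F := ℂ) (μ := (volume : Measure (Space d))) (p := 2))
  exact this h

theorem mult_eq_fourierMultiplierCLM (m : Space d →ᵇ ℂ)
    (hm : (m : Space d → ℂ).HasTemperateGrowth) (f : L2 d) :
    ((mult m f : L2 d) : 𝓢'(Space d, ℂ)) =
      TemperedDistribution.fourierMultiplierCLM ℂ m (f : 𝓢'(Space d, ℂ)) := by
  have h1 : mult m f = 𝓕⁻ (mulBdd m (𝓕 f)) := rfl
  have h2 : mulBdd m (𝓕 f) = (m.memLp_top.toLp m : Lp ℂ ∞ volume) • (𝓕 f : L2 d) := rfl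
  rw [h1, ← Lp.fourierInv_toTemperedDistribution_eq, h2,
    Lp.toTemperedDistribution_smul_eq hm, TemperedDistribution.fourierMultiplierCLM_apply,
    Lp.fourier_toTemperedDistribution_eq]

attribute [irreducible] mult lift

/-! ### Sobolev membership and the distributional Laplacian. -/

/-- The symbol `(1 + |ξ|²)⁻¹` of the Bessel potential of order `-2`. -/
def besselSymbol : Space d →ᵇ ℂ :=
  BoundedContinuousFunction.ofNormedAddCommGroup
    (fun ξ => (((1 + ‖ξ‖ ^ 2) ^ ((-2 : ℝ) / 2) : ℝ) : ℂ))
    (Complex.continuous_ofReal.comp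
      (Function.hasTemperateGrowth_one_add_norm_sq_rpow (Space d) ((-2 : ℝ) / 2)).1.continuous)
    1 (fun ξ => by
      rw [Complex.norm_real, Real.norm_of_nonneg (by positivity)]
      exact Real.rpow_le_one_of_one_le_of_nonpos (by simp) (by norm_num))

theorem besselSymbol_apply (ξ : Space d) : besselSymbol ξ = (((1 + ‖ξ‖ ^ 2)⁻¹ : ℝ) : ℂ) := by
  change (((1 + ‖ξ‖ ^ 2) ^ ((-2 : ℝ) / 2) : ℝ) : ℂ) = _
  rw [show (-2 : ℝ) / 2 = -1 by norm_num, Real.rpow_neg_one]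

theorem mult_besselSymbol_eq (f : L2 d) : ((mult besselSymbol f : L2 d) : 𝓢'(Space d, ℂ)) =
    TemperedDistribution.besselPotential (Space d) ℂ (-2) (f : 𝓢'(Space d, ℂ)) := by
  rw [mult_eq_fourierMultiplierCLM]
  · rfl
  · change Function.HasTemperateGrowth
      (fun ξ : Space d => (((1 + ‖ξ‖ ^ 2) ^ ((-2 : ℝ) / 2) : ℝ) : ℂ))
    fun_prop

theorem memH2_iff_exists (f : L2 d) : MemH2 f ↔ ∃ g : L2 d, f = mult besselSymbol g := by
  constructor
  · rintro ⟨g, hg⟩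
    refine ⟨g, toTempered_injective ?_⟩
    rw [mult_besselSymbol_eq, ← hg]
    simp
  · rintro ⟨g, rfl⟩
    refine ⟨g, ?_⟩
    rw [mult_besselSymbol_eq]
    simp

/-- The bounded symbol `(1 + |ξ|²) / (1 + |2πξ|²)`. -/
def ratioSymbol : Space d →ᵇ ℂ :=
  BoundedContinuousFunction.ofNormedAddCommGroup
    (fun ξ => (((1 + ‖ξ‖ ^ 2) / wsym ξ : ℝ) : ℂ))
    (Complex.continuous_ofReal.comp (by
      refine Continuous.div (by fun_prop) (by fun_prop) fun ξ => (wsym_pos ξ).ne'))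
    1 (fun ξ => by
      have := wsym_pos ξ
      rw [Complex.norm_real, Real.norm_of_nonneg (by positivity), div_le_one this, wsym]
      have h3 : 1 ≤ 2 * Real.pi := by linarith [Real.pi_gt_three]
      have : ‖ξ‖ ≤ 2 * Real.pi * ‖ξ‖ := le_mul_of_one_le_left (norm_nonneg _) h3
      gcongr)

theorem eq_mult_besselSymbol {f : L2 d} (hf : eH2Norm f < ∞) :
    f = mult besselSymbol (mult ratioSymbol (lift f)) := by
  apply ext_fourier
  filter_upwards [fourier_mult besselSymbol (mult ratioSymbol (lift f)),
    fourier_mult ratioSymbol (lift f), fourier_lift hf] with ξ h1 h2 h3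
  rw [h1, h2, h3, besselSymbol_apply]
  change _ = _ * ((((1 + ‖ξ‖ ^ 2) / wsym ξ : ℝ) : ℂ) * _)
  have h4 : (wsym ξ : ℂ) ≠ 0 := by exact_mod_cast (wsym_pos ξ).ne'
  have h5 : ((1 + ‖ξ‖ ^ 2 : ℝ) : ℂ) ≠ 0 := by
    have : (1 + ‖ξ‖ ^ 2 : ℝ) ≠ 0 := by positivity
    exact_mod_cast this
  rw [Complex.ofReal_inv, Complex.ofReal_div]
  field_simp

/-- `MemH2` rests on the weight 1 + |ξ|² and `eH2Norm` on 1 + |2πξ|²; each is bounded by a constant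
times the other, with constants 1 and (2π)². -/
theorem memH2_iff (f : L2 d) : MemH2 f ↔ eH2Norm f < ∞ := by
  rw [memH2_iff_exists]
  constructor
  · rintro ⟨g, rfl⟩
    have h : eH2Norm (mult besselSymbol g) ≤ ENNReal.ofReal ((2 * Real.pi) ^ 2) * ‖g‖ₑ := by
      rw [eH2Norm_eq, ← enorm_eq_of_fourier g (EventuallyEq.refl _ _)]
      refine eLpNorm_le_mul_eLpNorm_of_ae_le_mul ?_ 2
      filter_upwards [fourier_mult besselSymbol g] with ξ h1
      rw [h1, besselSymbol_apply, ← mul_assoc, norm_mul, ← Complex.ofReal_mul, Complex.norm_real,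
        Real.norm_of_nonneg (mul_nonneg (wsym_pos ξ).le (by positivity))]
      gcongr
      rw [← div_eq_mul_inv, div_le_iff₀ (by positivity), wsym]
      have h3 : 1 ≤ (2 * Real.pi) ^ 2 := by nlinarith [Real.pi_gt_three]
      nlinarith
    exact h.trans_lt (ENNReal.mul_lt_top ENNReal.ofReal_lt_top (by simp))
  · intro h
    exact ⟨_, eq_mult_besselSymbol h⟩

/-- The symbol of `Δ (1 - Δ)⁻¹`. -/
def lapSymbol : Space d →ᵇ ℂ :=
  BoundedContinuousFunction.ofNormedAddCommGroup
    (fun ξ => ((-(2 * Real.pi * ‖ξ‖) ^ 2 / wsym ξ : ℝ) : ℂ))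
    (Complex.continuous_ofReal.comp (by
      refine Continuous.div (by fun_prop) (by fun_prop) fun ξ => (wsym_pos ξ).ne'))
    1 (fun ξ => by
      have := wsym_pos ξ
      rw [Complex.norm_real, neg_div, norm_neg, Real.norm_of_nonneg (by positivity),
        div_le_one this, wsym]
      linarith)

/-- The Laplacian on `H²`. -/
def lap (f : L2 d) : L2 d := mult lapSymbol (lift f)

/-- The symbol of `Δ (1 - (2π)⁻²Δ)⁻¹`. -/
def lapBesselSymbol : Space d →ᵇ ℂ :=
  BoundedContinuousFunction.ofNormedAddCommGroup
    (fun ξ => (((1 + ‖ξ‖ ^ 2) ^ ((-2 : ℝ) / 2) : ℝ) : ℂ) * ((-(2 * Real.pi) ^ 2 * ‖ξ‖ ^ 2 : ℝ) : ℂ))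
    ((besselSymbol (d := d)).continuous.mul (by fun_prop))
    ((2 * Real.pi) ^ 2) (fun ξ => by
      change ‖besselSymbol ξ * _‖ ≤ _
      rw [besselSymbol_apply, ← Complex.ofReal_mul, Complex.norm_real, mul_comm, neg_mul, neg_mul,
        norm_neg, Real.norm_of_nonneg (by positivity), ← div_eq_mul_inv,
        div_le_iff₀ (by positivity)]
      nlinarith [sq_nonneg (2 * Real.pi)])

/-- Once f is the Bessel potential of an L² function, Δf is a composition of two distributional
multipliers of temperate growth, and their product `lapBesselSymbol` is bounded. `ratioSymbol`
converts between the two normalisations of the frequency. -/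
theorem laplacian_toTempered {f : L2 d} (hf : eH2Norm f < ∞) :
    Δ (f : 𝓢'(Space d, ℂ)) = ((lap f : L2 d) : 𝓢'(Space d, ℂ)) := by
  set g := mult ratioSymbol (lift f) with hg
  have e : lap f = mult lapBesselSymbol g := by
    apply ext_fourier
    filter_upwards [fourier_mult lapSymbol (lift f), fourier_mult lapBesselSymbol g,
      fourier_mult ratioSymbol (lift f)] with ξ h1 h2 h3
    rw [lap, h1, h2, hg, h3]
    change ((-(2 * Real.pi * ‖ξ‖) ^ 2 / wsym ξ : ℝ) : ℂ) * _ =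
      (besselSymbol ξ * _) * ((((1 + ‖ξ‖ ^ 2) / wsym ξ : ℝ) : ℂ) * _)
    rw [besselSymbol_apply, ← mul_assoc, ← Complex.ofReal_mul, ← Complex.ofReal_mul]
    congr 2
    have := (wsym_pos ξ).ne'
    have : (1 + ‖ξ‖ ^ 2 : ℝ) ≠ 0 := by positivity
    field_simp
  have hgr : (fun ξ : Space d => (((1 + ‖ξ‖ ^ 2) ^ ((-2 : ℝ) / 2) : ℝ) : ℂ)).HasTemperateGrowth := by
    fun_prop
  have hgr2 : (fun ξ : Space d => ((-(2 * Real.pi) ^ 2 * ‖ξ‖ ^ 2 : ℝ) : ℂ)).HasTemperateGrowth := by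
    fun_prop
  have hgr3 : (fun ξ : Space d => ((‖ξ‖ ^ 2 : ℝ) : ℂ)).HasTemperateGrowth := by
    fun_prop
  have hgr4 : (lapBesselSymbol : Space d → ℂ).HasTemperateGrowth := hgr.mul hgr2
  rw [e, mult_eq_fourierMultiplierCLM _ hgr4]
  conv_lhs => rw [eq_mult_besselSymbol hf]
  rw [mult_eq_fourierMultiplierCLM besselSymbol hgr,
    TemperedDistribution.laplacian_eq_fourierMultiplierCLM,
    show (besselSymbol : Space d → ℂ) = fun ξ => (((1 + ‖ξ‖ ^ 2) ^ ((-2 : ℝ) / 2) : ℝ) : ℂ) from rfl,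
    TemperedDistribution.fourierMultiplierCLM_fourierMultiplierCLM_apply hgr hgr3]
  rw [← Complex.coe_smul, ← smul_apply,
    ← TemperedDistribution.fourierMultiplierCLM_smul (hgr.mul hgr3)]
  congr 2
  ext ξ
  simp only [Pi.smul_apply, Pi.mul_apply, smul_eq_mul]
  change _ = _ * ((-(2 * Real.pi) ^ 2 * ‖ξ‖ ^ 2 : ℝ) : ℂ)
  push_cast
  ring

/-! ### The Schrödinger group. -/

theorem real_smul_eq (r : ℝ) (f : L2 d) : r • f = (r : ℂ) • f :=
  RCLike.real_smul_eq_coe_smul (K := ℂ) r f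

/-- The symbol of `exp (i τ Δ)`. -/
def schrodingerSymbol (τ : ℝ) : Space d →ᵇ ℂ :=
  BoundedContinuousFunction.ofNormedAddCommGroup
    (fun ξ => Complex.exp (((-τ * (2 * Real.pi * ‖ξ‖) ^ 2 : ℝ) : ℂ) * Complex.I))
    (by fun_prop) 1 (fun ξ => (Complex.norm_exp_ofReal_mul_I _).le)

theorem schrodingerSymbol_apply (τ : ℝ) (ξ : Space d) : schrodingerSymbol τ ξ =
    Complex.exp (((-τ * (2 * Real.pi * ‖ξ‖) ^ 2 : ℝ) : ℂ) * Complex.I) := rfl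

theorem norm_schrodingerSymbol (τ : ℝ) (ξ : Space d) : ‖schrodingerSymbol τ ξ‖ = 1 :=
  Complex.norm_exp_ofReal_mul_I _

/-- The Schrödinger group `exp (i τ Δ)`. -/
def U (τ : ℝ) : L2 d →L[ℂ] L2 d := mult (schrodingerSymbol τ)

@[simp]
theorem norm_U (τ : ℝ) (f : L2 d) : ‖U τ f‖ = ‖f‖ := norm_mult_eq _ (norm_schrodingerSymbol τ) f

theorem U_add (σ τ : ℝ) (f : L2 d) : U (σ + τ) f = U σ (U τ f) := by
  rw [U, U, U, ← mult_mul]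
  congr 2
  ext ξ
  rw [BoundedContinuousFunction.mul_apply, schrodingerSymbol_apply, schrodingerSymbol_apply,
    schrodingerSymbol_apply, ← Complex.exp_add]
  congr 1
  push_cast
  ring

@[simp]
theorem U_zero (f : L2 d) : U 0 f = f := by
  rw [U, show schrodingerSymbol 0 = (1 : Space d →ᵇ ℂ) from ?_, mult_one]
  ext ξ
  rw [schrodingerSymbol_apply]; simp

@[simp]
theorem U_U_neg (τ : ℝ) (f : L2 d) : U τ (U (-τ) f) = f := by
  rw [← U_add]; simp

theorem eH2Norm_U_le (τ : ℝ) (f : L2 d) : eH2Norm (U τ f) ≤ eH2Norm f :=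
  eH2Norm_mult_le (fun ξ => (norm_schrodingerSymbol τ ξ).le) f

theorem tendsto_U (τ : ℝ) (f : L2 d) : Tendsto (fun σ => U σ f) (𝓝 τ) (𝓝 (U τ f)) := by
  refine tendsto_mult _ _ 1 (fun σ ξ => (norm_schrodingerSymbol σ ξ).le) (fun ξ => ?_) f
  have : Continuous fun σ : ℝ => schrodingerSymbol σ ξ := by
    simp_rw [schrodingerSymbol_apply]; fun_prop
  exact this.tendsto τ

/-- Since every `U τ` is an isometry, strong continuity in τ upgrades to joint continuity. This is
needed because the phase and the function both move with time. -/
theorem continuous_U_uncurry : Continuous fun q : ℝ × L2 d => U q.1 q.2 := by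
  rw [continuous_iff_continuousAt]
  rintro ⟨τ, f⟩
  rw [ContinuousAt, tendsto_iff_norm_sub_tendsto_zero]
  have h1 : Tendsto (fun q : ℝ × L2 d => ‖q.2 - f‖ + ‖U q.1 f - U τ f‖) (𝓝 (τ, f)) (𝓝 (0 + 0)) := by
    refine Tendsto.add ?_ ?_
    · have : Continuous fun q : ℝ × L2 d => ‖q.2 - f‖ := by fun_prop
      simpa using this.tendsto (τ, f)
    · have := (tendsto_iff_norm_sub_tendsto_zero.1 (tendsto_U τ f))
      exact this.comp (continuous_fst.tendsto (τ, f))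
  rw [add_zero] at h1
  refine squeeze_zero (fun _ => norm_nonneg _) (fun q => ?_) h1
  calc ‖U q.1 q.2 - U τ f‖ = ‖U q.1 (q.2 - f) + (U q.1 f - U τ f)‖ := by
        rw [map_sub]; congr 1; abel
    _ ≤ _ := (norm_add_le _ _).trans (by rw [norm_U])

theorem tendsto_U_apply {ι : Type*} {l : Filter ι} {a : ι → ℝ} {f : ι → L2 d}
    {a₀ : ℝ} {f₀ : L2 d} (ha : Tendsto a l (𝓝 a₀)) (hf : Tendsto f l (𝓝 f₀)) :
    Tendsto (fun i => U (a i) (f i)) l (𝓝 (U a₀ f₀)) := by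
  have h1 : Tendsto (fun i => (a i, f i)) l (𝓝 (a₀, f₀)) := ha.prodMk_nhds hf
  have h2 : Tendsto (fun q : ℝ × L2 d => U q.1 q.2) (𝓝 (a₀, f₀)) (𝓝 (U a₀ f₀)) :=
    continuous_U_uncurry.tendsto (a₀, f₀)
  exact Tendsto.comp (g := fun q : ℝ × L2 d => U q.1 q.2) (f := fun i => (a i, f i)) h2 h1

theorem lift_U {f : L2 d} (hf : eH2Norm f < ∞) (τ : ℝ) : lift (U τ f) = U τ (lift f) := by
  have h := (eH2Norm_U_le τ f).trans_lt hf
  apply ext_fourier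
  filter_upwards [fourier_lift h, fourier_lift hf, fourier_mult (schrodingerSymbol τ) f,
    fourier_mult (schrodingerSymbol τ) (lift f)] with ξ h1 h2 h3 h4
  rw [h1, U, h4, h2, h3]; ring

theorem lap_U {f : L2 d} (hf : eH2Norm f < ∞) (τ : ℝ) : lap (U τ f) = U τ (lap f) := by
  rw [lap, lift_U hf, U, mult_comm, lap]

theorem hasDerivAt_schrodingerSymbol (ξ : Space d) :
    HasDerivAt (fun σ : ℝ => schrodingerSymbol σ ξ)
      (((-(2 * Real.pi * ‖ξ‖) ^ 2 : ℝ) : ℂ) * Complex.I) 0 := by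
  have h2 : HasDerivAt (fun σ : ℝ => -σ * (2 * Real.pi * ‖ξ‖) ^ 2)
      (-1 * (2 * Real.pi * ‖ξ‖) ^ 2) 0 := ((hasDerivAt_id 0).neg.mul_const _)
  rw [neg_one_mul] at h2
  have h1 := (h2.ofReal_comp.mul_const Complex.I).cexp
  have e : Complex.exp (((-(0 : ℝ) * (2 * Real.pi * ‖ξ‖) ^ 2 : ℝ) : ℂ) * Complex.I) = 1 := by simp
  rw [e, one_mul] at h1
  exact h1

theorem continuous_slopeSymbol (σ : ℝ) : Continuous fun ξ : Space d =>
    (σ : ℂ)⁻¹ * (schrodingerSymbol σ ξ - 1) * (((wsym ξ)⁻¹ : ℝ) : ℂ) := by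
  have h1 : Continuous fun ξ : Space d => (wsym ξ)⁻¹ :=
    continuous_wsym.inv₀ fun ξ => (wsym_pos ξ).ne'
  exact (continuous_const.mul ((schrodingerSymbol σ).continuous.sub continuous_const)).mul
    (Complex.continuous_ofReal.comp h1)

/-- From |e^{iθ} - 1| ≤ |θ|: the factor |2πξ|² that appears is absorbed by `wsym`, uniformly in σ.
This is the domination behind the derivative of the group on H². -/
theorem slopeSymbol_bound (σ : ℝ) (ξ : Space d) :
    ‖(σ : ℂ)⁻¹ * (schrodingerSymbol σ ξ - 1) * (((wsym ξ)⁻¹ : ℝ) : ℂ)‖ ≤ 1 := by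
  rw [schrodingerSymbol_apply, norm_mul, norm_mul, mul_comm _ Complex.I, norm_inv,
    Complex.norm_real, Complex.norm_real]
  have h1 : ‖Complex.exp (Complex.I * ((-σ * (2 * Real.pi * ‖ξ‖) ^ 2 : ℝ) : ℂ)) - 1‖ ≤
    ‖-σ * (2 * Real.pi * ‖ξ‖) ^ 2‖ := Real.norm_exp_I_mul_ofReal_sub_one_le
  rw [norm_mul, norm_neg, Real.norm_of_nonneg (sq_nonneg (2 * Real.pi * ‖ξ‖))] at h1
  have hw := wsym_pos ξ
  rw [Real.norm_of_nonneg (inv_nonneg.2 hw.le)]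
  rcases eq_or_ne σ 0 with rfl | hσ
  · simp
  have hσ' : 0 < ‖σ‖ := norm_pos_iff.2 hσ
  have hw' : 0 ≤ (wsym ξ)⁻¹ := (inv_pos.2 hw).le
  calc _ ≤ ‖σ‖⁻¹ * (‖σ‖ * (2 * Real.pi * ‖ξ‖) ^ 2) * (wsym ξ)⁻¹ :=
        mul_le_mul_of_nonneg_right (mul_le_mul_of_nonneg_left h1 (by positivity)) hw'
    _ = (2 * Real.pi * ‖ξ‖) ^ 2 / wsym ξ := by
        rw [← mul_assoc, inv_mul_cancel₀ hσ'.ne', one_mul, div_eq_mul_inv]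
    _ ≤ 1 := by rw [div_le_one hw, wsym]; linarith

/-- The symbol of `σ⁻¹ (exp (i σ Δ) - 1) (1 - Δ)⁻¹`. -/
def slopeSymbol (σ : ℝ) : Space d →ᵇ ℂ :=
  BoundedContinuousFunction.ofNormedAddCommGroup _ (continuous_slopeSymbol σ) 1
    (slopeSymbol_bound σ)

theorem slopeSymbol_apply (σ : ℝ) (ξ : Space d) : slopeSymbol σ ξ =
    (σ : ℂ)⁻¹ * (schrodingerSymbol σ ξ - 1) * (((wsym ξ)⁻¹ : ℝ) : ℂ) := rfl

theorem norm_slopeSymbol_le (σ : ℝ) (ξ : Space d) : ‖slopeSymbol σ ξ‖ ≤ 1 :=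
  slopeSymbol_bound σ ξ

theorem mult_slopeSymbol {f : L2 d} (hf : eH2Norm f < ∞) (σ : ℝ) :
    mult (slopeSymbol σ) (lift f) = σ⁻¹ • (U σ f - f) := by
  rw [real_smul_eq]
  apply ext_fourier
  filter_upwards [fourier_mult (slopeSymbol σ) (lift f), fourier_lift hf,
    fourier_smul' ((σ⁻¹ : ℝ) : ℂ) (U σ f - f), fourier_sub' (U σ f) f,
    fourier_mult (schrodingerSymbol σ) f] with ξ h1 h2 h3 h4 h5
  rw [h1, h2, h3, h4, U, h5, slopeSymbol_apply]
  have h4 : (wsym ξ : ℂ) ≠ 0 := by exact_mod_cast (wsym_pos ξ).ne'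
  push_cast
  field_simp

/-- The difference quotient is the multiplier `slopeSymbol σ` applied to (1 - Δ)f, and these symbols
are bounded by 1 and converge pointwise, so `tendsto_mult` applies. -/
theorem hasDerivAt_U_zero {f : L2 d} (hf : eH2Norm f < ∞) :
    HasDerivAt (fun σ => U σ f) (Complex.I • lap f) 0 := by
  rw [hasDerivAt_iff_tendsto_slope]
  have hslope : slope (fun σ => U σ f) 0 = fun σ : ℝ => mult (slopeSymbol σ) (lift f) := by
    ext1 σ
    rw [slope_def_module, sub_zero, U_zero, mult_slopeSymbol hf]
  rw [hslope, lap, ← mult_smul]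
  refine tendsto_mult slopeSymbol _ 1 norm_slopeSymbol_le (fun ξ => ?_) _
  have hs := hasDerivAt_iff_tendsto_slope.1 (hasDerivAt_schrodingerSymbol ξ)
  have hs2 := hs.mul_const (((wsym ξ)⁻¹ : ℝ) : ℂ)
  have hlim : (Complex.I • (lapSymbol : Space d →ᵇ ℂ)) ξ =
      (((-(2 * Real.pi * ‖ξ‖) ^ 2 : ℝ) : ℂ) * Complex.I) * (((wsym ξ)⁻¹ : ℝ) : ℂ) := by
    change Complex.I * ((-(2 * Real.pi * ‖ξ‖) ^ 2 / wsym ξ : ℝ) : ℂ) = _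
    push_cast
    ring
  rw [hlim]
  refine hs2.congr fun σ => ?_
  rw [slopeSymbol_apply, slope_def_module, sub_zero, ← Complex.coe_smul, smul_eq_mul,
    schrodingerSymbol_apply 0]
  simp

theorem hasDerivAt_U {f : L2 d} (hf : eH2Norm f < ∞) (τ : ℝ) :
    HasDerivAt (fun σ => U σ f) (Complex.I • U τ (lap f)) τ := by
  have h2 : HasDerivAt (fun σ => U (σ - τ) f) (Complex.I • lap f) τ :=
    HasDerivAt.comp_sub_const τ τ (by simpa using hasDerivAt_U_zero hf)
  have h3 := ((U τ).restrictScalars ℝ).hasFDerivAt.comp_hasDerivAt τ h2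
  have e : (fun σ => U σ f) = ((U τ).restrictScalars ℝ : L2 d → L2 d) ∘ fun σ => U (σ - τ) f := by
    ext1 σ
    simp [← U_add]
  rw [e]
  simpa using h3

/-- A product rule obtained from f(s) = f(t) + (f(s) - f(t)). The group is differentiated only on
f(t), the one value required to lie in H²; on the increment its joint continuity suffices. -/
theorem hasDerivWithinAt_U_comp {G : ℝ → ℝ} {g : ℝ} {f : ℝ → L2 d} {f' : L2 d} {J : Set ℝ} {t : ℝ}
    (hG : HasDerivAt G g t) (hf : HasDerivWithinAt f f' J t) (hft : eH2Norm (f t) < ∞) :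
    HasDerivWithinAt (fun s => U (G s) (f s))
      (U (G t) (f' + (g : ℂ) • Complex.I • lap (f t))) J t := by
  have h1 : HasDerivWithinAt (fun s => U (G s) (f t))
      (g • Complex.I • U (G t) (lap (f t))) J t :=
    (HasDerivAt.scomp t (hasDerivAt_U hft (G t)) hG).hasDerivWithinAt
  have h2 : HasDerivWithinAt (fun s => U (G s) (f s - f t)) (U (G t) f') J t := by
    rw [hasDerivWithinAt_iff_tendsto_slope] at hf ⊢
    have hc : Tendsto G (𝓝[J \ {t}] t) (𝓝 (G t)) :=
      hG.continuousAt.tendsto.mono_left nhdsWithin_le_nhds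
    refine (tendsto_U_apply hc hf).congr fun s => ?_
    simp [slope_def_module, real_smul_eq]
  have h3 := h1.add h2
  have e : (fun s => U (G s) (f t)) + (fun s => U (G s) (f s - f t)) = fun s => U (G s) (f s) := by
    ext1 s; simp
  rw [e] at h3
  have e2 : U (G t) (f' + (g : ℂ) • Complex.I • lap (f t)) =
      g • Complex.I • U (G t) (lap (f t)) + U (G t) f' := by
    rw [map_add, map_smul, map_smul, real_smul_eq, add_comm]
  rw [e2]
  exact h3

/-! ### Sobolev embedding in dimension at most three. -/

/-- A square integrable function with integrable Fourier transform is bounded. -/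
theorem ae_norm_le_integral_fourier {f : L2 d} (hf : Integrable (𝓕 f : L2 d) volume) :
    ∀ᵐ x, ‖f x‖ ≤ ∫ ξ, ‖(𝓕 f : L2 d) ξ‖ := by
  set g : L2 d := 𝓕 f with hg
  let F : Space d → ℂ := VectorFourier.fourierIntegral Real.fourierChar volume
    (-innerₗ (Space d)) g
  have hFb : ∀ x, ‖F x‖ ≤ ∫ ξ, ‖g ξ‖ := fun x =>
    VectorFourier.norm_fourierIntegral_le_integral_norm _ _ _ _ _
  have hcont : Continuous fun p : Space d × Space d => (-innerₗ (Space d)) p.1 p.2 := by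
    simp only [LinearMap.neg_apply, innerₗ_apply_apply]
    fun_prop
  have hFc : Continuous F :=
    VectorFourier.fourierIntegral_continuous Real.continuous_fourierChar hcont hf
  -- Both sides are paired with test functions: the distributional Fourier transform moves onto the
  -- test function, and the self-adjointness of the Fourier integral moves it back onto `g`.
  have hae : ∀ᵐ x, f x = F x := by
    refine ae_eq_of_integral_contDiff_smul_eq
      ((Lp.memLp f).locallyIntegrable (by norm_num)) hFc.locallyIntegrable ?_
    intro φ hφ hφc
    have hg₁ : HasCompactSupport (Complex.ofRealCLM ∘ φ) := hφc.comp_left rfl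
    have hg₂ : ContDiff ℝ ((⊤ : ℕ∞) : WithTop ℕ∞) (Complex.ofRealCLM ∘ φ) :=
      Complex.ofRealCLM.contDiff.comp hφ
    set ψ : 𝓢(Space d, ℂ) := hg₁.toSchwartzMap hg₂ with hψ
    have hψa : ∀ x, ψ x = (φ x : ℂ) := fun x => rfl
    have h1 : (f : 𝓢'(Space d, ℂ)) ψ = (g : 𝓢'(Space d, ℂ)) (𝓕⁻ ψ) := by
      rw [hg, ← Lp.fourier_toTemperedDistribution_eq, TemperedDistribution.fourier_apply]
      simp
    rw [Lp.toTemperedDistribution_apply, Lp.toTemperedDistribution_apply] at h1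
    have h2 : ∫ ξ, (𝓕⁻ ψ) ξ • g ξ = ∫ x, ψ x • F x := by
      have := VectorFourier.integral_fourierIntegral_smul_eq_flip (μ := (volume : Measure (Space d)))
        (ν := (volume : Measure (Space d))) (L := -innerₗ (Space d))
        Real.continuous_fourierChar hcont ψ.integrable hf
      have hfl : (-innerₗ (Space d)).flip = -innerₗ (Space d) := by
        ext x y
        simp [real_inner_comm]
      rw [hfl] at this
      rw [← this, SchwartzMap.fourierInv_coe]
      rfl
    simp_rw [hψa] at h1 h2
    simpa using h1.trans h2
  filter_upwards [hae] with x hx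
  rw [hx]
  exact hFb x

theorem continuous_inv_wsym_add (n : ℕ) : Continuous fun ξ : Space d => (wsym ξ + n)⁻¹ :=
  (continuous_wsym.add continuous_const).inv₀ fun ξ =>
    (add_pos_of_pos_of_nonneg (wsym_pos ξ) n.cast_nonneg).ne'

/-- The integrand decays like |ξ|⁻⁴, which is integrable for d < 4. The restriction on the dimension
enters the whole proof through this integral. -/
theorem integrable_inv_wsym_sq (hd : d ≤ 3) :
    Integrable (fun ξ : Space d => ((wsym ξ)⁻¹) ^ 2) volume := by
  have h4 : (Module.finrank ℝ (Space d) : ℝ) < 4 := by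
    simp only [finrank_euclideanSpace, Fintype.card_fin]
    have : (d : ℝ) ≤ 3 := by exact_mod_cast hd
    linarith
  refine (integrable_rpow_neg_one_add_norm_sq (E := Space d) h4).mono' ?_ ?_
  · have := (continuous_inv_wsym_add (d := d) 0).pow 2
    simp only [Nat.cast_zero, add_zero] at this
    exact this.aestronglyMeasurable
  · refine Eventually.of_forall fun ξ => ?_
    have hw := wsym_pos ξ
    rw [Real.norm_of_nonneg (by positivity), show (-4 : ℝ) / 2 = -(2 : ℕ) by norm_num,
      Real.rpow_neg (by positivity), Real.rpow_natCast, inv_pow]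
    have h3 : 1 ≤ (2 * Real.pi) ^ 2 := by nlinarith [Real.pi_gt_three]
    gcongr
    rw [wsym]
    nlinarith [sq_nonneg ‖ξ‖]

theorem tendsto_integral_inv_wsym_add (hd : d ≤ 3) :
    Tendsto (fun n : ℕ => ∫ ξ : Space d, ((wsym ξ + n)⁻¹) ^ 2) atTop (𝓝 0) := by
  have h0 : (0 : ℝ) = ∫ ξ : Space d, (0 : ℝ) := by simp
  rw [h0]
  refine tendsto_integral_of_dominated_convergence (fun ξ : Space d => ((wsym ξ)⁻¹) ^ 2)
    (fun n => ((continuous_inv_wsym_add n).pow 2).aestronglyMeasurable)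
    (integrable_inv_wsym_sq hd) (fun n => Eventually.of_forall fun ξ => ?_)
    (Eventually.of_forall fun ξ => ?_)
  · have hw := wsym_pos ξ
    rw [Real.norm_of_nonneg (by positivity)]
    gcongr
    simp
  · have h1 : Tendsto (fun n : ℕ => wsym ξ + (n : ℝ)) atTop atTop :=
      tendsto_atTop_add_const_left _ _ tendsto_natCast_atTop_atTop
    have h2 := (tendsto_inv_atTop_zero.comp h1).pow 2
    simpa using h2

theorem integrable_inv_wsym_add_sq (hd : d ≤ 3) (n : ℕ) :
    Integrable (fun ξ : Space d => ((wsym ξ + n)⁻¹) ^ 2) volume := by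
  refine (integrable_inv_wsym_sq hd).mono' ((continuous_inv_wsym_add n).pow 2).aestronglyMeasurable
    (Eventually.of_forall fun ξ => ?_)
  have hw := wsym_pos ξ
  rw [Real.norm_of_nonneg (by positivity)]
  gcongr
  simp

/-- Cauchy–Schwarz with the weight `wsym ξ + n`. The free parameter n makes the factor of the H²
norm small at the price of a large multiple of the L² norm. -/
theorem fourier_integrable_and_le (hd : d ≤ 3) {f : L2 d} (hf : eH2Norm f < ∞) (n : ℕ) :
    Integrable (𝓕 f : L2 d) volume ∧ ∫ ξ, ‖(𝓕 f : L2 d) ξ‖ ≤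
      √(∫ ξ : Space d, ((wsym ξ + n)⁻¹) ^ 2) * (‖lift f‖ + n * ‖f‖) := by
  set h : L2 d := lift f + (n : ℂ) • f with hh
  have h1 : ‖h‖ ≤ ‖lift f‖ + n * ‖f‖ := by
    refine (norm_add_le _ _).trans ?_
    rw [norm_smul]; simp
  have hF : (𝓕 h : L2 d) =ᵐ[volume] fun ξ => ((wsym ξ + n : ℝ) : ℂ) * (𝓕 f : L2 d) ξ := by
    filter_upwards [fourier_add' (lift f) ((n : ℂ) • f), fourier_smul' (n : ℂ) f, fourier_lift hf]
      with ξ h1 h2 h3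
    rw [h1, h2, h3]; push_cast; ring
  have hpos : ∀ ξ : Space d, 0 < wsym ξ + n := fun ξ => by have := wsym_pos ξ; positivity
  have hF2 : (𝓕 f : L2 d) =ᵐ[volume] fun ξ => (((wsym ξ + n)⁻¹ : ℝ) : ℂ) * (𝓕 h : L2 d) ξ := by
    filter_upwards [hF] with ξ h1
    rw [h1, ← mul_assoc, ← Complex.ofReal_mul, inv_mul_cancel₀ (hpos ξ).ne']
    simp
  have hm : MemLp (fun ξ : Space d => (wsym ξ + n)⁻¹) 2 volume := by
    rw [memLp_two_iff_integrable_sq (continuous_inv_wsym_add n).aestronglyMeasurable]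
    exact integrable_inv_wsym_add_sq hd n
  have hh2 : MemLp (𝓕 h : L2 d) 2 volume := Lp.memLp _
  constructor
  · exact (MemLp.integrable_mul hm.ofReal hh2).congr hF2.symm
  · have e1 : ∫ ξ, ‖(𝓕 f : L2 d) ξ‖ = ∫ ξ, ‖(wsym ξ + n)⁻¹‖ * ‖‖(𝓕 h : L2 d) ξ‖‖ := by
      refine integral_congr_ae ?_
      filter_upwards [hF2] with ξ h1
      rw [h1, norm_mul, Complex.norm_real, norm_norm]
    have e2 := integral_mul_norm_le_Lp_mul_Lq (μ := volume) (f := fun ξ : Space d => (wsym ξ + n)⁻¹)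
      (g := fun ξ => ‖(𝓕 h : L2 d) ξ‖) (Real.HolderConjugate.two_two) (by simpa using hm)
      (by simpa using hh2.norm)
    rw [e1]
    refine e2.trans ?_
    rw [← Real.sqrt_eq_rpow, ← Real.sqrt_eq_rpow]
    have e3 : ∫ ξ, ‖‖(𝓕 h : L2 d) ξ‖‖ ^ (2 : ℝ) = ‖h‖ ^ 2 := by
      rw [← norm_fourier' h, norm_sq_eq_integral]
      simp
    rw [e3, Real.sqrt_sq (norm_nonneg _)]
    simp only [Real.rpow_two, Real.norm_eq_abs, sq_abs]
    gcongr

/-- The Sobolev embedding `H² ⊂ L^∞` in dimension `d ≤ 3`, with a small constant in front of the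
`H²` norm. -/
theorem ae_norm_le (hd : d ≤ 3) {κ : ℝ} (hκ : 0 < κ) : ∃ C : ℝ, 0 ≤ C ∧ ∀ (f : L2 d) (r : ℝ),
    0 ≤ r → eH2Norm f ≤ ENNReal.ofReal r → ∀ᵐ x, ‖f x‖ ≤ κ * r + C * ‖f‖ := by
  have h1 := (tendsto_integral_inv_wsym_add (d := d) hd).sqrt
  rw [Real.sqrt_zero] at h1
  obtain ⟨n, hn⟩ := (h1.eventually (gt_mem_nhds hκ)).exists
  refine ⟨κ * n, by positivity, fun f r hr hfr => ?_⟩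
  have hf : eH2Norm f < ∞ := hfr.trans_lt ENNReal.ofReal_lt_top
  obtain ⟨h2, h3⟩ := fourier_integrable_and_le hd hf n
  have h4 : ‖lift f‖ ≤ r := by
    rw [eH2Norm_eq_lift hf, ← ofReal_norm] at hfr
    exact (ENNReal.ofReal_le_ofReal_iff hr).1 hfr
  filter_upwards [ae_norm_le_integral_fourier h2] with x hx
  calc ‖f x‖ ≤ _ := hx.trans h3
    _ ≤ κ * (r + n * ‖f‖) := by gcongr
    _ = _ := by ring

/-! ### Translations and the description of H² by second differences. -/

/-- The symbol of the translation `f ↦ f (· + h)`. -/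
def transSymbol (h : Space d) : Space d →ᵇ ℂ :=
  BoundedContinuousFunction.ofNormedAddCommGroup
    (fun ξ => Complex.exp (((2 * Real.pi * inner ℝ h ξ : ℝ) : ℂ) * Complex.I))
    (by fun_prop) 1 (fun ξ => (Complex.norm_exp_ofReal_mul_I _).le)

theorem transSymbol_apply (h ξ : Space d) : transSymbol h ξ =
    Complex.exp (((2 * Real.pi * inner ℝ h ξ : ℝ) : ℂ) * Complex.I) := rfl

theorem norm_transSymbol (h ξ : Space d) : ‖transSymbol h ξ‖ = 1 :=
  Complex.norm_exp_ofReal_mul_I _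

theorem measurePreserving_add (h : Space d) :
    MeasurePreserving (fun x : Space d => x + h) volume volume :=
  measurePreserving_add_right volume h

theorem mult_transSymbol (h : Space d) (f : L2 d) :
    mult (transSymbol h) f = Lp.compMeasurePreserving _ (measurePreserving_add h) f := by
  refine DenseRange.induction_on
    (p := fun f : L2 d => mult (transSymbol h) f =
      Lp.compMeasurePreserving _ (measurePreserving_add h) f)
    (SchwartzMap.denseRange_toLpCLM (p := 2) ENNReal.ofNat_ne_top) f ?_ ?_
  · exact isClosed_eq (mult _).continuous
      (Lp.isometry_compMeasurePreserving (measurePreserving_add h)).continuous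
  · intro φ
    have e : Lp.compMeasurePreserving _ (measurePreserving_add h)
        (SchwartzMap.toLpCLM ℝ ℂ 2 volume φ) = (φ.compSubConstCLM ℂ (-h)).toLp 2 volume := by
      apply Lp.ext
      have h1 := φ.coeFn_toLp 2 (volume : Measure (Space d))
      filter_upwards [Lp.coeFn_compMeasurePreserving (SchwartzMap.toLpCLM ℝ ℂ 2 volume φ)
        (measurePreserving_add h), (φ.compSubConstCLM ℂ (-h)).coeFn_toLp 2 volume,
        (measurePreserving_add h).quasiMeasurePreserving.ae h1] with x h2 h3 h4
      rw [h2, h3, SchwartzMap.compSubConstCLM_apply, sub_neg_eq_add, ← h4]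
      rfl
    rw [e]
    apply ext_fourier
    have h0 : (𝓕 (SchwartzMap.toLpCLM ℝ ℂ 2 volume φ : L2 d) : L2 d) = (𝓕 φ).toLp 2 :=
      SchwartzMap.toLp_fourier_eq φ
    rw [SchwartzMap.toLp_fourier_eq]
    have h1 := fourier_mult (transSymbol h) (SchwartzMap.toLpCLM ℝ ℂ 2 volume φ)
    rw [h0] at h1
    filter_upwards [h1, (𝓕 φ).coeFn_toLp 2 volume,
      (𝓕 (φ.compSubConstCLM ℂ (-h))).coeFn_toLp 2 volume] with ξ h2 h3 h4
    rw [h2, h3, h4, SchwartzMap.fourier_coe, SchwartzMap.fourier_coe]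
    have h5 := congrFun (VectorFourier.fourierIntegral_comp_add_right Real.fourierChar
      (volume : Measure (Space d)) (innerₗ (Space d)) (φ : Space d → ℂ) h) ξ
    have h6 : (fun x => (φ.compSubConstCLM ℂ (-h)) x) = (φ : Space d → ℂ) ∘ fun v => v + h := by
      ext x
      rw [SchwartzMap.compSubConstCLM_apply, sub_neg_eq_add]; rfl
    change _ = VectorFourier.fourierIntegral Real.fourierChar volume (innerₗ (Space d))
      (fun x => (φ.compSubConstCLM ℂ (-h)) x) ξ
    rw [h6, h5, transSymbol_apply, Circle.smul_def, Real.fourierChar_apply]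
    simp only [innerₗ_apply_apply, smul_eq_mul]
    rfl

theorem coeFn_mult_transSymbol (h : Space d) (f : L2 d) :
    mult (transSymbol h) f =ᵐ[volume] fun x => f (x + h) := by
  rw [mult_transSymbol]
  exact Lp.coeFn_compMeasurePreserving _ _

/-- The symbol `2 cos (2π h·ξ) - 2` of the second difference. -/
def diffSymbol (h : Space d) : Space d →ᵇ ℂ := transSymbol h + transSymbol (-h) - (2 : ℂ) • 1

/-- The second difference `f (· + h) - 2 f + f (· - h)`. -/
def secondDiff (h : Space d) : L2 d →L[ℂ] L2 d := mult (diffSymbol h)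

theorem coeFn_secondDiff (h : Space d) (f : L2 d) :
    secondDiff h f =ᵐ[volume] fun x => f (x + h) + f (x - h) - 2 * f x := by
  rw [secondDiff, diffSymbol, mult_sub, mult_add, mult_smul, mult_one]
  filter_upwards [coeFn_mult_transSymbol h f, coeFn_mult_transSymbol (-h) f,
    Lp.coeFn_sub (mult (transSymbol h) f + mult (transSymbol (-h)) f) ((2 : ℂ) • f),
    Lp.coeFn_add (mult (transSymbol h) f) (mult (transSymbol (-h)) f),
    Lp.coeFn_smul (2 : ℂ) f] with x h1 h2 h3 h4 h5
  rw [h3, Pi.sub_apply, h4, Pi.add_apply, h1, h2, h5, Pi.smul_apply, smul_eq_mul, sub_eq_add_neg x]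

theorem diffSymbol_apply (h ξ : Space d) :
    diffSymbol h ξ = ((2 * Real.cos (2 * Real.pi * inner ℝ h ξ) - 2 : ℝ) : ℂ) := by
  change transSymbol h ξ + transSymbol (-h) ξ - 2 * 1 = _
  rw [transSymbol_apply, transSymbol_apply, inner_neg_left]
  push_cast
  rw [Complex.cos]
  ring_nf

theorem norm_diffSymbol_le (h ξ : Space d) :
    ‖diffSymbol h ξ‖ ≤ (2 * Real.pi * inner ℝ h ξ) ^ 2 := by
  rw [diffSymbol_apply, Complex.norm_real, Real.norm_eq_abs, abs_sub_comm,
    abs_of_nonneg (by linarith [Real.cos_le_one (2 * Real.pi * inner ℝ h ξ)])]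
  linarith [Real.one_sub_sq_div_two_le_cos (x := 2 * Real.pi * inner ℝ h ξ)]

/-- From 2 - 2 cos θ ≤ θ² with θ = 2π h·ξ, and θ² ≤ |h|² `wsym ξ`. Together with its converse
`eH2Norm_le_of_secondDiff` this replaces second derivatives by differences of order |h|². -/
theorem norm_secondDiff_le {f : L2 d} {r : ℝ} (hr : 0 ≤ r) (hf : eH2Norm f ≤ ENNReal.ofReal r)
    (h : Space d) : ‖secondDiff h f‖ ≤ ‖h‖ ^ 2 * r := by
  have hf' : eH2Norm f < ∞ := hf.trans_lt ENNReal.ofReal_lt_top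
  have h4 : ‖lift f‖ ≤ r := by
    rw [eH2Norm_eq_lift hf', ← ofReal_norm] at hf
    exact (ENNReal.ofReal_le_ofReal_iff hr).1 hf
  refine le_trans ?_ (mul_le_mul_of_nonneg_left h4 (by positivity))
  rw [← norm_fourier', ← norm_fourier' (lift f)]
  refine Lp.norm_le_mul_norm_of_ae_le_mul ?_
  filter_upwards [fourier_mult (diffSymbol h) f, fourier_lift hf'] with ξ h1 h2
  rw [secondDiff, h1, h2, norm_mul, norm_mul, ← mul_assoc]
  gcongr
  rw [Complex.norm_real, Real.norm_of_nonneg (wsym_pos ξ).le]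
  refine (norm_diffSymbol_le h ξ).trans ?_
  have h5 : (inner ℝ h ξ) ^ 2 ≤ (‖h‖ * ‖ξ‖) ^ 2 := by
    rw [sq_le_sq, abs_of_nonneg (by positivity : 0 ≤ ‖h‖ * ‖ξ‖)]
    exact abs_real_inner_le_norm h ξ
  rw [wsym]
  nlinarith [sq_nonneg (2 * Real.pi), mul_le_mul_of_nonneg_left h5 (sq_nonneg (2 * Real.pi)),
    sq_nonneg ‖h‖]

/-- A bound for the multiplier with symbol `-∂_j²`, by Fatou's lemma. -/
theorem eLpNorm_coord_le {f : L2 d} {A : ℝ} (j : Fin d)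
    (h : ∀ᶠ s : ℝ in 𝓝[>] 0, ‖secondDiff (s • EuclideanSpace.single j (1 : ℝ)) f‖ ≤ A * s ^ 2) :
    eLpNorm (fun ξ : Space d => (((2 * Real.pi * ξ j) ^ 2 : ℝ) : ℂ) * (𝓕 f : L2 d) ξ) 2 volume ≤
      ENNReal.ofReal A := by
  have hs : Tendsto (fun n : ℕ => (1 / ((n : ℝ) + 1))) atTop (𝓝[>] 0) :=
    tendsto_nhdsWithin_iff.2 ⟨tendsto_one_div_add_atTop_nhds_zero_nat,
      Eventually.of_forall fun n => by simp only [Set.mem_Ioi]; positivity⟩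
  set s : ℕ → ℝ := fun n => 1 / ((n : ℝ) + 1) with hsdef
  have hspos : ∀ n, 0 < s n := fun n => by rw [hsdef]; positivity
  have h' := hs.eventually h
  have hin : ∀ (t : ℝ) (ξ : Space d),
      inner ℝ (t • EuclideanSpace.single j (1 : ℝ)) ξ = t * ξ j := by
    intro t ξ
    rw [real_inner_smul_left, EuclideanSpace.inner_single_left]
    simp
  have hlim := Lp.eLpNorm_lim_le_liminf_eLpNorm (μ := volume) (p := 2)
    (f := fun (n : ℕ) (ξ : Space d) => (-((s n) ^ 2)⁻¹ : ℂ) *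
      (diffSymbol (s n • EuclideanSpace.single j (1 : ℝ)) ξ * (𝓕 f : L2 d) ξ)) (fun n =>
      aestronglyMeasurable_const.mul ((BoundedContinuousFunction.continuous
        _).aestronglyMeasurable.mul (Lp.aestronglyMeasurable _)))
    (fun ξ : Space d => (((2 * Real.pi * ξ j) ^ 2 : ℝ) : ℂ) * (𝓕 f : L2 d) ξ)
    (Eventually.of_forall fun ξ => by
      simp_rw [← mul_assoc]
      refine Tendsto.mul_const _ ?_
      -- By the double-angle formula the normalised symbol is a square of sin(π ξ_j s)/s, so its
      -- limit needs only the derivative of the sine at 0.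
      have e : ∀ n, (-((s n) ^ 2)⁻¹ : ℂ) * diffSymbol (s n • EuclideanSpace.single j (1 : ℝ)) ξ =
          ((4 * (Real.sin (Real.pi * ξ j * s n) / s n) ^ 2 : ℝ) : ℂ) := by
        intro n
        have h2 : Real.cos (2 * Real.pi * (s n * ξ j)) =
            1 - 2 * Real.sin (Real.pi * ξ j * s n) ^ 2 := by
          rw [show 2 * Real.pi * (s n * ξ j) = 2 * (Real.pi * ξ j * s n) by ring,
            Real.cos_two_mul, Real.cos_sq']
          ring
        rw [diffSymbol_apply, hin, h2]
        have := (hspos n).ne'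
        push_cast
        have : (s n : ℂ) ≠ 0 := by exact_mod_cast this
        field_simp
        ring
      simp_rw [e]
      refine (Complex.continuous_ofReal.tendsto _).comp ?_
      have hd : HasDerivAt (fun s : ℝ => Real.sin (Real.pi * ξ j * s)) (Real.pi * ξ j) 0 := by
        have h1 := ((hasDerivAt_id (0 : ℝ)).const_mul (Real.pi * ξ j)).sin
        simpa using h1
      have hsl := (hasDerivAt_iff_tendsto_slope.1 hd).comp
        (hs.mono_right (nhdsWithin_mono _ fun x (hx : 0 < x) => hx.ne'))
      have h3 := (hsl.pow 2).const_mul 4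
      have e3 : 4 * (Real.pi * ξ j) ^ 2 = (2 * Real.pi * ξ j) ^ 2 := by ring
      rw [e3] at h3
      refine h3.congr fun n => ?_
      simp only [Function.comp_apply, slope_def_field]
      simp [hsdef])
  refine hlim.trans ?_
  have h3 : ∀ᶠ n in atTop, eLpNorm (fun ξ : Space d => (-((s n) ^ 2)⁻¹ : ℂ) *
      (diffSymbol (s n • EuclideanSpace.single j (1 : ℝ)) ξ * (𝓕 f : L2 d) ξ)) 2 volume ≤
        ENNReal.ofReal A := by
    filter_upwards [h'] with n hn
    have e : (𝓕 ((-((s n) ^ 2)⁻¹ : ℂ) •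
        mult (diffSymbol (s n • EuclideanSpace.single j (1 : ℝ))) f) : L2 d) =ᵐ[volume]
        fun ξ : Space d => (-((s n) ^ 2)⁻¹ : ℂ) *
      (diffSymbol (s n • EuclideanSpace.single j (1 : ℝ)) ξ * (𝓕 f : L2 d) ξ) := by
      filter_upwards [fourier_smul' (-((s n) ^ 2)⁻¹ : ℂ)
        (mult (diffSymbol (s n • EuclideanSpace.single j (1 : ℝ))) f),
        fourier_mult (diffSymbol (s n • EuclideanSpace.single j (1 : ℝ))) f] with ξ h1 h2
      rw [h1, h2]
    rw [enorm_eq_of_fourier _ e, ← ofReal_norm]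
    apply ENNReal.ofReal_le_ofReal
    rw [norm_smul, norm_neg, Complex.norm_real, norm_inv, norm_pow,
      Real.norm_of_nonneg (hspos n).le]
    have h5 : 0 < (s n) ^ 2 := pow_pos (hspos n) 2
    rw [inv_mul_le_iff₀ h5, mul_comm]
    exact hn
  refine (liminf_le_liminf h3).trans (by simp)

/-- A bound on all second differences in the coordinate directions gives a bound in `H²`. -/
theorem eH2Norm_le_of_secondDiff {f : L2 d} {A : ℝ} (hA : 0 ≤ A) (h0 : ‖f‖ ≤ A)
    (h : ∀ j : Fin d, ∀ᶠ s : ℝ in 𝓝[>] 0,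
      ‖secondDiff (s • EuclideanSpace.single j (1 : ℝ)) f‖ ≤ A * s ^ 2) :
    eH2Norm f ≤ ENNReal.ofReal ((1 + d) * A) := by
  -- The weight 1 + |2πξ|² splits into 1 and one term for each coordinate, whence the factor 1 + d.
  have e : (fun ξ => (wsym ξ : ℂ) * (𝓕 f : L2 d) ξ) = ((𝓕 f : L2 d) : Space d → ℂ) +
      ∑ j : Fin d, fun ξ : Space d => (((2 * Real.pi * ξ j) ^ 2 : ℝ) : ℂ) * (𝓕 f : L2 d) ξ := by
    ext ξ
    rw [Pi.add_apply, Finset.sum_apply, ← Finset.sum_mul, ← Complex.ofReal_sum, wsym, mul_pow,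
      EuclideanSpace.real_norm_sq_eq, Finset.mul_sum]
    simp_rw [mul_pow]
    push_cast
    ring
  have hm : ∀ j : Fin d, AEStronglyMeasurable
      (fun ξ : Space d => (((2 * Real.pi * ξ j) ^ 2 : ℝ) : ℂ) * (𝓕 f : L2 d) ξ) volume := fun j =>
    (by fun_prop : Continuous fun ξ : Space d =>
      (((2 * Real.pi * ξ j) ^ 2 : ℝ) : ℂ)).aestronglyMeasurable.mul (Lp.aestronglyMeasurable _)
  rw [eH2Norm_eq, e]
  refine (eLpNorm_add_le (Lp.aestronglyMeasurable _)
    (Finset.aestronglyMeasurable_sum _ fun j _ => hm j) (by norm_num)).trans ?_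
  have h1 : eLpNorm ((𝓕 f : L2 d) : Space d → ℂ) 2 volume ≤ ENNReal.ofReal A := by
    rw [enorm_eq_of_fourier f (EventuallyEq.refl _ _), ← ofReal_norm]
    exact ENNReal.ofReal_le_ofReal h0
  have h2 : eLpNorm (∑ j : Fin d, fun ξ : Space d =>
      (((2 * Real.pi * ξ j) ^ 2 : ℝ) : ℂ) * (𝓕 f : L2 d) ξ) 2 volume ≤ d * ENNReal.ofReal A := by
    refine (eLpNorm_sum_le (fun j _ => hm j) (by norm_num)).trans ?_
    refine (Finset.sum_le_sum fun j _ => eLpNorm_coord_le j (h j)).trans ?_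
    simp
  refine (add_le_add h1 h2).trans (le_of_eq ?_)
  rw [add_mul, one_mul, ENNReal.ofReal_add hA (by positivity), ENNReal.ofReal_mul (by positivity),
    ENNReal.ofReal_natCast]

/-! ### A discrete Gagliardo–Nirenberg inequality. -/

theorem eLpNorm_two_le {g : Space d → ℝ} (hg : Integrable (fun x => g x ^ 2) volume) {B : ℝ}
    (hB : 0 ≤ B) (h : ∫ x, g x ^ 2 ≤ B ^ 2) : eLpNorm g 2 volume ≤ ENNReal.ofReal B := by
  rw [eLpNorm_eq_lintegral_rpow_enorm_toReal (by norm_num) (by norm_num)]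
  have e : ∫⁻ x, ‖g x‖ₑ ^ (2 : ℝ≥0∞).toReal ∂volume = ENNReal.ofReal (∫ x, g x ^ 2) := by
    rw [ofReal_integral_eq_lintegral_ofReal hg (Eventually.of_forall fun x => sq_nonneg _)]
    refine lintegral_congr fun x => ?_
    simp only [ENNReal.toReal_ofNat, ENNReal.rpow_ofNat]
    rw [← ofReal_norm, ← ENNReal.ofReal_pow (norm_nonneg _), Real.norm_eq_abs, sq_abs]
  rw [e, ENNReal.ofReal_rpow_of_nonneg (integral_nonneg fun x => sq_nonneg _) (by simp)]
  apply ENNReal.ofReal_le_ofReal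
  simp only [ENNReal.toReal_ofNat]
  rw [← Real.sqrt_eq_rpow]
  exact (Real.sqrt_le_sqrt h).trans_eq (Real.sqrt_sq hB)

theorem ae_comp_add {P : Space d → Prop} (h : Space d) (hP : ∀ᵐ x, P x) : ∀ᵐ x, P (x + h) :=
  (measurePreserving_add h).quasiMeasurePreserving.ae hP

theorem ae_comp_sub {P : Space d → Prop} (h : Space d) (hP : ∀ᵐ x, P x) : ∀ᵐ x, P (x - h) := by
  simpa only [sub_eq_add_neg] using ae_comp_add (-h) hP

theorem memLp_comp_add {u : Space d → ℝ} (hu : MemLp u 2 volume) (h : Space d) :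
    MemLp (fun x => u (x + h)) 2 volume :=
  hu.comp_measurePreserving (measurePreserving_add h)

theorem integral_mul_le_sqrt {f g : Space d → ℝ} (hf : MemLp f 2 volume) (hg : MemLp g 2 volume) :
    ∫ x, |f x| * |g x| ≤ √(∫ x, f x ^ 2) * √(∫ x, g x ^ 2) := by
  have := integral_mul_norm_le_Lp_mul_Lq (μ := volume) (f := f) (g := g)
    Real.HolderConjugate.two_two (by simpa using hf) (by simpa using hg)
  rw [← Real.sqrt_eq_rpow, ← Real.sqrt_eq_rpow] at this
  simpa only [Real.rpow_two, Real.norm_eq_abs, sq_abs] using this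

section GagliardoNirenberg

variable {u c : Space d → ℝ} {M η : ℝ} {h : Space d}

theorem memLp_diff (hu : MemLp u 2 volume) (h : Space d) :
    MemLp (fun x => u (x + h) - u x) 2 volume := (memLp_comp_add hu h).sub hu

theorem ae_abs_diff_le (hM : ∀ᵐ x, |u x| ≤ M) (h : Space d) :
    ∀ᵐ x, |u (x + h) - u x| ≤ 2 * M := by
  filter_upwards [hM, ae_comp_add h hM] with x h1 h2
  exact (abs_sub _ _).trans (by linarith)

theorem memLp_diff_sq (hu : MemLp u 2 volume) (hM : ∀ᵐ x, |u x| ≤ M) (h : Space d) :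
    MemLp (fun x => (u (x + h) - u x) ^ 2) 2 volume := by
  have h1 := memLp_diff hu h
  refine (h1.const_mul (2 * M)).mono (h1.1.pow 2) ?_
  filter_upwards [ae_abs_diff_le hM h] with x hx
  rw [Real.norm_eq_abs, Real.norm_eq_abs, abs_pow, abs_mul, sq]
  have : |2 * M| = 2 * M := abs_of_nonneg ((abs_nonneg _).trans hx)
  rw [this]
  gcongr

theorem integrable_diff_cube (hu : MemLp u 2 volume) (hM : ∀ᵐ x, |u x| ≤ M) (h : Space d) :
    Integrable (fun x => (u (x + h) - u x) ^ 3) volume := by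
  refine ((memLp_diff_sq hu hM h).integrable_mul (memLp_diff hu h)).congr
    (Eventually.of_forall fun x => ?_)
  simp only [Pi.mul_apply]
  ring

/-- Summation by parts: translation invariance moves the difference from c onto the cube of the
first difference. A difference of cubes b³ - a³ contains the factor a - b, here the second
difference of u, and Cauchy–Schwarz finishes. The choice c = u gives the global inequality, and c =
u clipped at height η the one near the zeros. -/
theorem integral_diff_mul_cube_le (hu : MemLp u 2 volume) (hM : ∀ᵐ x, |u x| ≤ M)
    (hc : AEStronglyMeasurable c volume) (hη : ∀ᵐ x, |c x| ≤ η) (hη0 : 0 ≤ η) (h : Space d) :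
    ∫ x, (c (x + h) - c x) * (u (x + h) - u x) ^ 3 ≤
      3 * η * (√(∫ x, (u (x + h) + u (x - h) - 2 * u x) ^ 2) *
        √(∫ x, (u (x + h) - u x) ^ 4)) := by
  set S : Space d → ℝ := fun x => u (x + h) + u (x - h) - 2 * u x with hS
  have hSm : MemLp S 2 volume := by
    have h1 := memLp_comp_add hu (-h)
    simp only [← sub_eq_add_neg] at h1
    exact ((memLp_comp_add hu h).add h1).sub (hu.const_mul 2)
  have hD3 := integrable_diff_cube hu hM h
  have hD2 := memLp_diff_sq hu hM h
  have hD3' : Integrable (fun x => (u x - u (x - h)) ^ 3) volume := by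
    have := (measurePreserving_add (-h)).integrable_comp_of_integrable hD3
    refine this.congr (Eventually.of_forall fun x => ?_)
    simp [sub_eq_add_neg]
  have hD2' : MemLp (fun x => (u x - u (x - h)) ^ 2) 2 volume := by
    refine (memLp_comp_add hD2 (-h)).congr_norm ?_ (Eventually.of_forall fun x => ?_)
    · have h1 := memLp_comp_add hu (-h)
      simp only [← sub_eq_add_neg] at h1
      exact (hu.1.sub h1.1).pow 2
    · simp [sub_eq_add_neg]
  have hcs : AEStronglyMeasurable (fun x => c (x + h)) volume :=
    hc.comp_measurePreserving (measurePreserving_add h)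
  have i1 : Integrable (fun x => c (x + h) * (u (x + h) - u x) ^ 3) volume :=
    hD3.bdd_mul (c := η) hcs (by simpa using ae_comp_add h hη)
  have i2 : Integrable (fun x => c x * (u (x + h) - u x) ^ 3) volume :=
    hD3.bdd_mul (c := η) hc (by simpa using hη)
  have i3 : Integrable (fun x => c x * (u x - u (x - h)) ^ 3) volume :=
    hD3'.bdd_mul (c := η) hc (by simpa using hη)
  have e1 : ∫ x, c (x + h) * (u (x + h) - u x) ^ 3 = ∫ x, c x * (u x - u (x - h)) ^ 3 := by
    have := integral_add_right_eq_self (μ := (volume : Measure (Space d)))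
      (fun x => c x * (u x - u (x - h)) ^ 3) h
    simpa using this
  have e2 : ∫ x, (c (x + h) - c x) * (u (x + h) - u x) ^ 3 =
      ∫ x, c x * ((u x - u (x - h)) ^ 3 - (u (x + h) - u x) ^ 3) := by
    simp_rw [sub_mul, mul_sub]
    rw [integral_sub i1 i2, integral_sub i3 i2, e1]
  have j1 : Integrable (fun x => |S x| * |(u (x + h) - u x) ^ 2|) volume :=
    (hSm.norm.integrable_mul hD2.norm)
  have j2 : Integrable (fun x => |S x| * |(u x - u (x - h)) ^ 2|) volume :=
    (hSm.norm.integrable_mul hD2'.norm)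
  have e3 : ∫ x, c x * ((u x - u (x - h)) ^ 3 - (u (x + h) - u x) ^ 3) ≤
      ∫ x, 3 / 2 * η * (|S x| * |(u (x + h) - u x) ^ 2| + |S x| * |(u x - u (x - h)) ^ 2|) := by
    refine integral_mono_ae ?_ ((j1.add j2).const_mul _) ?_
    · simp_rw [mul_sub]
      exact i3.sub i2
    · filter_upwards [hη] with x hx
      set a := u (x + h) - u x
      set b := u x - u (x - h)
      have hab : S x = a - b := by simp only [hS, a, b]; ring
      have h1 : b ^ 3 - a ^ 3 = -(S x * (a ^ 2 + a * b + b ^ 2)) := by rw [hab]; ring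
      have h2 : |a ^ 2 + a * b + b ^ 2| ≤ 3 / 2 * (a ^ 2 + b ^ 2) := by
        rw [abs_le]
        constructor <;> nlinarith [sq_nonneg (a - b), sq_nonneg (a + b)]
      calc c x * (b ^ 3 - a ^ 3) ≤ |c x * (b ^ 3 - a ^ 3)| := le_abs_self _
        _ = |c x| * (|S x| * |a ^ 2 + a * b + b ^ 2|) := by
            rw [h1, abs_mul, abs_neg, abs_mul]
        _ ≤ η * (|S x| * (3 / 2 * (a ^ 2 + b ^ 2))) := by gcongr
        _ = _ := by rw [abs_of_nonneg (sq_nonneg a), abs_of_nonneg (sq_nonneg b)]; ring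
  rw [e2]
  refine e3.trans ?_
  rw [integral_const_mul, integral_add j1 j2]
  have k1 := integral_mul_le_sqrt hSm hD2
  have k2 := integral_mul_le_sqrt hSm hD2'
  have e4 : ∫ x, ((u x - u (x - h)) ^ 2) ^ 2 = ∫ x, ((u (x + h) - u x) ^ 2) ^ 2 := by
    have := integral_add_right_eq_self (μ := (volume : Measure (Space d)))
      (fun x => ((u x - u (x - h)) ^ 2) ^ 2) h
    rw [← this]
    simp
  rw [e4] at k2
  simp_rw [← pow_mul] at k1 k2
  norm_num only at k1 k2
  calc 3 / 2 * η * _ ≤ 3 / 2 * η * (√(∫ x, S x ^ 2) * √(∫ x, (u (x + h) - u x) ^ 4) +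
        √(∫ x, S x ^ 2) * √(∫ x, (u (x + h) - u x) ^ 4)) := by gcongr
    _ = _ := by ring

/-- A discrete Gagliardo–Nirenberg inequality, with no differentiation. -/
theorem integral_diff_pow_four_le (hu : MemLp u 2 volume) (hM : ∀ᵐ x, |u x| ≤ M) (hM0 : 0 ≤ M)
    (h : Space d) : ∫ x, (u (x + h) - u x) ^ 4 ≤
      (3 * M) ^ 2 * ∫ x, (u (x + h) + u (x - h) - 2 * u x) ^ 2 := by
  have h1 := integral_diff_mul_cube_le hu hM hu.1 hM hM0 h
  have e : ∫ x, (u (x + h) - u x) * (u (x + h) - u x) ^ 3 = ∫ x, (u (x + h) - u x) ^ 4 :=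
    integral_congr_ae (Eventually.of_forall fun x => by ring)
  rw [e] at h1
  set E := ∫ x, (u (x + h) - u x) ^ 4
  set T := ∫ x, (u (x + h) + u (x - h) - 2 * u x) ^ 2
  have hE : 0 ≤ E := integral_nonneg fun x => by positivity
  have hT : 0 ≤ T := integral_nonneg fun x => by positivity
  rcases hE.eq_or_lt with h0 | h0
  · rw [← h0]; positivity
  have h2 : 0 < √E := Real.sqrt_pos.2 h0
  -- With c = u the inequality reads E ≤ 3M √T √E, and one factor √E cancels.
  have h3 : √E ≤ 3 * M * √T := by
    have h4 : √E * √E ≤ (3 * M * √T) * √E := by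
      rw [Real.mul_self_sqrt hE]; linarith
    exact le_of_mul_le_mul_right h4 h2
  calc E = √E ^ 2 := (Real.sq_sqrt hE).symm
    _ ≤ (3 * M * √T) ^ 2 := by gcongr
    _ = _ := by rw [mul_pow, Real.sq_sqrt hT]

/-- Clipping is monotone. The sign allows an integral over a subset to be bounded by the integral
over the whole space. -/
theorem clip_diff_mul_nonneg (η a b : ℝ) :
    0 ≤ (max (-η) (min η a) - max (-η) (min η b)) * (a - b) ^ 3 := by
  rcases le_total a b with hab | hab
  · have h1 : max (-η) (min η a) ≤ max (-η) (min η b) :=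
      max_le_max_left _ (min_le_min_left _ hab)
    have h2 : (a - b) ^ 3 ≤ 0 := by
      have : a - b ≤ 0 := by linarith
      exact Odd.pow_nonpos (by decide) this
    exact mul_nonneg_of_nonpos_of_nonpos (by linarith) h2
  · have h1 : max (-η) (min η b) ≤ max (-η) (min η a) :=
      max_le_max_left _ (min_le_min_left _ hab)
    have : 0 ≤ a - b := by linarith
    exact mul_nonneg (by linarith) (by positivity)

/-- The part of the discrete Gagliardo–Nirenberg inequality near the zeros of the function. -/
theorem setIntegral_diff_pow_four_le (hu : MemLp u 2 volume) (hM : ∀ᵐ x, |u x| ≤ M) (hM0 : 0 ≤ M)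
    (hη : 0 ≤ η) (h : Space d) {s : Set (Space d)} (hsm : NullMeasurableSet s volume)
    (hs : ∀ x ∈ s, |u x| ≤ η ∧ |u (x + h)| ≤ η) :
    ∫ x in s, (u (x + h) - u x) ^ 4 ≤
      9 * η * M * ∫ x, (u (x + h) + u (x - h) - 2 * u x) ^ 2 := by
  -- The clipped function agrees with u at x and x + h for x in `s`, but is bounded by η instead of
  -- M; this is the source of the gain.
  set c : Space d → ℝ := fun x => max (-η) (min η (u x)) with hc
  have hcm : AEStronglyMeasurable c volume :=
    aestronglyMeasurable_const.sup (aestronglyMeasurable_const.inf hu.1)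
  have hcη : ∀ x, |c x| ≤ η := fun x => by
    rw [abs_le]
    exact ⟨le_max_left _ _, max_le (by linarith) (min_le_left _ _)⟩
  have h1 := integral_diff_mul_cube_le hu hM hcm (Eventually.of_forall hcη) hη h
  have hcs : AEStronglyMeasurable (fun x => c (x + h)) volume :=
    hcm.comp_measurePreserving (measurePreserving_add h)
  have hint : Integrable (fun x => (c (x + h) - c x) * (u (x + h) - u x) ^ 3) volume := by
    refine (integrable_diff_cube hu hM h).bdd_mul (c := 2 * η) (hcs.sub hcm)
      (Eventually.of_forall fun x => ?_)
    rw [Real.norm_eq_abs]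
    exact (abs_sub _ _).trans (by linarith [hcη x, hcη (x + h)])
  have h2 : ∫ x in s, (u (x + h) - u x) ^ 4 ≤
      ∫ x, (c (x + h) - c x) * (u (x + h) - u x) ^ 3 := by
    have e : ∫ x in s, (u (x + h) - u x) ^ 4 =
        ∫ x in s, (c (x + h) - c x) * (u (x + h) - u x) ^ 3 := by
      refine setIntegral_congr_fun₀ hsm fun x hx => ?_
      obtain ⟨ha, hb⟩ := hs x hx
      rw [abs_le] at ha hb
      simp only [hc]
      rw [min_eq_right ha.2, min_eq_right hb.2, max_eq_right ha.1, max_eq_right hb.1]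
      ring
    rw [e]
    exact setIntegral_le_integral hint
      (Eventually.of_forall fun x => clip_diff_mul_nonneg η (u (x + h)) (u x))
  refine h2.trans (h1.trans ?_)
  have h3 := integral_diff_pow_four_le hu hM hM0 h
  set E := ∫ x, (u (x + h) - u x) ^ 4
  set T := ∫ x, (u (x + h) + u (x - h) - 2 * u x) ^ 2
  have hT : 0 ≤ T := integral_nonneg fun x => by positivity
  have h4 : √E ≤ 3 * M * √T := by
    refine (Real.sqrt_le_sqrt h3).trans_eq ?_
    rw [Real.sqrt_mul (by positivity), Real.sqrt_sq (by positivity)]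
  calc 3 * η * (√T * √E) ≤ 3 * η * (√T * (3 * M * √T)) := by gcongr
    _ = 9 * η * M * (√T * √T) := by ring
    _ = _ := by rw [Real.mul_self_sqrt hT]

end GagliardoNirenberg

theorem secondDiff_neg (h : Space d) : (secondDiff (-h) : L2 d →L[ℂ] L2 d) = secondDiff h := by
  rw [secondDiff, secondDiff, diffSymbol, diffSymbol, neg_neg, add_comm (transSymbol h)]

/-- Clipping requires real values, so the inequalities for complex functions are obtained separately
for L the real and the imaginary part. -/
theorem integral_part_secondDiff_le (L : ℂ →L[ℝ] ℝ) (hL : ∀ z, |L z| ≤ ‖z‖) (f : L2 d)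
    (h : Space d) :
    ∫ x, (L (f (x + h)) + L (f (x - h)) - 2 * L (f x)) ^ 2 ≤ ‖secondDiff h f‖ ^ 2 := by
  rw [norm_sq_eq_integral]
  have hi : Integrable (fun x => ‖secondDiff h f x‖ ^ 2) volume :=
    (Lp.memLp (secondDiff h f)).integrable_norm_pow (by norm_num)
  refine integral_mono_of_nonneg (Eventually.of_forall fun x => sq_nonneg _) hi ?_
  filter_upwards [coeFn_secondDiff h f] with x hx
  have h1 : L (f (x + h)) + L (f (x - h)) - 2 * L (f x) = L (secondDiff h f x) := by
    rw [hx, map_sub, map_add, show (2 : ℂ) * f x = (2 : ℝ) • f x by simp, map_smul, smul_eq_mul]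
  rw [h1, ← sq_abs]
  gcongr
  exact hL _

theorem memLp_part (L : ℂ →L[ℝ] ℝ) (f : L2 d) : MemLp (fun x => L (f x)) 2 volume :=
  L.comp_memLp' (Lp.memLp f)

theorem abs_reCLM_le (z : ℂ) : |Complex.reCLM z| ≤ ‖z‖ := Complex.abs_re_le_norm z

theorem abs_imCLM_le (z : ℂ) : |Complex.imCLM z| ≤ ‖z‖ := Complex.abs_im_le_norm z

theorem eLpNorm_part_diff_sq_le (L : ℂ →L[ℝ] ℝ) (hL : ∀ z, |L z| ≤ ‖z‖) {f : L2 d} {M : ℝ}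
    (hM0 : 0 ≤ M) (hM : ∀ᵐ x, ‖f x‖ ≤ M) (h : Space d) :
    eLpNorm (fun x => (L (f (x + h)) - L (f x)) ^ 2) 2 volume ≤
      ENNReal.ofReal (3 * M * ‖secondDiff h f‖) := by
  have hM' : ∀ᵐ x, |L (f x)| ≤ M := hM.mono fun x hx => (hL _).trans hx
  have hu := memLp_part L f
  have h1 := integral_diff_pow_four_le hu hM' hM0 h
  have h2 := integral_part_secondDiff_le L hL f h
  refine eLpNorm_two_le ((memLp_diff_sq hu hM' h).integrable_sq) (by positivity) ?_
  simp_rw [← pow_mul]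
  norm_num only
  calc _ ≤ _ := h1
    _ ≤ (3 * M) ^ 2 * ‖secondDiff h f‖ ^ 2 := by gcongr
    _ = _ := by ring

theorem normSq_diff (z w : ℂ) : ‖z - w‖ ^ 2 =
    (Complex.reCLM z - Complex.reCLM w) ^ 2 + (Complex.imCLM z - Complex.imCLM w) ^ 2 := by
  rw [← Complex.normSq_eq_norm_sq, Complex.normSq_apply]
  simp only [Complex.sub_re, Complex.sub_im, Complex.reCLM_apply, Complex.imCLM_apply]
  ring

theorem aestronglyMeasurable_part_diff_sq (L : ℂ →L[ℝ] ℝ) (f : L2 d) (h : Space d) :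
    AEStronglyMeasurable (fun x => (L (f (x + h)) - L (f x)) ^ 2) volume :=
  (memLp_diff (memLp_part L f) h).1.pow 2

theorem eLpNorm_diff_sq_le {f : L2 d} {M : ℝ} (hM0 : 0 ≤ M) (hM : ∀ᵐ x, ‖f x‖ ≤ M) (h : Space d) :
    eLpNorm (fun x => ‖f (x + h) - f x‖ ^ 2) 2 volume ≤
      ENNReal.ofReal (6 * M * ‖secondDiff h f‖) := by
  simp_rw [normSq_diff]
  refine (eLpNorm_add_le (aestronglyMeasurable_part_diff_sq _ f h)
    (aestronglyMeasurable_part_diff_sq _ f h) (by norm_num)).trans ?_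
  refine (add_le_add (eLpNorm_part_diff_sq_le _ abs_reCLM_le hM0 hM h)
    (eLpNorm_part_diff_sq_le _ abs_imCLM_le hM0 hM h)).trans_eq ?_
  rw [← ENNReal.ofReal_add (by positivity) (by positivity)]
  ring_nf

theorem nullMeasurableSet_small (f : L2 d) (η : ℝ) (h : Space d) :
    NullMeasurableSet {x | ‖f x‖ ≤ η ∧ ‖f (x + h)‖ ≤ η} volume := by
  have h1 : AEMeasurable (fun x => ‖f x‖) volume := (Lp.aestronglyMeasurable f).norm.aemeasurable
  have h2 : AEMeasurable (fun x => ‖f (x + h)‖) volume :=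
    ((Lp.aestronglyMeasurable f).comp_measurePreserving
      (measurePreserving_add h)).norm.aemeasurable
  exact (nullMeasurableSet_le h1 aemeasurable_const).inter
    (nullMeasurableSet_le h2 aemeasurable_const)

theorem eLpNorm_part_diff_sq_small_le (L : ℂ →L[ℝ] ℝ) (hL : ∀ z, |L z| ≤ ‖z‖) {f : L2 d} {M η : ℝ}
    (hM0 : 0 ≤ M) (hη : 0 ≤ η) (hM : ∀ᵐ x, ‖f x‖ ≤ M) (h : Space d) :
    eLpNorm ({x | ‖f x‖ ≤ η ∧ ‖f (x + h)‖ ≤ η}.indicator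
      fun x => (L (f (x + h)) - L (f x)) ^ 2) 2 volume ≤
      ENNReal.ofReal (3 * √(η * M) * ‖secondDiff h f‖) := by
  have hM' : ∀ᵐ x, |L (f x)| ≤ M := hM.mono fun x hx => (hL _).trans hx
  have hu := memLp_part L f
  have hs := nullMeasurableSet_small f η h
  have h1 := setIntegral_diff_pow_four_le hu hM' hM0 hη h hs
    fun x hx => ⟨(hL _).trans hx.1, (hL _).trans hx.2⟩
  have h2 := integral_part_secondDiff_le L hL f h
  have e : (fun x => ({x | ‖f x‖ ≤ η ∧ ‖f (x + h)‖ ≤ η}.indicator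
      (fun x => (L (f (x + h)) - L (f x)) ^ 2) x) ^ 2) =
      {x | ‖f x‖ ≤ η ∧ ‖f (x + h)‖ ≤ η}.indicator
        fun x => ((L (f (x + h)) - L (f x)) ^ 2) ^ 2 := by
    ext x
    by_cases hx : x ∈ {x | ‖f x‖ ≤ η ∧ ‖f (x + h)‖ ≤ η}
    · rw [Set.indicator_of_mem hx, Set.indicator_of_mem hx]
    · rw [Set.indicator_of_notMem hx, Set.indicator_of_notMem hx]; simp
  refine eLpNorm_two_le ?_ (by positivity) ?_
  · rw [e]
    exact ((memLp_diff_sq hu hM' h).integrable_sq).indicator₀ hs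
  · rw [e, integral_indicator₀ hs]
    simp_rw [← pow_mul]
    norm_num only
    calc _ ≤ _ := h1
      _ ≤ 9 * η * M * ‖secondDiff h f‖ ^ 2 := by gcongr
      _ = 9 * (√(η * M)) ^ 2 * ‖secondDiff h f‖ ^ 2 := by
          rw [Real.sq_sqrt (by positivity)]; ring
      _ = _ := by ring

theorem eLpNorm_diff_sq_small_le {f : L2 d} {M η : ℝ} (hM0 : 0 ≤ M) (hη : 0 ≤ η)
    (hM : ∀ᵐ x, ‖f x‖ ≤ M) (h : Space d) :
    eLpNorm ({x | ‖f x‖ ≤ η ∧ ‖f (x + h)‖ ≤ η}.indicator fun x => ‖f (x + h) - f x‖ ^ 2) 2 volume ≤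
      ENNReal.ofReal (6 * √(η * M) * ‖secondDiff h f‖) := by
  have hs := nullMeasurableSet_small f η h
  simp_rw [normSq_diff]
  have e := Set.indicator_add' {x | ‖f x‖ ≤ η ∧ ‖f (x + h)‖ ≤ η}
    (fun x => (Complex.reCLM (f (x + h)) - Complex.reCLM (f x)) ^ 2)
    (fun x => (Complex.imCLM (f (x + h)) - Complex.imCLM (f x)) ^ 2)
  change eLpNorm (Set.indicator _ ((fun x => (Complex.reCLM (f (x + h)) - Complex.reCLM (f x)) ^ 2)
    + (fun x => (Complex.imCLM (f (x + h)) - Complex.imCLM (f x)) ^ 2))) 2 volume ≤ _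
  rw [e]
  refine (eLpNorm_add_le ((aestronglyMeasurable_part_diff_sq _ f h).indicator₀ hs)
    ((aestronglyMeasurable_part_diff_sq _ f h).indicator₀ hs) (by norm_num)).trans ?_
  refine (add_le_add (eLpNorm_part_diff_sq_small_le _ abs_reCLM_le hM0 hη hM h)
    (eLpNorm_part_diff_sq_small_le _ abs_imCLM_le hM0 hη hM h)).trans_eq ?_
  rw [← ENNReal.ofReal_add (by positivity) (by positivity)]
  ring_nf

/-! ### Pointwise calculus of the power nonlinearity. -/

theorem abs_rpow_sub_le {q M a b : ℝ} (hq : 1 ≤ q) (ha : 0 ≤ a) (haM : a ≤ M) (hb : 0 ≤ b)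
    (hbM : b ≤ M) : |a ^ q - b ^ q| ≤ q * M ^ (q - 1) * |a - b| := by
  have := (convex_Icc (0 : ℝ) M).norm_image_sub_le_of_norm_hasDerivWithin_le
    (f := fun x : ℝ => x ^ q) (f' := fun x => q * x ^ (q - 1)) (C := q * M ^ (q - 1))
    (fun x _ => (Real.hasDerivAt_rpow_const (Or.inr hq)).hasDerivWithinAt)
    (fun x hx => by
      have h1 : x ^ (q - 1) ≤ M ^ (q - 1) := Real.rpow_le_rpow hx.1 hx.2 (by linarith)
      have h2 : 0 ≤ x ^ (q - 1) := Real.rpow_nonneg hx.1 _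
      rw [Real.norm_of_nonneg (by positivity)]
      gcongr) ⟨hb, hbM⟩ ⟨ha, haM⟩
  simpa using this

/-- The power nonlinearity `|z|^{p-1} z`. -/
def powNL (p : ℝ) (z : ℂ) : ℂ := ((‖z‖ ^ (p - 1) : ℝ) : ℂ) * z

theorem powNL_eq_smul (p : ℝ) (z : ℂ) : powNL p z = (‖z‖ ^ (p - 1)) • z := by
  rw [powNL, Complex.real_smul]

/-- The real derivative of the power nonlinearity. -/
def powNLDeriv (p : ℝ) (z : ℂ) : ℂ →L[ℝ] ℂ :=
  (‖z‖ ^ (p - 1)) • ContinuousLinearMap.id ℝ ℂ +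
    (((p - 1) * ‖z‖ ^ (p - 3)) • innerSL ℝ z).smulRight z

theorem hasFDerivAt_norm_rpow_of_ne {z : ℂ} (hz : z ≠ 0) (q : ℝ) :
    HasFDerivAt (fun z : ℂ => ‖z‖ ^ q) ((q * ‖z‖ ^ (q - 2)) • innerSL ℝ z) z := by
  have h1 : HasFDerivAt (fun z : ℂ => ‖z‖ ^ 2) (2 • innerSL ℝ z) z :=
    (hasStrictFDerivAt_norm_sq z).hasFDerivAt
  have hpos : 0 < ‖z‖ := norm_pos_iff.2 hz
  have h2 := h1.rpow_const (p := q / 2) (Or.inl (by positivity))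
  have e : (fun z : ℂ => (‖z‖ ^ 2) ^ (q / 2)) = fun z : ℂ => ‖z‖ ^ q := by
    ext w
    rw [← Real.rpow_natCast, ← Real.rpow_mul (norm_nonneg _)]
    congr 1; push_cast; ring
  rw [e] at h2
  convert! h2 using 1
  rw [← Real.rpow_natCast ‖z‖ 2, ← Real.rpow_mul (norm_nonneg _), two_nsmul, ← two_smul ℝ, smul_smul]
  congr 1
  rw [show ((2 : ℕ) : ℝ) * (q / 2 - 1) = q - 2 by push_cast; ring]
  ring

theorem hasFDerivAt_powNL {p : ℝ} (hp : 2 ≤ p) (z : ℂ) :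
    HasFDerivAt (powNL p) (powNLDeriv p z) z := by
  have e : powNL p = fun z : ℂ => (‖z‖ ^ (p - 1)) • z := funext fun z => powNL_eq_smul p z
  rw [e]
  rcases eq_or_ne z 0 with rfl | hz
  · have h0 : powNLDeriv p 0 = 0 := by
      rw [powNLDeriv, norm_zero, Real.zero_rpow (by linarith)]
      ext; simp
    rw [h0, hasFDerivAt_iff_isLittleO]
    simp only [sub_zero, smul_zero, zero_apply]
    have h1 : Tendsto (fun z : ℂ => ‖z‖ ^ (p - 1)) (𝓝 0) (𝓝 0) := by
      have h2 : Continuous fun z : ℂ => ‖z‖ ^ (p - 1) :=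
        continuous_norm.rpow_const fun _ => Or.inr (by linarith)
      have := h2.tendsto 0
      simpa [Real.zero_rpow (by linarith : p - 1 ≠ 0)] using this
    have h3 := ((Asymptotics.isLittleO_one_iff ℝ).2 h1).smul_isBigO
      (Asymptotics.isBigO_refl (fun z : ℂ => z) (𝓝 0))
    simpa using h3
  · have h1 := (hasFDerivAt_norm_rpow_of_ne hz (p - 1)).smul (hasFDerivAt_id z)
    rw [show p - 1 - 2 = p - 3 by ring] at h1
    exact h1

theorem powNLDeriv_apply (p : ℝ) (z w : ℂ) : powNLDeriv p z w =
    (‖z‖ ^ (p - 1)) • w + ((p - 1) * ‖z‖ ^ (p - 3) * inner ℝ z w) • z := by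
  simp [powNLDeriv, mul_assoc]

theorem powNLDeriv_zero {p : ℝ} (hp : 2 ≤ p) : powNLDeriv p 0 = 0 := by
  rw [powNLDeriv, norm_zero, Real.zero_rpow (by linarith)]
  ext; simp

theorem powNLDeriv_apply' {p : ℝ} {z : ℂ} (hz : z ≠ 0) (w : ℂ) : powNLDeriv p z w =
    (‖z‖ ^ (p - 1)) • (w + ((p - 1) * inner ℝ ((‖z‖⁻¹) • z) w) • ((‖z‖⁻¹) • z)) := by
  have h0 : 0 < ‖z‖ := norm_pos_iff.2 hz
  have h1 : ‖z‖ ^ (p - 3) = ‖z‖ ^ (p - 1) * (‖z‖⁻¹ * ‖z‖⁻¹) := by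
    rw [show p - 3 = p - 1 - (2 : ℕ) by push_cast; ring, Real.rpow_sub_natCast h0.ne']
    field_simp
  rw [powNLDeriv_apply, h1, smul_add, real_inner_smul_left, smul_smul, smul_smul]
  congr 2
  ring

theorem norm_powNLDeriv_le {p : ℝ} (hp : 2 ≤ p) (z : ℂ) :
    ‖powNLDeriv p z‖ ≤ p * ‖z‖ ^ (p - 1) := by
  refine ContinuousLinearMap.opNorm_le_bound _ (by positivity) fun w => ?_
  rcases eq_or_ne z 0 with rfl | hz
  · rw [powNLDeriv_zero hp]
    simp only [zero_apply, norm_zero]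
    positivity
  have h0 : 0 < ‖z‖ := norm_pos_iff.2 hz
  have hu : ‖(‖z‖⁻¹) • z‖ = 1 := by
    rw [norm_smul, norm_inv, norm_norm, inv_mul_cancel₀ h0.ne']
  rw [powNLDeriv_apply' hz, norm_smul, Real.norm_of_nonneg (by positivity)]
  have h2 : ‖w + ((p - 1) * inner ℝ ((‖z‖⁻¹) • z) w) • ((‖z‖⁻¹) • z)‖ ≤ p * ‖w‖ := by
    refine (norm_add_le _ _).trans ?_
    rw [norm_smul, hu, mul_one, norm_mul, Real.norm_of_nonneg (by linarith : 0 ≤ p - 1)]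
    have h3 : ‖inner ℝ ((‖z‖⁻¹) • z) w‖ ≤ 1 * ‖w‖ := by
      rw [← hu]; exact norm_inner_le_norm _ _
    nlinarith
  calc _ ≤ ‖z‖ ^ (p - 1) * (p * ‖w‖) := by gcongr
    _ = _ := by ring

/-- The direction z/|z| jumps at the origin, but the factor |z'| makes its variation Lipschitz;
`powNLDeriv_apply'` isolates the direction so that this can be used. -/
theorem norm_mul_unit_sub_le {z z' : ℂ} (hz : z ≠ 0) (hz' : z' ≠ 0) :
    ‖z'‖ * ‖(‖z‖⁻¹) • z - (‖z'‖⁻¹) • z'‖ ≤ 2 * ‖z - z'‖ := by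
  have h0 : 0 < ‖z‖ := norm_pos_iff.2 hz
  have h0' : 0 < ‖z'‖ := norm_pos_iff.2 hz'
  have hu : ‖(‖z‖⁻¹) • z‖ = 1 := by
    rw [norm_smul, norm_inv, norm_norm, inv_mul_cancel₀ h0.ne']
  have e : ‖z'‖ • ((‖z‖⁻¹) • z - (‖z'‖⁻¹) • z') =
      (‖z'‖ - ‖z‖) • ((‖z‖⁻¹) • z) + (z - z') := by
    rw [smul_sub, smul_smul ‖z'‖ ‖z'‖⁻¹, mul_inv_cancel₀ h0'.ne', one_smul, sub_smul,
      smul_smul ‖z‖ ‖z‖⁻¹, mul_inv_cancel₀ h0.ne', one_smul]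
    abel
  have h1 : ‖z'‖ * ‖(‖z‖⁻¹) • z - (‖z'‖⁻¹) • z'‖ =
      ‖(‖z'‖ - ‖z‖) • ((‖z‖⁻¹) • z) + (z - z')‖ := by
    rw [← e, norm_smul, norm_norm]
  rw [h1]
  refine (norm_add_le _ _).trans ?_
  rw [norm_smul, hu, mul_one, two_mul]
  gcongr
  rw [Real.norm_eq_abs, norm_sub_rev z z']
  exact abs_norm_sub_norm_le _ _

/-- For p ≥ 2 the modulus |z|^{p-1} is locally Lipschitz and also tames the jump of z/|z| at the
origin, so the bound holds across zero. The two contributions add up to p² + 4(p - 1), which is at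
most 5p². -/
theorem powNLDeriv_lipschitz {p M : ℝ} (hp : 2 ≤ p) {z z' : ℂ} (hz : ‖z‖ ≤ M) (hz' : ‖z'‖ ≤ M) :
    ‖powNLDeriv p z - powNLDeriv p z'‖ ≤ 5 * p ^ 2 * M ^ (p - 2) * ‖z - z'‖ := by
  have hM0 : 0 ≤ M := (norm_nonneg z).trans hz
  have key : ∀ w : ℂ, ‖w‖ ≤ M → p * ‖w‖ ^ (p - 1) ≤ 5 * p ^ 2 * M ^ (p - 2) * ‖w‖ := by
    intro w hw
    rcases (norm_nonneg w).eq_or_lt with h | h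
    · rw [← h, Real.zero_rpow (by linarith)]; simp
    have h1 : ‖w‖ ^ (p - 1) = ‖w‖ ^ (p - 2) * ‖w‖ := by
      rw [← Real.rpow_add_one h.ne']; congr 1; ring
    have h2 : ‖w‖ ^ (p - 2) ≤ M ^ (p - 2) := Real.rpow_le_rpow h.le hw (by linarith)
    have h3 : 0 ≤ ‖w‖ ^ (p - 2) := by positivity
    rw [h1, ← mul_assoc]
    gcongr
    nlinarith
  rcases eq_or_ne z 0 with rfl | hz0
  · rw [powNLDeriv_zero hp, zero_sub, norm_neg, zero_sub, norm_neg]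
    exact (norm_powNLDeriv_le hp z').trans (key z' hz')
  rcases eq_or_ne z' 0 with rfl | hz0'
  · rw [powNLDeriv_zero hp, sub_zero, sub_zero]
    exact (norm_powNLDeriv_le hp z).trans (key z hz)
  have h0 : 0 < ‖z‖ := norm_pos_iff.2 hz0
  have h0' : 0 < ‖z'‖ := norm_pos_iff.2 hz0'
  refine ContinuousLinearMap.opNorm_le_bound _ (by positivity) fun w => ?_
  rw [sub_apply, powNLDeriv_apply' hz0, powNLDeriv_apply' hz0']
  have hA := abs_rpow_sub_le (q := p - 1) (by linarith) h0.le hz h0'.le hz'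
  rw [show p - 1 - 1 = p - 2 by ring] at hA
  have hAB : |‖z‖ - ‖z'‖| ≤ ‖z - z'‖ := abs_norm_sub_norm_le _ _
  have hV := norm_mul_unit_sub_le hz0 hz0'
  have hu : ‖(‖z‖⁻¹) • z‖ = 1 := by
    rw [norm_smul, norm_inv, norm_norm, inv_mul_cancel₀ h0.ne']
  have hu' : ‖(‖z'‖⁻¹) • z'‖ = 1 := by
    rw [norm_smul, norm_inv, norm_norm, inv_mul_cancel₀ h0'.ne']
  set e : ℂ := (‖z‖⁻¹) • z
  set e' : ℂ := (‖z'‖⁻¹) • z'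
  set A := ‖z‖ ^ (p - 1)
  set A' := ‖z'‖ ^ (p - 1) with hA'
  have e1 : A • (w + ((p - 1) * inner ℝ e w) • e) - A' • (w + ((p - 1) * inner ℝ e' w) • e') =
      (A - A') • (w + ((p - 1) * inner ℝ e w) • e) +
        (A' * (p - 1)) • (inner ℝ e w • (e - e') + inner ℝ (e - e') w • e') := by
    rw [inner_sub_left]
    module
  have hi : ‖inner ℝ e w‖ ≤ ‖w‖ := by
    have := norm_inner_le_norm (𝕜 := ℝ) e w
    rwa [hu, one_mul] at this
  have h2 : ‖w + ((p - 1) * inner ℝ e w) • e‖ ≤ p * ‖w‖ := by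
    refine (norm_add_le _ _).trans ?_
    rw [norm_smul, hu, mul_one, norm_mul, Real.norm_of_nonneg (by linarith : 0 ≤ p - 1)]
    nlinarith
  have h3 : ‖inner ℝ e w • (e - e') + inner ℝ (e - e') w • e'‖ ≤ 2 * ‖e - e'‖ * ‖w‖ := by
    refine (norm_add_le _ _).trans ?_
    rw [norm_smul, norm_smul, hu', mul_one]
    have := norm_inner_le_norm (𝕜 := ℝ) (e - e') w
    nlinarith [norm_nonneg (e - e')]
  have h4 : A' = ‖z'‖ ^ (p - 2) * ‖z'‖ := by
    rw [hA', ← Real.rpow_add_one h0'.ne']; congr 1; ring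
  have h5 : ‖z'‖ ^ (p - 2) ≤ M ^ (p - 2) := Real.rpow_le_rpow h0'.le hz' (by linarith)
  have h6 : 0 ≤ ‖z'‖ ^ (p - 2) := by positivity
  have h7 : 0 ≤ M ^ (p - 2) := by positivity
  have h8 : |A - A'| ≤ p * M ^ (p - 2) * ‖z - z'‖ := by
    refine hA.trans ?_
    gcongr
    linarith
  have h9 : A' * ‖e - e'‖ ≤ M ^ (p - 2) * (2 * ‖z - z'‖) := by
    rw [h4, mul_assoc]
    gcongr
  have hA'0 : 0 ≤ A' := by positivity
  have hp1 : 0 ≤ p - 1 := by linarith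
  rw [e1]
  refine (norm_add_le _ _).trans ?_
  rw [norm_smul, norm_smul, Real.norm_of_nonneg (by positivity : 0 ≤ A' * (p - 1)),
    Real.norm_eq_abs]
  calc |A - A'| * ‖w + ((p - 1) * inner ℝ e w) • e‖ +
        A' * (p - 1) * ‖inner ℝ e w • (e - e') + inner ℝ (e - e') w • e'‖
      ≤ (p * M ^ (p - 2) * ‖z - z'‖) * (p * ‖w‖) + A' * (p - 1) * (2 * ‖e - e'‖ * ‖w‖) := by
        gcongr
    _ = (p * M ^ (p - 2) * ‖z - z'‖) * (p * ‖w‖) + 2 * (p - 1) * (A' * ‖e - e'‖) * ‖w‖ := by ring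
    _ ≤ (p * M ^ (p - 2) * ‖z - z'‖) * (p * ‖w‖) +
        2 * (p - 1) * (M ^ (p - 2) * (2 * ‖z - z'‖)) * ‖w‖ := by gcongr
    _ = (p ^ 2 + 4 * (p - 1)) * (M ^ (p - 2) * ‖z - z'‖ * ‖w‖) := by ring
    _ ≤ (5 * p ^ 2) * (M ^ (p - 2) * ‖z - z'‖ * ‖w‖) := by
        gcongr
        nlinarith
    _ = _ := by ring

theorem powNL_taylor_le {p M : ℝ} (hp : 2 ≤ p) {a b : ℂ} (ha : ‖a‖ ≤ M) (hb : ‖b‖ ≤ M) :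
    ‖powNL p b - powNL p a - powNLDeriv p a (b - a)‖ ≤
      5 * p ^ 2 * M ^ (p - 2) * ‖b - a‖ ^ 2 := by
  have hM0 : 0 ≤ M := (norm_nonneg a).trans ha
  have hseg : ∀ x ∈ segment ℝ a b, ‖x‖ ≤ M := by
    intro x hx
    have := (convex_closedBall (0 : ℂ) M).segment_subset (by simpa using ha) (by simpa using hb) hx
    simpa using this
  have := (convex_segment a b).norm_image_sub_le_of_norm_hasFDerivWithin_le'
    (f := powNL p) (f' := powNLDeriv p) (φ := powNLDeriv p a)
    (C := 5 * p ^ 2 * M ^ (p - 2) * ‖b - a‖)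
    (fun x _ => (hasFDerivAt_powNL hp x).hasFDerivWithinAt)
    (fun x hx => by
      refine (powNLDeriv_lipschitz hp (hseg x hx) ha).trans ?_
      gcongr
      obtain ⟨s, t, hs, ht, hst, rfl⟩ := hx
      have e : s • a + t • b - a = t • (b - a) := by
        rw [show s = 1 - t by linarith]; module
      rw [e, norm_smul, Real.norm_of_nonneg ht]
      exact mul_le_of_le_one_left (norm_nonneg _) (by linarith))
    (left_mem_segment ℝ a b) (right_mem_segment ℝ a b)
  exact this.trans_eq (by ring)

theorem contDiffAt_powNL {p : ℝ} {z : ℂ} (hz : z ≠ 0) (n : ℕ) : ContDiffAt ℝ n (powNL p) z := by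
  have e : powNL p = fun z : ℂ => (‖z‖ ^ (p - 1)) • z := funext fun z => powNL_eq_smul p z
  rw [e]
  exact ((contDiffAt_norm ℝ hz).rpow_const_of_ne (norm_ne_zero_iff.2 hz)).smul contDiffAt_id

theorem fderiv_powNL {p : ℝ} (hp : 2 ≤ p) : fderiv ℝ (powNL p) = powNLDeriv p :=
  funext fun z => (hasFDerivAt_powNL hp z).fderiv

theorem contDiffAt_powNLDeriv {p : ℝ} (hp : 2 ≤ p) {z : ℂ} (hz : z ≠ 0) :
    ContDiffAt ℝ 1 (powNLDeriv p) z := by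
  rw [← fderiv_powNL hp]
  exact (contDiffAt_powNL hz 2).fderiv_right (by norm_num)

theorem hasFDerivAt_powNLDeriv {p : ℝ} (hp : 2 ≤ p) {z : ℂ} (hz : z ≠ 0) :
    HasFDerivAt (powNLDeriv p) (fderiv ℝ (powNLDeriv p) z) z :=
  ((contDiffAt_powNLDeriv hp hz).differentiableAt (by norm_num)).hasFDerivAt

theorem continuousAt_fderiv_powNLDeriv {p : ℝ} (hp : 2 ≤ p) {z : ℂ} (hz : z ≠ 0) :
    ContinuousAt (fderiv ℝ (powNLDeriv p)) z :=
  ((contDiffAt_powNLDeriv hp hz).fderiv_right (m := 0) (by norm_num)).continuousAt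

theorem exists_delta_of_isCompact {G : Type*} [NormedAddCommGroup G] {K : Set ℂ} (hK : IsCompact K)
    {f : ℂ → G} (hf : ContinuousOn f K) {κ : ℝ} (hκ : 0 < κ) :
    ∃ δ > 0, ∀ z ∈ K, ∀ z' ∈ K, ‖z - z'‖ ≤ δ → ‖f z - f z'‖ ≤ κ := by
  obtain ⟨δ, hδ, h⟩ := Metric.uniformContinuousOn_iff_le.1
    (hK.uniformContinuousOn_of_continuous hf) κ hκ
  exact ⟨δ, hδ, fun z hz z' hz' hzz => by
    simpa only [dist_eq_norm] using h z hz z' hz' (by rwa [dist_eq_norm])⟩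

/-- Uniform continuity of the second derivative on a compact annulus. The lower radius is needed,
since at p = 2 the second derivative has no limit at 0. -/
theorem fderiv_powNLDeriv_uniform {p : ℝ} (hp : 2 ≤ p) {η : ℝ} (hη : 0 < η) (M : ℝ) {κ : ℝ}
    (hκ : 0 < κ) : ∃ δ > 0, ∀ z z' : ℂ, η ≤ ‖z‖ → ‖z‖ ≤ M → η ≤ ‖z'‖ → ‖z'‖ ≤ M →
      ‖z - z'‖ ≤ δ → ‖fderiv ℝ (powNLDeriv p) z - fderiv ℝ (powNLDeriv p) z'‖ ≤ κ := by
  have hK : IsCompact {z : ℂ | η ≤ ‖z‖ ∧ ‖z‖ ≤ M} := by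
    have e : {z : ℂ | η ≤ ‖z‖ ∧ ‖z‖ ≤ M} = Metric.closedBall 0 M ∩ {z | η ≤ ‖z‖} := by
      ext z; simp [and_comm]
    rw [e]
    exact (isCompact_closedBall (0 : ℂ) M).inter_right (isClosed_le continuous_const continuous_norm)
  have hc : ContinuousOn (fderiv ℝ (powNLDeriv p)) {z : ℂ | η ≤ ‖z‖ ∧ ‖z‖ ≤ M} := fun z hz =>
    (continuousAt_fderiv_powNLDeriv hp
      (norm_pos_iff.1 (hη.trans_le hz.1))).continuousWithinAt
  obtain ⟨δ, hδ, h⟩ := exists_delta_of_isCompact (G := ℂ →L[ℝ] ℂ →L[ℝ] ℂ) hK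
    (f := fderiv ℝ (powNLDeriv p)) (by convert! hc) hκ
  exact ⟨δ, hδ, fun z z' h1 h2 h3 h4 h5 => h z ⟨h1, h2⟩ z' ⟨h3, h4⟩ h5⟩

/-- Continuity of the second order Taylor remainder in the base point, away from zero. -/
theorem powNL_remainder_sub_le {p : ℝ} (hp : 2 ≤ p) {η : ℝ} (hη : 0 < η) (M : ℝ) {κ : ℝ}
    (hκ : 0 < κ) : ∃ δ > 0, ∀ a a' e : ℂ, 3 * η ≤ ‖a'‖ → ‖a'‖ ≤ M → ‖e‖ ≤ η → ‖a - a'‖ ≤ δ →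
      ‖(powNL p (a + e) - powNL p a - powNLDeriv p a e) -
        (powNL p (a' + e) - powNL p a' - powNLDeriv p a' e)‖ ≤ κ * ‖e‖ ^ 2 := by
  obtain ⟨δ, hδ, h⟩ := fderiv_powNLDeriv_uniform hp hη (M + 2 * η) hκ
  refine ⟨min δ η, lt_min hδ hη, fun a a' e h1 h2 he haa => ?_⟩
  have ha1 : ‖a - a'‖ ≤ δ := haa.trans (min_le_left _ _)
  have ha2 : ‖a - a'‖ ≤ η := haa.trans (min_le_right _ _)
  -- With |a'| ≥ 3η, moving by at most η along the increment and by at most η to the other base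
  -- point keeps every point at distance at least η from the origin.
  have lower : ∀ y : ℂ, ‖y‖ ≤ η → (2 * η ≤ ‖a' + y‖ ∧ ‖a' + y‖ ≤ M + η) := by
    intro y hy
    have h3 := norm_sub_norm_le a' (-y)
    rw [norm_neg, sub_neg_eq_add] at h3
    exact ⟨by linarith, (norm_add_le _ _).trans (by linarith)⟩
  have lower2 : ∀ y : ℂ, ‖y‖ ≤ η → (η ≤ ‖a + y‖ ∧ ‖a + y‖ ≤ M + 2 * η) := by
    intro y hy
    obtain ⟨h3, h4⟩ := lower y hy
    have e1 : a + y = (a' + y) + (a - a') := by ring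
    have h5 := norm_sub_norm_le (a' + y) (-(a - a'))
    rw [norm_neg, sub_neg_eq_add, ← e1] at h5
    have h6 : ‖a + y‖ ≤ ‖a' + y‖ + ‖a - a'‖ := by rw [e1]; exact norm_add_le _ _
    exact ⟨by linarith, by linarith⟩
  have ne1 : ∀ y : ℂ, ‖y‖ ≤ η → a' + y ≠ 0 := fun y hy =>
    norm_pos_iff.1 (by linarith [(lower y hy).1])
  have ne2 : ∀ y : ℂ, ‖y‖ ≤ η → a + y ≠ 0 := fun y hy =>
    norm_pos_iff.1 (by linarith [(lower2 y hy).1])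
  -- Two mean value inequalities: this one integrates the second derivative, and the next integrates
  -- the result once more, giving a bound quadratic in e.
  have hΘ : ∀ y : ℂ, ‖y‖ ≤ η → ‖(powNLDeriv p (a + y) - powNLDeriv p (a' + y)) -
      (powNLDeriv p a - powNLDeriv p a')‖ ≤ κ * ‖y‖ := by
    intro y hy
    have := (convex_closedBall (0 : ℂ) η).norm_image_sub_le_of_norm_hasFDerivWithin_le
      (f := fun y => powNLDeriv p (a + y) - powNLDeriv p (a' + y))
      (f' := fun y => fderiv ℝ (powNLDeriv p) (a + y) - fderiv ℝ (powNLDeriv p) (a' + y))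
      (C := κ) (x := 0) (y := y)
      (fun x hx => by
        rw [mem_closedBall_zero_iff] at hx
        have d1 := (hasFDerivAt_comp_add_left a).2 (hasFDerivAt_powNLDeriv hp (ne2 x hx))
        have d2 := (hasFDerivAt_comp_add_left a').2 (hasFDerivAt_powNLDeriv hp (ne1 x hx))
        exact (d1.sub d2).hasFDerivWithinAt)
      (fun x hx => by
        rw [mem_closedBall_zero_iff] at hx
        refine h _ _ (lower2 x hx).1 (lower2 x hx).2 ?_ ?_ ?_
        · linarith [(lower x hx).1]
        · linarith [(lower x hx).2]
        · rw [add_sub_add_right_eq_sub]; exact ha1)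
      (by simp [hη.le]) (by simpa using hy)
    simpa using this
  have hΨ := (convex_closedBall (0 : ℂ) ‖e‖).norm_image_sub_le_of_norm_hasFDerivWithin_le'
      (f := fun y => powNL p (a + y) - powNL p (a' + y))
      (f' := fun y => powNLDeriv p (a + y) - powNLDeriv p (a' + y))
      (φ := powNLDeriv p a - powNLDeriv p a')
      (C := κ * ‖e‖) (x := 0) (y := e)
      (fun x _ => (((hasFDerivAt_comp_add_left a).2 (hasFDerivAt_powNL hp (a + x))).sub
        ((hasFDerivAt_comp_add_left a').2 (hasFDerivAt_powNL hp (a' + x)))).hasFDerivWithinAt)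
      (fun x hx => by
        rw [mem_closedBall_zero_iff] at hx
        refine (hΘ x (hx.trans he)).trans ?_
        gcongr)
      (by simp) (by simp)
  simp only [add_zero, sub_zero, sub_apply] at hΨ
  rw [sq, ← mul_assoc]
  refine le_trans (le_of_eq ?_) hΨ
  congr 1
  ring

/-! ### The truncated nonlinearity as a Lipschitz map of L². -/

/-- The power nonlinearity, truncated to a globally Lipschitz function. -/
def truncNL (p M : ℝ) (z : ℂ) : ℂ := (min ‖z‖ M) ^ (p - 1) • z

theorem truncNL_of_le {p M : ℝ} {z : ℂ} (hz : ‖z‖ ≤ M) : truncNL p M z = powNL p z := by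
  rw [truncNL, min_eq_left hz, powNL_eq_smul]

theorem truncNL_zero (p M : ℝ) : truncNL p M 0 = 0 := by simp [truncNL]

theorem norm_truncNL_sub_le {p M : ℝ} (hp : 2 ≤ p) (hM : 0 ≤ M) (z z' : ℂ) :
    ‖truncNL p M z - truncNL p M z'‖ ≤ p * M ^ (p - 1) * ‖z - z'‖ := by
  -- The difference of the weights multiplies the smaller vector z': either both weights are capped
  -- and it vanishes, or ‖z'‖ ≤ M.
  wlog hzz : ‖z'‖ ≤ ‖z‖ generalizing z z'
  · rw [norm_sub_rev, norm_sub_rev z]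
    exact this z' z (le_of_not_ge hzz)
  have e : truncNL p M z - truncNL p M z' = (min ‖z‖ M) ^ (p - 1) • (z - z') +
      ((min ‖z‖ M) ^ (p - 1) - (min ‖z'‖ M) ^ (p - 1)) • z' := by
    rw [truncNL, truncNL]; module
  have hm : ∀ w : ℂ, 0 ≤ min ‖w‖ M := fun w => le_min (norm_nonneg _) hM
  have h1 : (min ‖z‖ M) ^ (p - 1) ≤ M ^ (p - 1) :=
    Real.rpow_le_rpow (hm z) (min_le_right _ _) (by linarith)
  have h2 : ‖((min ‖z‖ M) ^ (p - 1) - (min ‖z'‖ M) ^ (p - 1)) • z'‖ ≤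
      (p - 1) * M ^ (p - 1) * ‖z - z'‖ := by
    have hp1 : 0 ≤ p - 1 := by linarith
    rcases le_total M ‖z'‖ with h | h
    · rw [min_eq_right h, min_eq_right (h.trans hzz), sub_self, zero_smul, norm_zero]
      positivity
    · have h3 := abs_rpow_sub_le (q := p - 1) (by linarith) (hm z) (min_le_right ‖z‖ M) (hm z')
        (min_le_right ‖z'‖ M)
      have h4 : |min ‖z‖ M - min ‖z'‖ M| ≤ ‖z - z'‖ :=
        (abs_min_sub_min_le_max ‖z‖ M ‖z'‖ M).trans
          (by simpa using abs_norm_sub_norm_le z z')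
      rw [norm_smul, Real.norm_eq_abs]
      rcases hM.eq_or_lt with h0 | h0
      · have : ‖z'‖ = 0 := le_antisymm (h.trans_eq h0.symm) (norm_nonneg _)
        rw [this, mul_zero]; positivity
      calc _ ≤ ((p - 1) * M ^ (p - 1 - 1) * ‖z - z'‖) * M := by
            gcongr
            exact h3.trans (by gcongr)
        _ = (p - 1) * (M ^ (p - 1 - 1) * M) * ‖z - z'‖ := by ring
        _ = _ := by rw [← Real.rpow_add_one h0.ne', sub_add_cancel]
  rw [e]
  refine (norm_add_le _ _).trans ?_
  rw [norm_smul, Real.norm_of_nonneg (Real.rpow_nonneg (hm z) _)]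
  calc _ ≤ M ^ (p - 1) * ‖z - z'‖ + (p - 1) * M ^ (p - 1) * ‖z - z'‖ := by gcongr
    _ = _ := by ring

theorem lipschitzWith_truncNL {p M : ℝ} (hp : 2 ≤ p) (hM : 0 ≤ M) :
    LipschitzWith (Real.toNNReal (p * M ^ (p - 1))) (truncNL p M) :=
  LipschitzWith.of_dist_le_mul fun z z' => by
    rw [dist_eq_norm, dist_eq_norm, Real.coe_toNNReal _ (by positivity)]
    exact norm_truncNL_sub_le hp hM z z'

theorem memLp_truncNL {p M : ℝ} (hp : 2 ≤ p) (hM : 0 ≤ M) (f : L2 d) :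
    MemLp (fun x => truncNL p M (f x)) 2 volume :=
  (lipschitzWith_truncNL hp hM).comp_memLp (truncNL_zero p M) (Lp.memLp f)

open Classical in
/-- The truncated power nonlinearity on `L²`. -/
def nl (p M : ℝ) (f : L2 d) : L2 d :=
  -- The value 0 is never taken when p ≥ 2 and M ≥ 0, by `memLp_truncNL`.
  if h : MemLp (fun x => truncNL p M (f x)) 2 volume then h.toLp _ else 0

theorem coeFn_nl {p M : ℝ} (hp : 2 ≤ p) (hM : 0 ≤ M) (f : L2 d) :
    nl p M f =ᵐ[volume] fun x => truncNL p M (f x) := by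
  rw [nl, dif_pos (memLp_truncNL hp hM f)]
  exact MemLp.coeFn_toLp _

theorem coeFn_nl_of_le {p M : ℝ} (hp : 2 ≤ p) (hM : 0 ≤ M) {f : L2 d} (hf : ∀ᵐ x, ‖f x‖ ≤ M) :
    nl p M f =ᵐ[volume] fun x => powNL p (f x) := by
  filter_upwards [coeFn_nl hp hM f, hf] with x h1 h2
  rw [h1, truncNL_of_le h2]

theorem norm_nl_sub_le {p M : ℝ} (hp : 2 ≤ p) (hM : 0 ≤ M) (f g : L2 d) :
    ‖nl p M f - nl p M g‖ ≤ p * M ^ (p - 1) * ‖f - g‖ := by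
  refine Lp.norm_le_mul_norm_of_ae_le_mul ?_
  filter_upwards [coeFn_nl hp hM f, coeFn_nl hp hM g, Lp.coeFn_sub f g,
    Lp.coeFn_sub (nl p M f) (nl p M g)] with x h1 h2 h3 h4
  rw [h4, h3, Pi.sub_apply, Pi.sub_apply, h1, h2]
  exact norm_truncNL_sub_le hp hM _ _

theorem nl_zero {p M : ℝ} (hp : 2 ≤ p) (hM : 0 ≤ M) : nl p M (0 : L2 d) = 0 := by
  apply Lp.ext
  filter_upwards [coeFn_nl hp hM (0 : L2 d), Lp.coeFn_zero ℂ 2 (volume : Measure (Space d))]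
    with x h1 h2
  rw [h1, h2, Pi.zero_apply, truncNL_zero]

theorem norm_nl_le {p M : ℝ} (hp : 2 ≤ p) (hM : 0 ≤ M) (f : L2 d) :
    ‖nl p M f‖ ≤ p * M ^ (p - 1) * ‖f‖ := by
  have := norm_nl_sub_le hp hM f 0
  rwa [nl_zero hp hM, sub_zero, sub_zero] at this

theorem continuous_nl {p M : ℝ} (hp : 2 ≤ p) (hM : 0 ≤ M) :
    Continuous (nl p M : L2 d → L2 d) := by
  refine (LipschitzWith.of_dist_le_mul (K := Real.toNNReal (p * M ^ (p - 1)))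
    fun f g => ?_).continuous
  rw [dist_eq_norm, dist_eq_norm, Real.coe_toNNReal _ (by positivity)]
  exact norm_nl_sub_le hp hM f g

/-! ### The power nonlinearity in H². -/

/-- A measurable real function has `L²` norm at most `B`. -/
structure L2Le (G : Space d → ℝ) (B : ℝ) : Prop where
  meas : AEStronglyMeasurable G volume
  nonneg : 0 ≤ B
  le : eLpNorm G 2 volume ≤ ENNReal.ofReal B

theorem L2Le.add {G G' : Space d → ℝ} {B B' : ℝ} (h : L2Le G B) (h' : L2Le G' B') :
    L2Le (fun x => G x + G' x) (B + B') :=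
  ⟨h.meas.add h'.meas, add_nonneg h.nonneg h'.nonneg,
    (eLpNorm_add_le h.meas h'.meas (by norm_num)).trans
      ((add_le_add h.le h'.le).trans_eq (ENNReal.ofReal_add h.nonneg h'.nonneg).symm)⟩

theorem L2Le.const_mul {G : Space d → ℝ} {B : ℝ} (h : L2Le G B) {c : ℝ} (hc : 0 ≤ c) :
    L2Le (fun x => c * G x) (c * B) := by
  refine ⟨h.meas.const_mul c, mul_nonneg hc h.nonneg, ?_⟩
  refine (eLpNorm_const_smul_le (c := c) (f := G) (μ := volume)).trans ?_
  rw [Real.enorm_eq_ofReal hc, ENNReal.ofReal_mul hc]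
  gcongr
  exact h.le

theorem L2Le.of_norm {f : L2 d} {B : ℝ} (h : ‖f‖ ≤ B) : L2Le (fun x => ‖f x‖) B := by
  refine ⟨(Lp.aestronglyMeasurable f).norm, (norm_nonneg _).trans h, ?_⟩
  rw [eLpNorm_norm, ← Lp.enorm_def, ← ofReal_norm]
  exact ENNReal.ofReal_le_ofReal h

theorem L2Le.norm_le {G : Space d → ℝ} {B : ℝ} (h : L2Le G B) {f : L2 d}
    (hf : ∀ᵐ x, ‖f x‖ ≤ G x) : ‖f‖ ≤ B := by
  have h1 : ‖f‖ₑ ≤ ENNReal.ofReal B := by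
    rw [Lp.enorm_def]
    exact (eLpNorm_mono_ae_real hf).trans h.le
  rw [← ofReal_norm] at h1
  exact (ENNReal.ofReal_le_ofReal_iff h.nonneg).1 h1

theorem L2Le.diff_sq {f : L2 d} {M : ℝ} (hM0 : 0 ≤ M) (hM : ∀ᵐ x, ‖f x‖ ≤ M) (h : Space d) {s : ℝ}
    (hs : ‖secondDiff h f‖ ≤ s) : L2Le (fun x => ‖f (x + h) - f x‖ ^ 2) (6 * M * s) := by
  have hs0 : 0 ≤ s := (norm_nonneg _).trans hs
  refine ⟨?_, by positivity, (eLpNorm_diff_sq_le hM0 hM h).trans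
    (ENNReal.ofReal_le_ofReal (by gcongr))⟩
  exact (((Lp.aestronglyMeasurable f).comp_measurePreserving (measurePreserving_add h)).sub
    (Lp.aestronglyMeasurable f)).norm.pow 2

open Classical in
theorem L2Le.diff_sq_small {f : L2 d} {M η : ℝ} (hM0 : 0 ≤ M) (hη : 0 ≤ η)
    (hM : ∀ᵐ x, ‖f x‖ ≤ M) (h : Space d) {s : ℝ} (hs : ‖secondDiff h f‖ ≤ s) :
    L2Le (fun x => if ‖f x‖ ≤ η ∧ ‖f (x + h)‖ ≤ η then ‖f (x + h) - f x‖ ^ 2 else 0)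
      (6 * √(η * M) * s) := by
  have hs0 : 0 ≤ s := (norm_nonneg _).trans hs
  have e : (fun x => if ‖f x‖ ≤ η ∧ ‖f (x + h)‖ ≤ η then ‖f (x + h) - f x‖ ^ 2 else 0) =
      {x | ‖f x‖ ≤ η ∧ ‖f (x + h)‖ ≤ η}.indicator fun x => ‖f (x + h) - f x‖ ^ 2 := by
    ext x; simp [Set.indicator_apply]
  rw [e]
  refine ⟨?_, by positivity, (eLpNorm_diff_sq_small_le hM0 hη hM h).trans
    (ENNReal.ofReal_le_ofReal (by gcongr))⟩
  exact (((((Lp.aestronglyMeasurable f).comp_measurePreserving (measurePreserving_add h)).sub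
    (Lp.aestronglyMeasurable f)).norm.pow 2)).indicator₀ (nullMeasurableSet_small f η h)

/-- A discrete chain rule: the derivative acts on the second difference, and the remaining two terms
are Taylor remainders, quadratic in the first differences b - a and c - a. -/
theorem powNL_secondDiff_eq (p : ℝ) (a b c : ℂ) : powNL p b + powNL p c - 2 * powNL p a =
    powNLDeriv p a (b + c - 2 * a) + (powNL p b - powNL p a - powNLDeriv p a (b - a)) +
      (powNL p c - powNL p a - powNLDeriv p a (c - a)) := by
  rw [show b + c - 2 * a = (b - a) + (c - a) by ring, map_add]
  ring

theorem norm_powNLDeriv_le_of_le {p M : ℝ} (hp : 2 ≤ p) {a : ℂ} (ha : ‖a‖ ≤ M) :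
    ‖powNLDeriv p a‖ ≤ p * M ^ (p - 1) :=
  (norm_powNLDeriv_le hp a).trans (by
    have := Real.rpow_le_rpow (norm_nonneg a) ha (by linarith : 0 ≤ p - 1)
    gcongr)

theorem secondDiff_apply_neg (h : Space d) (f : L2 d) : secondDiff (-h) f = secondDiff h f := by
  rw [secondDiff_neg]

/-- The second differences of `|u|^{p-1} u` are controlled by those of `u`. -/
theorem norm_secondDiff_nl_le {p M : ℝ} (hp : 2 ≤ p) (hM : 0 ≤ M) {u : L2 d}
    (hu : ∀ᵐ x, ‖u x‖ ≤ M) (h : Space d) : ‖secondDiff h (nl p M u)‖ ≤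
      (p * M ^ (p - 1) + 12 * (5 * p ^ 2 * M ^ (p - 2)) * M) * ‖secondDiff h u‖ := by
  set L := 5 * p ^ 2 * M ^ (p - 2) with hL
  have hL0 : 0 ≤ L := by positivity
  -- Each Taylor remainder costs 6LM by the discrete Gagliardo–Nirenberg inequality; the steps h and
  -- -h together give 12LM.
  have hG : L2Le (fun x => p * M ^ (p - 1) * ‖secondDiff h u x‖ +
      L * ‖u (x + h) - u x‖ ^ 2 + L * ‖u (x + -h) - u x‖ ^ 2)
      (p * M ^ (p - 1) * ‖secondDiff h u‖ + L * (6 * M * ‖secondDiff h u‖) +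
        L * (6 * M * ‖secondDiff h u‖)) :=
    (((L2Le.of_norm le_rfl).const_mul (by positivity)).add
      ((L2Le.diff_sq hM hu h le_rfl).const_mul hL0)).add
      ((L2Le.diff_sq hM hu (-h) (by rw [secondDiff_neg])).const_mul hL0)
  refine (hG.norm_le ?_).trans_eq (by ring)
  have hn := coeFn_nl_of_le hp hM hu
  filter_upwards [coeFn_secondDiff h (nl p M u), coeFn_secondDiff h u, hn, ae_comp_add h hn,
    ae_comp_sub h hn, hu, ae_comp_add h hu, ae_comp_sub h hu] with x h1 h2 h3 h4 h5 h6 h7 h8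
  rw [h1, h2, h3, h4, h5, powNL_secondDiff_eq, ← sub_eq_add_neg]
  refine (norm_add₃_le ..).trans ?_
  gcongr
  · exact (ContinuousLinearMap.le_opNorm _ _).trans
      (mul_le_mul_of_nonneg_right (norm_powNLDeriv_le_of_le hp h6) (norm_nonneg _))
  · exact powNL_taylor_le hp h6 h7
  · exact powNL_taylor_le hp h6 h8

/-- The power nonlinearity maps `H²` to itself. -/
theorem eH2Norm_nl_le {p M : ℝ} (hp : 2 ≤ p) (hM : 0 ≤ M) : ∃ C : ℝ, 0 ≤ C ∧ ∀ (u : L2 d) (r : ℝ),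
    0 ≤ r → (∀ᵐ x, ‖u x‖ ≤ M) → eH2Norm u ≤ ENNReal.ofReal r →
      eH2Norm (nl p M u) ≤ ENNReal.ofReal (C * r) := by
  set C₀ := p * M ^ (p - 1) + 12 * (5 * p ^ 2 * M ^ (p - 2)) * M with hC₀
  have hC : 0 ≤ C₀ := by positivity
  refine ⟨(1 + d) * C₀, by positivity, fun u r hr hu hur => ?_⟩
  rw [mul_assoc]
  refine eH2Norm_le_of_secondDiff (by positivity) ?_ fun j => ?_
  · refine (norm_nl_le hp hM u).trans ?_
    have h1 := norm_le_of_eH2Norm_le hr hur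
    have h2 : p * M ^ (p - 1) ≤ C₀ := by
      have : 0 ≤ 12 * (5 * p ^ 2 * M ^ (p - 2)) * M := by positivity
      linarith
    gcongr
  · filter_upwards [self_mem_nhdsWithin] with s hs
    refine (norm_secondDiff_nl_le hp hM hu _).trans ?_
    have h1 := norm_secondDiff_le hr hur (s • EuclideanSpace.single j (1 : ℝ))
    rw [norm_smul, PiLp.norm_single, norm_one, mul_one, Real.norm_eq_abs, sq_abs] at h1
    calc C₀ * _ ≤ C₀ * (s ^ 2 * r) := mul_le_mul_of_nonneg_left h1 hC
      _ = C₀ * r * s ^ 2 := by ring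

/-- Translations are strongly continuous in H², because they commute with `lift`, and the Sobolev
embedding turns this into uniform closeness. -/
theorem eventually_ae_norm_diff_le (hd : d ≤ 3) {f : L2 d} (hf : eH2Norm f < ∞) {η : ℝ}
    (hη : 0 < η) : ∀ᶠ h in 𝓝 (0 : Space d), ∀ᵐ x, ‖f (x + h) - f x‖ ≤ η := by
  obtain ⟨C, hC, hb⟩ := ae_norm_le (d := d) hd one_pos
  have h1 : Tendsto (fun h => mult (transSymbol h) (lift f)) (𝓝 (0 : Space d))
      (𝓝 (mult (1 : Space d →ᵇ ℂ) (lift f))) := by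
    refine tendsto_mult _ _ 1 (fun h ξ => (norm_transSymbol h ξ).le) (fun ξ => ?_) _
    have : Continuous fun h : Space d => transSymbol h ξ := by
      simp_rw [transSymbol_apply]; fun_prop
    have h2 := this.tendsto 0
    simpa [transSymbol_apply] using h2
  have h2 := tendsto_iff_norm_sub_tendsto_zero.1 h1
  have h3 : 0 < η / (1 + C) := by positivity
  filter_upwards [h2.eventually (gt_mem_nhds h3)] with h hh
  have e : mult (transSymbol h) f - f = mult (transSymbol h - 1) f := by
    rw [mult_sub, mult_one]
  have h4 : eH2Norm (mult (transSymbol h) f - f) ≤ ENNReal.ofReal (η / (1 + C)) := by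
    rw [e, eH2Norm_mult hf, ← ofReal_norm]
    apply ENNReal.ofReal_le_ofReal
    rw [mult_sub]
    exact hh.le
  have h5 := norm_le_of_eH2Norm_le h3.le h4
  filter_upwards [hb _ _ h3.le h4, Lp.coeFn_sub (mult (transSymbol h) f) f,
    coeFn_mult_transSymbol h f] with x h6 h7 h8
  rw [h7, Pi.sub_apply, h8] at h6
  calc _ ≤ _ := h6
    _ ≤ 1 * (η / (1 + C)) + C * (η / (1 + C)) := by gcongr
    _ = η := by field_simp

open Classical in
/-- Pointwise comparison of second order Taylor remainders. -/
theorem powNL_taylor_sub_le {p M : ℝ} (hp : 2 ≤ p) {η κ δ σ : ℝ} (hη : 0 < η) (hκ : 0 < κ)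
    (hσ : 0 < σ)
    (hrem : ∀ a a' e : ℂ, 3 * η ≤ ‖a'‖ → ‖a'‖ ≤ M → ‖e‖ ≤ η → ‖a - a'‖ ≤ δ →
      ‖(powNL p (a + e) - powNL p a - powNLDeriv p a e) -
        (powNL p (a' + e) - powNL p a' - powNLDeriv p a' e)‖ ≤ κ * ‖e‖ ^ 2)
    {a b a' b' : ℂ} (ha : ‖a‖ ≤ M) (hb : ‖b‖ ≤ M) (ha' : ‖a'‖ ≤ M) (hb' : ‖b'‖ ≤ M)
    (haa : ‖a - a'‖ ≤ δ) (hba : ‖b' - a'‖ ≤ η) :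
    ‖(powNL p b - powNL p a - powNLDeriv p a (b - a)) -
      (powNL p b' - powNL p a' - powNLDeriv p a' (b' - a'))‖ ≤
      5 * p ^ 2 * (3 * M) ^ (p - 2) * (1 + σ⁻¹) * ‖(b - b') - (a - a')‖ ^ 2 +
        (5 * p ^ 2 * (3 * M) ^ (p - 2) * σ + κ) * ‖b' - a'‖ ^ 2 +
        2 * (5 * p ^ 2 * (3 * M) ^ (p - 2)) *
          (if ‖a'‖ ≤ 4 * η ∧ ‖b'‖ ≤ 4 * η then ‖b' - a'‖ ^ 2 else 0) := by
  have hM : 0 ≤ M := (norm_nonneg a).trans ha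
  set L := 5 * p ^ 2 * (3 * M) ^ (p - 2) with hL
  have hL0 : 0 ≤ L := by positivity
  set e := b' - a' with he
  set w := (b - b') - (a - a') with hw
  have hbe : b = a + e + w := by simp only [he, hw]; ring
  have hb'e : b' = a' + e := by simp only [he]; ring
  -- The intermediate point a + (b' - a') may leave the ball of radius M; hence the radius 3M in the
  -- constant.
  have hae : ‖a + e‖ ≤ 3 * M := by
    refine (norm_add_le _ _).trans ?_
    have : ‖e‖ ≤ ‖b'‖ + ‖a'‖ := norm_sub_le _ _
    linarith
  have ha3 : ‖a‖ ≤ 3 * M := by linarith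
  have hb3 : ‖b‖ ≤ 3 * M := by linarith
  have ha3' : ‖a'‖ ≤ 3 * M := by linarith
  have hb3' : ‖b'‖ ≤ 3 * M := by linarith
  -- First the increment b - a is replaced by e = b' - a' at the same base point. The cross term ‖e‖
  -- ‖w‖ is split by Young's inequality with parameter σ.
  have h1 : ‖(powNL p b - powNL p a - powNLDeriv p a (b - a)) -
      (powNL p (a + e) - powNL p a - powNLDeriv p a e)‖ ≤
      L * (1 + σ⁻¹) * ‖w‖ ^ 2 + L * σ * ‖e‖ ^ 2 := by
    have e1 : (powNL p b - powNL p a - powNLDeriv p a (b - a)) -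
        (powNL p (a + e) - powNL p a - powNLDeriv p a e) =
        (powNL p b - powNL p (a + e) - powNLDeriv p (a + e) (b - (a + e))) +
          (powNLDeriv p (a + e) - powNLDeriv p a) w := by
      have e2 : b - (a + e) = w := by rw [hbe]; ring
      have e3 : b - a = e + w := by rw [hbe]; ring
      rw [e2, e3, map_add, sub_apply]; ring
    have h2 := powNL_taylor_le hp hae hb3
    have h3 : ‖(powNLDeriv p (a + e) - powNLDeriv p a) w‖ ≤ L * ‖e‖ * ‖w‖ := by
      refine (ContinuousLinearMap.le_opNorm _ _).trans ?_
      have := powNLDeriv_lipschitz hp hae ha3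
      rw [add_sub_cancel_left] at this
      gcongr
    have e2 : b - (a + e) = w := by rw [hbe]; ring
    rw [e2] at h2
    rw [e1, e2]
    refine (norm_add_le _ _).trans ((add_le_add h2 h3).trans ?_)
    have h4 : ‖e‖ * ‖w‖ ≤ σ * ‖e‖ ^ 2 + σ⁻¹ * ‖w‖ ^ 2 := by
      have h5 : 0 ≤ (σ * ‖e‖ - ‖w‖) ^ 2 * σ⁻¹ := by positivity
      have h6 : (σ * ‖e‖ - ‖w‖) ^ 2 * σ⁻¹ = σ * ‖e‖ ^ 2 + σ⁻¹ * ‖w‖ ^ 2 - 2 * (‖e‖ * ‖w‖) := by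
        field_simp; ring
      have : 0 ≤ ‖e‖ * ‖w‖ := by positivity
      linarith
    have h5 := mul_le_mul_of_nonneg_left h4 hL0
    linarith
  -- Then the base point changes from a to a'. Away from zero the second derivative is uniformly
  -- continuous; otherwise a' and b' both have modulus at most 4η, and the localised inequality will
  -- make the crude bound small.
  have h2 : ‖(powNL p (a + e) - powNL p a - powNLDeriv p a e) -
      (powNL p b' - powNL p a' - powNLDeriv p a' e)‖ ≤ κ * ‖e‖ ^ 2 +
        2 * L * (if ‖a'‖ ≤ 4 * η ∧ ‖b'‖ ≤ 4 * η then ‖e‖ ^ 2 else 0) := by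
    by_cases h3 : 3 * η ≤ ‖a'‖
    · rw [hb'e]
      refine (hrem a a' e h3 ha' hba haa).trans (le_add_of_nonneg_right ?_)
      split_ifs <;> positivity
    · have h4 : ‖a'‖ ≤ 4 * η ∧ ‖b'‖ ≤ 4 * η := by
        refine ⟨by linarith, ?_⟩
        rw [hb'e]
        exact (norm_add_le _ _).trans (by linarith)
      rw [if_pos h4]
      have h5 := powNL_taylor_le hp ha3 hae
      have h6 := powNL_taylor_le hp ha3' hb3'
      rw [add_sub_cancel_left] at h5
      refine (norm_sub_le _ _).trans ((add_le_add h5 h6).trans ?_)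
      have : 0 ≤ κ * ‖e‖ ^ 2 := by positivity
      linarith
  have h3 := norm_sub_le_norm_sub_add_norm_sub (powNL p b - powNL p a - powNLDeriv p a (b - a))
    (powNL p (a + e) - powNL p a - powNLDeriv p a e)
    (powNL p b' - powNL p a' - powNLDeriv p a' e)
  linarith

theorem exists_pos_mul_le {X κ : ℝ} (hX : 0 ≤ X) (hκ : 0 < κ) : ∃ t > 0, X * t ≤ κ :=
  ⟨κ / (1 + X), by positivity, by
    rw [mul_div_assoc', div_le_iff₀ (by positivity)]; nlinarith⟩

/-- Continuity of the power nonlinearity in `H²`, with a Lipschitz bound up to an error that is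
small if the functions are uniformly close. -/
theorem eH2Norm_nl_sub_le (hd : d ≤ 3) {p M : ℝ} (hp : 2 ≤ p) (hM : 0 ≤ M) :
    ∃ C : ℝ, 0 ≤ C ∧ ∀ Q : ℝ, 0 ≤ Q → ∀ κ > 0, ∃ δ > 0, ∀ (v k : L2 d) (r : ℝ), 0 ≤ r →
      (∀ᵐ x, ‖v x‖ ≤ M) → (∀ᵐ x, ‖k x‖ ≤ M) → eH2Norm k ≤ ENNReal.ofReal Q →
      (∀ᵐ x, ‖v x - k x‖ ≤ δ) → eH2Norm (v - k) ≤ ENNReal.ofReal r →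
        eH2Norm (nl p M v - nl p M k) ≤ ENNReal.ofReal (C * r + κ) := by
  classical
  set L := 5 * p ^ 2 * (3 * M) ^ (p - 2) with hL
  have hL0 : 0 ≤ L := by positivity
  set P := p * M ^ (p - 1) with hP
  have hP0 : 0 ≤ P := by positivity
  refine ⟨(1 + d) * (P + 12 * L), by positivity, fun Q hQ κ₀ hκ₀ => ?_⟩
  obtain ⟨κ, hκ, hκκ⟩ : ∃ κ > 0, (1 + d : ℝ) * κ ≤ κ₀ := exists_pos_mul_le (by positivity) hκ₀
  have hκ4 : 0 < κ / 4 := by positivity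
  -- The error κ is shared equally by four sources: Young's inequality (σ), the Taylor remainder
  -- away from zero (κ'), the region near zero (t) and the change of base point in the derivative
  -- (δ₂). Since the localised inequality gains only √η, the radius is η = t².
  obtain ⟨σ, hσ, hσ'⟩ := exists_pos_mul_le (X := 12 * L * M * Q) (by positivity) hκ4
  obtain ⟨κ', hκ', hκ''⟩ := exists_pos_mul_le (X := 12 * M * Q) (by positivity) hκ4
  obtain ⟨t, ht, ht'⟩ := exists_pos_mul_le (X := 48 * L * √M * Q) (by positivity) hκ4
  set η := t ^ 2 with hη
  have hη0 : 0 < η := by positivity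
  have hsq : √(4 * η * M) = 2 * t * √M := by
    rw [Real.sqrt_mul (by positivity), show 4 * η = (2 * t) ^ 2 by rw [hη]; ring,
      Real.sqrt_sq (by positivity)]
  obtain ⟨δ₁, hδ₁, hrem⟩ := powNL_remainder_sub_le hp hη0 M hκ'
  obtain ⟨δ₂, hδ₂, hδ₂'⟩ := exists_pos_mul_le (X := L * Q) (by positivity) hκ4
  -- The Gagliardo–Nirenberg bound for v - k carries its sup norm δ as a factor, which compensates
  -- the large 1 + σ⁻¹. Hence C depends on neither κ nor Q.
  obtain ⟨δ₃, hδ₃, hδ₃'⟩ := exists_pos_mul_le (X := 1 + σ⁻¹) (by positivity) one_pos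
  set δ := min δ₁ (min δ₂ δ₃) with hδ
  have hδ0 : 0 < δ := lt_min hδ₁ (lt_min hδ₂ hδ₃)
  have hδa : δ ≤ δ₁ := min_le_left _ _
  have hδb : δ ≤ δ₂ := (min_le_right _ _).trans (min_le_left _ _)
  have hδc : δ ≤ δ₃ := (min_le_right _ _).trans (min_le_right _ _)
  refine ⟨δ, hδ0, fun v k r hr hv hk hkQ hvk hvkr => ?_⟩
  have key : eH2Norm (nl p M v - nl p M k) ≤
      ENNReal.ofReal ((1 + d) * ((P + 12 * L) * r + κ)) := by
    refine eH2Norm_le_of_secondDiff (by positivity) ?_ fun j => ?_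
    · refine (norm_nl_sub_le hp hM v k).trans ?_
      have h1 := norm_le_of_eH2Norm_le hr hvkr
      calc P * ‖v - k‖ ≤ P * r := by gcongr
        _ ≤ _ := by nlinarith [mul_nonneg hL0 hr]
    · have hlim1 : Tendsto (fun s : ℝ => s • EuclideanSpace.single j (1 : ℝ)) (𝓝[>] 0)
          (𝓝 (0 : Space d)) := by
        have : Continuous fun s : ℝ => s • EuclideanSpace.single j (1 : ℝ) := by fun_prop
        have h1 := this.tendsto 0
        rw [zero_smul] at h1
        exact h1.mono_left nhdsWithin_le_nhds
      have hlim2 := hlim1.neg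
      rw [neg_zero] at hlim2
      have hkfin : eH2Norm k < ∞ := hkQ.trans_lt ENNReal.ofReal_lt_top
      filter_upwards [self_mem_nhdsWithin,
        hlim1.eventually (eventually_ae_norm_diff_le hd hkfin hη0),
        hlim2.eventually (eventually_ae_norm_diff_le hd hkfin hη0)] with s hs hu1 hu2
      set h : Space d := s • EuclideanSpace.single j (1 : ℝ) with hh
      have hnorm : ‖h‖ ^ 2 = s ^ 2 := by
        rw [hh, norm_smul, PiLp.norm_single, norm_one, mul_one, Real.norm_eq_abs, sq_abs]
      have hk2 := norm_secondDiff_le hQ hkQ h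
      have hw2 := norm_secondDiff_le hr hvkr h
      rw [hnorm] at hk2 hw2
      have hk2' : ‖secondDiff (-h) k‖ ≤ s ^ 2 * Q := by rwa [secondDiff_apply_neg]
      have hw2' : ‖secondDiff (-h) (v - k)‖ ≤ s ^ 2 * r := by rwa [secondDiff_apply_neg]
      have hvk' : ∀ᵐ x, ‖(v - k : L2 d) x‖ ≤ δ := by
        filter_upwards [hvk, Lp.coeFn_sub v k] with x h1 h2
        rw [h2]; exact h1
      -- The L² bound for the difference of one pair of Taylor remainders, used with g = h and g =
      -- -h.
      have part : ∀ g : Space d, ‖secondDiff g k‖ ≤ s ^ 2 * Q → ‖secondDiff g (v - k)‖ ≤ s ^ 2 * r →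
          L2Le (fun x => L * (1 + σ⁻¹) * ‖(v - k : L2 d) (x + g) - (v - k : L2 d) x‖ ^ 2 +
            (L * σ + κ') * ‖k (x + g) - k x‖ ^ 2 + 2 * L * (if ‖k x‖ ≤ 4 * η ∧ ‖k (x + g)‖ ≤ 4 * η
              then ‖k (x + g) - k x‖ ^ 2 else 0))
            (L * (1 + σ⁻¹) * (6 * δ * (s ^ 2 * r)) + (L * σ + κ') * (6 * M * (s ^ 2 * Q)) +
              2 * L * (6 * √(4 * η * M) * (s ^ 2 * Q))) := fun g hg1 hg2 =>
        (((L2Le.diff_sq hδ0.le hvk' g hg2).const_mul (by positivity)).add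
          ((L2Le.diff_sq hM hk g hg1).const_mul (by positivity))).add
          ((L2Le.diff_sq_small hM (by positivity) hk g hg1).const_mul (by positivity))
      have hG := ((((L2Le.of_norm hw2).const_mul hP0).add
        ((L2Le.of_norm hk2).const_mul (by positivity : 0 ≤ L * δ))).add
        (part h hk2 hw2)).add (part (-h) hk2' hw2')
      refine (hG.norm_le ?_).trans ?_
      · have hn := coeFn_nl_of_le hp hM hv
        have hm := coeFn_nl_of_le hp hM hk
        have hs := Lp.coeFn_sub v k
        have hnm := Lp.coeFn_sub (nl p M v) (nl p M k)
        filter_upwards [coeFn_secondDiff h (nl p M v - nl p M k), coeFn_secondDiff h (v - k),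
          coeFn_secondDiff h k, hn, ae_comp_add h hn, ae_comp_sub h hn, hm, ae_comp_add h hm,
          ae_comp_sub h hm, hs, ae_comp_add h hs, ae_comp_sub h hs, hnm, ae_comp_add h hnm,
          ae_comp_sub h hnm, hv, ae_comp_add h hv, ae_comp_sub h hv, hk, ae_comp_add h hk,
          ae_comp_sub h hk, hvk, hu1, hu2] with x y1 y2 y3 n1 n2 n3 m1 m2 m3 s1 s2 s3 q1 q2 q3
            v1 v2 v3 k1 k2 k3 e1 e2 e3
        rw [← sub_eq_add_neg] at e3
        rw [y1, y2, y3, ← sub_eq_add_neg]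
        simp only [s1, s2, s3, q1, q2, q3, Pi.sub_apply, n1, n2, n3, m1, m2, m3]
        have t1 := powNL_taylor_sub_le hp hη0 hκ' hσ hrem v1 v2 k1 k2 (e1.trans hδa) e2
        have t2 := powNL_taylor_sub_le hp hη0 hκ' hσ hrem v1 v3 k1 k3 (e1.trans hδa) e3
        have d1 : ‖powNLDeriv p (v x) (v (x + h) - k (x + h) + (v (x - h) - k (x - h)) -
            2 * (v x - k x))‖ ≤ P * ‖v (x + h) - k (x + h) + (v (x - h) - k (x - h)) -
            2 * (v x - k x)‖ :=
          (ContinuousLinearMap.le_opNorm _ _).trans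
            (mul_le_mul_of_nonneg_right (norm_powNLDeriv_le_of_le hp v1) (norm_nonneg _))
        have d2 : ‖(powNLDeriv p (v x) - powNLDeriv p (k x)) (k (x + h) + k (x - h) - 2 * k x)‖ ≤
            L * δ * ‖k (x + h) + k (x - h) - 2 * k x‖ := by
          refine (ContinuousLinearMap.le_opNorm _ _).trans
            (mul_le_mul_of_nonneg_right ?_ (norm_nonneg _))
          refine (powNLDeriv_lipschitz hp (M := 3 * M) (by linarith) (by linarith)).trans ?_
          gcongr
        have e0 : powNL p (v (x + h)) - powNL p (k (x + h)) +
            (powNL p (v (x - h)) - powNL p (k (x - h))) - 2 * (powNL p (v x) - powNL p (k x)) =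
            powNLDeriv p (v x) (v (x + h) - k (x + h) + (v (x - h) - k (x - h)) -
              2 * (v x - k x)) +
            (powNLDeriv p (v x) - powNLDeriv p (k x)) (k (x + h) + k (x - h) - 2 * k x) +
            ((powNL p (v (x + h)) - powNL p (v x) - powNLDeriv p (v x) (v (x + h) - v x)) -
              (powNL p (k (x + h)) - powNL p (k x) - powNLDeriv p (k x) (k (x + h) - k x))) +
            ((powNL p (v (x - h)) - powNL p (v x) - powNLDeriv p (v x) (v (x - h) - v x)) -
              (powNL p (k (x - h)) - powNL p (k x) - powNLDeriv p (k x) (k (x - h) - k x))) := by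
          have r1 : v (x + h) - k (x + h) + (v (x - h) - k (x - h)) - 2 * (v x - k x) =
            (v (x + h) - v x) + (v (x - h) - v x) - (k (x + h) + k (x - h) - 2 * k x) := by ring
          have r2 : k (x + h) + k (x - h) - 2 * k x = (k (x + h) - k x) + (k (x - h) - k x) := by
            ring
          rw [r1, map_sub, map_add, sub_apply, r2, map_add, map_add]
          ring
        rw [e0]
        refine (norm_add_le _ _).trans (add_le_add ((norm_add_le _ _).trans (add_le_add
          ((norm_add_le _ _).trans (add_le_add d1 d2)) t1)) t2)
      · rw [hsq]
        have hs2 : 0 ≤ s ^ 2 := sq_nonneg s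
        have z1 : (1 + σ⁻¹) * δ ≤ 1 :=
          (mul_le_mul_of_nonneg_left hδc (by positivity)).trans hδ₃'
        have z2 : L * Q * δ ≤ κ / 4 := (mul_le_mul_of_nonneg_left hδb (by positivity)).trans hδ₂'
        have z3 : L * r * ((1 + σ⁻¹) * δ) ≤ L * r * 1 :=
          mul_le_mul_of_nonneg_left z1 (by positivity)
        have z4 : P * r + L * Q * δ + 12 * (L * r * ((1 + σ⁻¹) * δ)) + 12 * L * M * Q * σ +
            12 * M * Q * κ' + 48 * L * √M * Q * t ≤ (P + 12 * L) * r + κ := by linarith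
        calc _ = (P * r + L * Q * δ + 12 * (L * r * ((1 + σ⁻¹) * δ)) + 12 * L * M * Q * σ +
            12 * M * Q * κ' + 48 * L * √M * Q * t) * s ^ 2 := by ring
          _ ≤ _ := mul_le_mul_of_nonneg_right z4 hs2
  refine key.trans (ENNReal.ofReal_le_ofReal ?_)
  rw [mul_add, mul_assoc]
  gcongr

/-! ### The dispersion map and its phase. -/

/-- `G` is the primitive of the coefficient `g` which vanishes at `t₀`. -/
structure IsPhase (g : ℝ → ℝ) (t₀ : ℝ) (G : ℝ → ℝ) : Prop where
  continuous : Continuous G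
  zero : G t₀ = 0
  countable : {t | ¬ ContinuousAt g t}.Countable
  hasDerivAt : ∀ t, ContinuousAt g t → HasDerivAt G (g t) t

/-- With zero coefficient the group disappears from the Duhamel formula, so the limiting ordinary
differential equation falls under the same solution theory. -/
theorem isPhase_zero (t₀ : ℝ) : IsPhase (fun _ => 0) t₀ fun _ => 0 where
  continuous := continuous_const
  zero := rfl
  countable := by
    convert Set.countable_empty
    ext t
    simpa using (continuousAt_const : ContinuousAt (fun _ : ℝ => (0 : ℝ)) t)
  hasDerivAt t _ := hasDerivAt_const t 0

theorem dispersionMap_add_one (γp γm tp t : ℝ) :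
    dispersionMap γp γm tp (t + 1) = dispersionMap γp γm tp t := by
  rw [dispersionMap, dispersionMap, toIocMod_add_right]

theorem abs_dispersionMap_le {γp γm : ℝ} (hγp : 0 < γp) (hγm : 0 < γm) (tp t : ℝ) :
    |dispersionMap γp γm tp t| ≤ γp + γm := by
  rw [dispersionMap]
  split_ifs
  · rw [abs_of_pos hγp]; linarith
  · rw [abs_neg, abs_of_pos hγm]; linarith

theorem continuousAt_dispersionMap (γp γm tp : ℝ) {n : ℤ} {t : ℝ} (h1 : (n : ℝ) < t)
    (h2 : t < n + 1) (h3 : t ≠ n + tp) : ContinuousAt (dispersionMap γp γm tp) t := by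
  have key : ∀ s : ℝ, (n : ℝ) < s → s < n + 1 → toIocMod (one_pos : (0 : ℝ) < 1) 0 s = s - n := by
    intro s hs hs'
    rw [toIocMod_eq_iff]
    exact ⟨⟨by linarith, by linarith⟩, n, by simp⟩
  have hev : ∀ᶠ s in 𝓝 t, dispersionMap γp γm tp s = dispersionMap γp γm tp t := by
    rcases lt_or_gt_of_ne h3 with h | h
    · filter_upwards [Ioo_mem_nhds h1 h2, Iio_mem_nhds h] with s hs hs'
      have : s < n + tp := hs'
      rw [dispersionMap, dispersionMap, key s hs.1 hs.2, key t h1 h2, if_pos (by linarith),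
        if_pos (by linarith)]
    · filter_upwards [Ioo_mem_nhds h1 h2, Ioi_mem_nhds h] with s hs hs'
      have : n + tp < s := hs'
      rw [dispersionMap, dispersionMap, key s hs.1 hs.2, key t h1 h2, if_neg (by linarith),
        if_neg (by linarith)]
  exact (continuousAt_const (y := dispersionMap γp γm tp t)).congr
    (hev.mono fun s hs => hs.symm)

theorem countable_not_continuousAt_dispersionMap (γp γm tp : ℝ) :
    {t | ¬ ContinuousAt (dispersionMap γp γm tp) t}.Countable := by
  refine ((Set.countable_range (fun n : ℤ => (n : ℝ))).union
    (Set.countable_range (fun n : ℤ => (n : ℝ) + tp))).mono fun t ht => ?_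
  by_contra hn
  rw [Set.mem_union, not_or] at hn
  refine ht (continuousAt_dispersionMap γp γm tp (n := ⌊t⌋)
    (lt_of_le_of_ne (Int.floor_le t) fun h => hn.1 ⟨_, h⟩) (Int.lt_floor_add_one t)
    fun h => hn.2 ⟨⌊t⌋, h.symm⟩)

theorem measurable_dispersionMap (γp γm tp : ℝ) : Measurable (dispersionMap γp γm tp) := by
  have h : Measurable fun t : ℝ => toIocMod (one_pos : (0 : ℝ) < 1) 0 t := by
    have e : (fun t : ℝ => toIocMod (one_pos : (0 : ℝ) < 1) 0 t) = fun t => t - ((⌈t⌉ : ℝ) - 1) := by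
      ext t
      rw [toIocMod_eq_iff]
      refine ⟨⟨by linarith [Int.ceil_lt_add_one t], by linarith [Int.le_ceil t]⟩, ⌈t⌉ - 1, by simp⟩
    rw [e]
    exact measurable_id.sub ((measurable_from_top.comp Int.measurable_ceil).sub_const 1)
  exact Measurable.ite (measurableSet_le h measurable_const) measurable_const measurable_const

theorem intervalIntegrable_dispersionMap_div {γp γm : ℝ} (hγp : 0 < γp) (hγm : 0 < γm)
    (tp ε a b : ℝ) :
    IntervalIntegrable (fun t => dispersionMap γp γm tp (t / ε)) volume a b := by
  refine (intervalIntegrable_const (c := γp + γm)).mono_fun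
    ((measurable_dispersionMap γp γm tp).comp (measurable_id.div_const ε)).aestronglyMeasurable ?_
  refine Eventually.of_forall fun t => ?_
  have := abs_dispersionMap_le hγp hγm tp (t / ε)
  change |_| ≤ |_|
  exact this.trans (le_abs_self _)

/-- Vanishing mean makes the primitive 1-periodic, so it suffices to integrate over less than one
period. -/
theorem abs_integral_dispersionMap_le {γp γm tp : ℝ} (hγp : 0 < γp) (hγm : 0 < γm)
    (hγ : average (dispersionMap γp γm tp) = 0) (x : ℝ) :
    |∫ s in (0 : ℝ)..x, dispersionMap γp γm tp s| ≤ γp + γm := by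
  set γ := dispersionMap γp γm tp with hdef
  have hint : ∀ a b, IntervalIntegrable γ volume a b := fun a b => by
    simpa using intervalIntegrable_dispersionMap_div hγp hγm tp 1 a b
  have hper : Function.Periodic γ 1 := dispersionMap_add_one γp γm tp
  have h1 : Function.Periodic (fun x => ∫ s in (0 : ℝ)..x, γ s) 1 := by
    intro x
    have : ∫ s in x..(x + 1), γ s = 0 := by
      rw [hper.intervalIntegral_add_eq x 0, zero_add]; exact hγ
    change ∫ s in (0 : ℝ)..(x + 1), γ s = ∫ s in (0 : ℝ)..x, γ s
    rw [← intervalIntegral.integral_add_adjacent_intervals (hint 0 x) (hint x _), this, add_zero]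
  have h2 := h1.sub_int_mul_eq (x := x) ⌊x⌋
  rw [mul_one] at h2
  change ∫ s in (0 : ℝ)..(x - ⌊x⌋), γ s = ∫ s in (0 : ℝ)..x, γ s at h2
  rw [← h2]
  have h3 := intervalIntegral.norm_integral_le_of_norm_le_const (a := (0 : ℝ)) (b := x - ⌊x⌋)
    (f := γ) (C := γp + γm) fun s _ => abs_dispersionMap_le hγp hγm tp s
  refine h3.trans ?_
  have h4 : |x - ⌊x⌋ - 0| ≤ 1 := by
    rw [sub_zero, abs_of_nonneg (sub_nonneg.2 (Int.floor_le x))]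
    linarith [Int.lt_floor_add_one x]
  have : 0 < γp + γm := by linarith
  nlinarith

/-- The substitution s ↦ s/ε extracts a factor ε from the bounded primitive. The factor 2 accounts
for the two endpoints t/ε and t₀/ε. -/
theorem exists_isPhase_dispersionMap {γp γm tp : ℝ} (hγp : 0 < γp) (hγm : 0 < γm)
    (hγ : average (dispersionMap γp γm tp) = 0) (t₀ : ℝ) {ε : ℝ} (hε : 0 < ε) :
    ∃ G, IsPhase (fun t => dispersionMap γp γm tp (t / ε)) t₀ G ∧
      ∀ t, |G t| ≤ 2 * (γp + γm) * ε := by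
  set γ := dispersionMap γp γm tp with hdef
  have hint := intervalIntegrable_dispersionMap_div hγp hγm tp ε
  refine ⟨fun t => ∫ s in t₀..t, γ (s / ε),
    ⟨intervalIntegral.continuous_primitive hint t₀, intervalIntegral.integral_same, ?_, ?_⟩, ?_⟩
  · have hinj : Function.Injective fun t : ℝ => t / ε := fun a b h => by
      simpa [hε.ne'] using h
    refine ((countable_not_continuousAt_dispersionMap γp γm tp).preimage hinj).mono ?_
    intro t ht hc
    refine ht (ContinuousAt.comp (g := γ) (f := fun t : ℝ => t / ε) hc ?_)
    fun_prop
  · intro t ht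
    refine intervalIntegral.integral_hasDerivAt_right (hint t₀ t) ?_ ht
    exact ((measurable_dispersionMap γp γm tp).comp
      (measurable_id.div_const ε)).stronglyMeasurable.stronglyMeasurableAtFilter
  · intro t
    have hi : ∀ a b, IntervalIntegrable γ volume a b := fun a b => by
      simpa using intervalIntegrable_dispersionMap_div hγp hγm tp 1 a b
    have e : ∫ s in t₀..t, γ (s / ε) =
        ε * ((∫ s in (0 : ℝ)..(t / ε), γ s) - ∫ s in (0 : ℝ)..(t₀ / ε), γ s) := by
      rw [intervalIntegral.integral_comp_div _ hε.ne',
        intervalIntegral.integral_interval_sub_left (hi _ _) (hi _ _), smul_eq_mul]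
    change |∫ s in t₀..t, γ (s / ε)| ≤ _
    rw [e, abs_mul, abs_of_pos hε]
    have h1 := abs_integral_dispersionMap_le hγp hγm hγ (t / ε)
    have h2 := abs_integral_dispersionMap_le hγp hγm hγ (t₀ / ε)
    have h3 := abs_sub (∫ s in (0 : ℝ)..(t / ε), γ s) (∫ s in (0 : ℝ)..(t₀ / ε), γ s)
    rw [mul_comm ε]
    refine mul_le_mul_of_nonneg_right ?_ hε.le
    linarith

/-! ### Exponential weights and Gronwall's inequality. -/

/-- The integral of an exponential weight. -/
theorem abs_integral_exp_abs_le {Λ : ℝ} (hΛ : 0 < Λ) (t₀ t : ℝ) :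
    |∫ s in t₀..t, Real.exp (Λ * |s - t₀|)| ≤ Λ⁻¹ * Real.exp (Λ * |t - t₀|) := by
  rcases le_total t₀ t with h | h
  · have e : ∫ s in t₀..t, Real.exp (Λ * |s - t₀|) =
        Λ⁻¹ * Real.exp (Λ * |t - t₀|) - Λ⁻¹ := by
      rw [intervalIntegral.integral_congr (g := fun s => Real.exp (Λ * s - Λ * t₀)),
        intervalIntegral.integral_comp_mul_sub (fun x => Real.exp x) hΛ.ne', integral_exp,
        abs_of_nonneg (sub_nonneg.2 h)]
      · simp [mul_sub]
      · intro s hs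
        rw [Set.uIcc_of_le h] at hs
        simp only
        rw [abs_of_nonneg (sub_nonneg.2 hs.1), mul_sub]
    rw [e, abs_of_nonneg]
    · linarith [inv_pos.2 hΛ]
    · have : 1 ≤ Real.exp (Λ * |t - t₀|) := Real.one_le_exp (by positivity)
      have := inv_pos.2 hΛ
      nlinarith
  · have e : ∫ s in t₀..t, Real.exp (Λ * |s - t₀|) =
        -(Λ⁻¹ * Real.exp (Λ * |t - t₀|) - Λ⁻¹) := by
      rw [intervalIntegral.integral_congr (g := fun s => Real.exp (Λ * t₀ - Λ * s)),
        intervalIntegral.integral_comp_sub_mul (fun x => Real.exp x) hΛ.ne', integral_exp,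
        abs_of_nonpos (sub_nonpos.2 h)]
      · simp [mul_sub]
      · intro s hs
        rw [Set.uIcc_of_ge h] at hs
        simp only
        rw [abs_of_nonpos (sub_nonpos.2 hs.2)]; ring_nf
    rw [e, abs_neg, abs_of_nonneg]
    · linarith [inv_pos.2 hΛ]
    · have : 1 ≤ Real.exp (Λ * |t - t₀|) := Real.one_le_exp (by positivity)
      have := inv_pos.2 hΛ
      nlinarith

/-- Integration against the weight gains a factor 1/Λ, so that Λ large makes the integral term small
on time intervals of any length. -/
theorem norm_integral_le_of_exp {E : Type*} [NormedAddCommGroup E] [NormedSpace ℝ E] {Λ : ℝ}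
    (hΛ : 0 < Λ) {t₀ t b c : ℝ} (hb : 0 ≤ b) (hc : 0 ≤ c) {f : ℝ → E}
    (hf : ∀ s ∈ Set.uIoc t₀ t, ‖f s‖ ≤ b * Real.exp (Λ * |s - t₀|) + c) :
    ‖∫ s in t₀..t, f s‖ ≤ b / Λ * Real.exp (Λ * |t - t₀|) + c * |t - t₀| := by
  have h1 : ‖∫ s in t₀..t, f s‖ ≤ |∫ s in t₀..t, (b * Real.exp (Λ * |s - t₀|) + c)| :=
    intervalIntegral.norm_integral_le_abs_of_norm_le
      ((ae_restrict_iff' measurableSet_uIoc).2 (Eventually.of_forall hf))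
      (Continuous.intervalIntegrable (by fun_prop) _ _)
  refine h1.trans ?_
  rw [intervalIntegral.integral_add (Continuous.intervalIntegrable (by fun_prop) _ _)
    (by simp), intervalIntegral.integral_const_mul, intervalIntegral.integral_const, smul_eq_mul]
  refine (abs_add_le _ _).trans ?_
  rw [abs_mul, abs_of_nonneg hb, abs_mul, mul_comm _ |c|, div_eq_mul_inv, mul_assoc,
    abs_of_nonneg hc]
  gcongr
  exact abs_integral_exp_abs_le hΛ t₀ t

/-- A Gronwall inequality on both sides of the initial time. -/
theorem gronwall_two_sided {y : ℝ → ℝ} {t₀ T A K : ℝ} (hK : 0 ≤ K)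
    (hy : ContinuousOn y (Set.uIcc t₀ T)) (hy0 : ∀ s ∈ Set.uIcc t₀ T, 0 ≤ y s)
    (h : ∀ s ∈ Set.uIcc t₀ T, y s ≤ A + K * |∫ r in t₀..s, y r|) :
    y T ≤ 2 * A * Real.exp ((2 * K + 1) * |T - t₀|) := by
  -- This choice gives K/Λ ≤ 1/2, so at the maximum of the weighted function the integral term is
  -- absorbed into the left-hand side.
  set Λ := 2 * K + 1 with hΛ
  have hΛ0 : 0 < Λ := by positivity
  obtain ⟨s, hs, hmax⟩ := isCompact_uIcc.exists_isMaxOn Set.nonempty_uIcc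
    (f := fun s => Real.exp (-(Λ * |s - t₀|)) * y s)
    (ContinuousOn.mul (Continuous.continuousOn (by fun_prop)) hy)
  set m := Real.exp (-(Λ * |s - t₀|)) * y s with hm
  have hm0 : 0 ≤ m := mul_nonneg (Real.exp_pos _).le (hy0 s hs)
  have hle : ∀ r ∈ Set.uIcc t₀ T, y r ≤ m * Real.exp (Λ * |r - t₀|) := by
    intro r hr
    have h1 : Real.exp (-(Λ * |r - t₀|)) * y r ≤ m := hmax hr
    rw [Real.exp_neg, inv_mul_le_iff₀ (Real.exp_pos _)] at h1
    linarith
  have hsub : Set.uIoc t₀ s ⊆ Set.uIcc t₀ T :=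
    Set.uIoc_subset_uIcc.trans (Set.uIcc_subset_uIcc_left hs)
  have h2 := norm_integral_le_of_exp hΛ0 (t₀ := t₀) (t := s) (c := 0) hm0 le_rfl (f := y) fun r hr => by
    rw [Real.norm_of_nonneg (hy0 r (hsub hr)), add_zero]; exact hle r (hsub hr)
  rw [zero_mul, add_zero, Real.norm_eq_abs] at h2
  have h3 : y s ≤ A + K * (m / Λ * Real.exp (Λ * |s - t₀|)) :=
    (h s hs).trans (by gcongr)
  have hE : 1 ≤ Real.exp (Λ * |s - t₀|) := Real.one_le_exp (by positivity)
  have h4 : y s = m * Real.exp (Λ * |s - t₀|) := by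
    rw [hm, Real.exp_neg]; field_simp
  have h5 : K * (m / Λ) ≤ m / 2 := by
    rw [← mul_div_assoc, div_le_div_iff₀ hΛ0 two_pos, hΛ]; nlinarith
  have h6 : m ≤ 2 * A := by nlinarith
  refine (hle T Set.right_mem_uIcc).trans ?_
  gcongr

/-! ### Continuity in `H²` -/

theorem tendsto_eH2Norm_sub_iff {ι : Type*} {l : Filter ι} {f : ι → L2 d} {f₀ : L2 d}
    (hf : ∀ᶠ i in l, eH2Norm (f i) < ∞) (hf₀ : eH2Norm f₀ < ∞) :
    Tendsto (fun i => eH2Norm (f i - f₀)) l (𝓝 0) ↔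
      Tendsto (fun i => lift (f i)) l (𝓝 (lift f₀)) := by
  rw [tendsto_iff_edist_tendsto_0]
  refine tendsto_congr' (hf.mono fun i hi => ?_)
  change eH2Norm (f i - f₀) = edist (lift (f i)) (lift f₀)
  rw [edist_eq_enorm_sub, ← lift_sub hi hf₀]
  exact eH2Norm_eq_lift ((eH2Norm_sub_le _ _).trans_lt (ENNReal.add_lt_top.2 ⟨hi, hf₀⟩))

theorem continuousOn_lift_iff {J : Set ℝ} {f : ℝ → L2 d} (hf : ∀ t ∈ J, eH2Norm (f t) < ∞) :
    ContinuousOn (fun t => lift (f t)) J ↔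
      ∀ t ∈ J, Tendsto (fun s => eH2Norm (f s - f t)) (𝓝[J] t) (𝓝 0) :=
  forall₂_congr fun t ht => (tendsto_eH2Norm_sub_iff
    (eventually_mem_nhdsWithin.mono fun s hs => hf s hs) (hf t ht)).symm

theorem tendsto_of_tendsto_eH2Norm {ι : Type*} {l : Filter ι} {f : ι → L2 d} {f₀ : L2 d}
    (h : Tendsto (fun i => eH2Norm (f i - f₀)) l (𝓝 0)) : Tendsto f l (𝓝 f₀) := by
  rw [tendsto_iff_edist_tendsto_0]
  refine tendsto_of_tendsto_of_tendsto_of_le_of_le tendsto_const_nhds h (fun _ => zero_le)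
    fun i => ?_
  rw [edist_eq_enorm_sub]
  exact enorm_le_eH2Norm _

theorem eH2Norm_le_ofReal_of_norm_lift_le {f : L2 d} (hf : eH2Norm f < ∞) {B : ℝ}
    (h : ‖lift f‖ ≤ B) : eH2Norm f ≤ ENNReal.ofReal B := by
  rw [eH2Norm_eq_lift hf, ← ofReal_norm]
  exact ENNReal.ofReal_le_ofReal h

/-! ### The Duhamel formula -/

theorem continuousOn_duhamelIntegrand {p M : ℝ} (hp : 2 ≤ p) (hM : 0 ≤ M) {G : ℝ → ℝ}
    (hG : Continuous G) {v : ℝ → L2 d} {S : Set ℝ} (hv : ContinuousOn v S) :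
    ContinuousOn (fun s => U (-G s) (nl p M (v s))) S := by
  have h1 : ContinuousOn (fun s => nl p M (v s)) S := (continuous_nl hp hM).comp_continuousOn hv
  intro t ht
  exact tendsto_U_apply (hG.neg.continuousWithinAt.tendsto) (h1 t ht)

/-- The Duhamel formula in the interaction picture. -/
def interaction (p M t₀ : ℝ) (φ : L2 d) (G : ℝ → ℝ) (v : ℝ → L2 d) (t : ℝ) : L2 d :=
  φ + Complex.I • ∫ s in t₀..t, U (-G s) (nl p M (v s))

/-- The right-hand side of the Duhamel formula. -/
def duhamel (p M t₀ : ℝ) (φ : L2 d) (G : ℝ → ℝ) (v : ℝ → L2 d) (t : ℝ) : L2 d :=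
  U (G t) (interaction p M t₀ φ G v t)

theorem intervalIntegrable_duhamelIntegrand {p M : ℝ} (hp : 2 ≤ p) (hM : 0 ≤ M) {G : ℝ → ℝ}
    (hG : Continuous G) {v : ℝ → L2 d} {a b : ℝ} (hv : ContinuousOn v (Set.uIcc a b)) :
    IntervalIntegrable (fun s => U (-G s) (nl p M (v s))) volume a b :=
  (continuousOn_duhamelIntegrand hp hM hG hv).intervalIntegrable

/-- For u in H² every term comes from L², which embeds injectively into the tempered distributions;
the equation can then be solved for the time derivative. -/
theorem equation_iff {g : ℝ} {u u' N : L2 d} (hu : eH2Norm u < ∞) :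
    Complex.I • (u' : 𝓢'(Space d, ℂ)) + (g : ℂ) • Δ (u : 𝓢'(Space d, ℂ))
        + (N : 𝓢'(Space d, ℂ)) = 0 ↔ u' = Complex.I • ((g : ℂ) • lap u + N) := by
  rw [laplacian_toTempered hu]
  have e : Complex.I • (u' : 𝓢'(Space d, ℂ)) + (g : ℂ) • ((lap u : L2 d) : 𝓢'(Space d, ℂ))
        + (N : 𝓢'(Space d, ℂ)) =
      ((Complex.I • u' + (g : ℂ) • lap u + N : L2 d) : 𝓢'(Space d, ℂ)) := by
    change Complex.I • (Lp.toTemperedDistributionCLM ℂ (volume : Measure (Space d)) 2) u' +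
      (g : ℂ) • (Lp.toTemperedDistributionCLM ℂ (volume : Measure (Space d)) 2) (lap u) +
      (Lp.toTemperedDistributionCLM ℂ (volume : Measure (Space d)) 2) N =
      (Lp.toTemperedDistributionCLM ℂ (volume : Measure (Space d)) 2) _
    rw [map_add, map_add, map_smul, map_smul]
  have e0 : (0 : 𝓢'(Space d, ℂ)) = ((0 : L2 d) : 𝓢'(Space d, ℂ)) :=
    (map_zero (Lp.toTemperedDistributionCLM ℂ (volume : Measure (Space d)) 2)).symm
  rw [e, e0]
  constructor
  · intro h
    have h2 := toTempered_injective h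
    have h3 : Complex.I • u' = -((g : ℂ) • lap u + N) := by
      rw [add_assoc] at h2; exact eq_neg_of_add_eq_zero_left h2
    have h4 := congrArg (fun f => (-Complex.I) • f) h3
    simp only [smul_smul, neg_mul, Complex.I_mul_I, neg_neg, one_smul, smul_neg, neg_smul] at h4
    exact h4
  · intro h
    congr 1
    rw [h, smul_smul, Complex.I_mul_I, neg_one_smul, add_assoc, neg_add_cancel]

theorem ae_eq_nl {p M : ℝ} (hp : 2 ≤ p) (hM : 0 ≤ M) {u : L2 d} (hb : ∀ᵐ x, ‖u x‖ ≤ M) :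
    ∀ᵐ x, nl p M u x = ((‖u x‖ ^ (p - 1) : ℝ) : ℂ) * u x :=
  coeFn_nl_of_le hp hM hb

namespace IsSolution

variable {p t₀ : ℝ} {g : ℝ → ℝ} {φ : L2 d} {J : Set ℝ} {u : ℝ → L2 d}

theorem eH2Norm_lt_top (h : IsSolution p g t₀ φ J u) {t : ℝ} (ht : t ∈ J) :
    eH2Norm (u t) < ∞ := (memH2_iff _).1 (h.memH2 t ht)

theorem continuousOn (h : IsSolution p g t₀ φ J u) : ContinuousOn u J :=
  fun t ht => tendsto_of_tendsto_eH2Norm (h.continuous t ht)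

theorem continuousOn_lift (h : IsSolution p g t₀ φ J u) :
    ContinuousOn (fun t => lift (u t)) J :=
  (continuousOn_lift_iff fun _ ht => h.eH2Norm_lt_top ht).2 h.continuous

theorem uIcc_subset (h : IsSolution p g t₀ φ J u) {t : ℝ} (ht : t ∈ J) : Set.uIcc t₀ t ⊆ J :=
  h.ordConnected.uIcc_subset h.mem ht

theorem hasDerivWithinAt (hp : 2 ≤ p) (h : IsSolution p g t₀ φ J u) {t : ℝ} (ht : t ∈ J)
    (hg : ContinuousAt g t) {M : ℝ} (hM : 0 ≤ M) (hb : ∀ᵐ x, ‖u t x‖ ≤ M) :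
    HasDerivWithinAt u (Complex.I • ((g t : ℂ) • lap (u t) + nl p M (u t))) J t := by
  obtain ⟨u', N, hu', hN, heq⟩ := h.equation t ht hg
  have e : N = nl p M (u t) := by
    refine Lp.ext ?_
    filter_upwards [hN, ae_eq_nl hp hM hb] with x h1 h2
    rw [h1, h2]
  rwa [(equation_iff (h.eH2Norm_lt_top ht)).1 heq, e] at hu'

/-- Sobolev embedding: a solution is bounded on compact time intervals. -/
theorem exists_ae_bound (hd : d ≤ 3) (h : IsSolution p g t₀ φ J u) {t : ℝ} (ht : t ∈ J) :
    ∃ M : ℝ, 0 ≤ M ∧ ∀ s ∈ Set.uIcc t₀ t, ∀ᵐ x, ‖u s x‖ ≤ M := by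
  obtain ⟨C, hC, hemb⟩ := ae_norm_le (d := d) hd one_pos
  obtain ⟨B, hB⟩ := isCompact_uIcc.exists_bound_of_continuousOn
    (h.continuousOn_lift.mono (h.uIcc_subset ht))
  have hB0 : 0 ≤ B := (norm_nonneg _).trans (hB t₀ Set.left_mem_uIcc)
  refine ⟨1 * B + C * B, by positivity, fun s hs => ?_⟩
  have h1 := eH2Norm_le_ofReal_of_norm_lift_le (h.eH2Norm_lt_top (h.uIcc_subset ht hs)) (hB s hs)
  have h2 := norm_le_of_eH2Norm_le hB0 h1
  filter_upwards [hemb _ B hB0 h1] with x hx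
  exact hx.trans (by gcongr)

/-- Solutions satisfy the Duhamel formula. -/
theorem eq_duhamel (hp : 2 ≤ p) (h : IsSolution p g t₀ φ J u) {G : ℝ → ℝ} (hG : IsPhase g t₀ G)
    {M : ℝ} (hM : 0 ≤ M) {t : ℝ} (ht : t ∈ J) (hb : ∀ s ∈ Set.uIcc t₀ t, ∀ᵐ x, ‖u s x‖ ≤ M) :
    u t = duhamel p M t₀ φ G u t := by
  have hsub := h.uIcc_subset ht
  have hcont := h.continuousOn.mono hsub
  -- In the interaction picture the Laplacian terms cancel and only the nonlinearity remains. At the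
  -- countably many jumps of the coefficient, continuity is all that this form of the fundamental
  -- theorem asks for.
  have hd := integral_eq_of_hasDerivAt_off_countable (fun s => U (-G s) (u s))
    (fun s => Complex.I • U (-G s) (nl p M (u s))) (a := t₀) (b := t) hG.countable
    (fun s hs => tendsto_U_apply hG.continuous.neg.continuousWithinAt.tendsto (hcont s hs))
    (fun s hs => by
      have hs1 : s ∈ Set.uIcc t₀ t := Set.Ioo_subset_Icc_self hs.1
      have hgs : ContinuousAt g s := not_not.1 hs.2
      have h1 := h.hasDerivWithinAt hp (hsub hs1) hgs hM (hb s hs1)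
      have h2 := hasDerivWithinAt_U_comp (hG.hasDerivAt s hgs).neg h1
        (h.eH2Norm_lt_top (hsub hs1))
      have h3 : J ∈ 𝓝 s := mem_of_superset (Icc_mem_nhds hs.1.1 hs.1.2) hsub
      refine HasDerivAt.congr_deriv (h2.hasDerivAt h3) (Eq.symm ?_)
      change _ = U (-G s) _
      rw [← map_smul]
      congr 1
      rw [smul_add, add_right_comm, smul_comm Complex.I, Complex.ofReal_neg, neg_smul,
        add_neg_cancel, zero_add])
    ((intervalIntegrable_duhamelIntegrand hp hM hG.continuous hcont).smul Complex.I)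
  rw [intervalIntegral.integral_smul] at hd
  rw [duhamel, interaction, hd, hG.zero, neg_zero, U_zero, h.initial, add_sub_cancel, U_U_neg]

end IsSolution

/-! ### Uniqueness and gluing of solutions. -/

theorem norm_duhamel_sub_le {p M : ℝ} (hp : 2 ≤ p) (hM : 0 ≤ M) {t₀ : ℝ} (φ : L2 d) {G : ℝ → ℝ}
    (hG : Continuous G) {v w : ℝ → L2 d} {t : ℝ} (hv : ContinuousOn v (Set.uIcc t₀ t))
    (hw : ContinuousOn w (Set.uIcc t₀ t)) :
    ‖duhamel p M t₀ φ G v t - duhamel p M t₀ φ G w t‖ ≤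
      p * M ^ (p - 1) * |∫ s in t₀..t, ‖v s - w s‖| := by
  rw [duhamel, duhamel, ← map_sub, norm_U, interaction, interaction, add_sub_add_left_eq_sub,
    ← smul_sub, ← intervalIntegral.integral_sub (intervalIntegrable_duhamelIntegrand hp hM hG hv)
      (intervalIntegrable_duhamelIntegrand hp hM hG hw), norm_smul, Complex.norm_I, one_mul]
  have hi : IntervalIntegrable (fun s => p * M ^ (p - 1) * ‖v s - w s‖) volume t₀ t :=
    (continuousOn_const.mul (hv.sub hw).norm).intervalIntegrable
  refine (intervalIntegral.norm_integral_le_abs_of_norm_le (Eventually.of_forall fun s => ?_)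
    hi).trans_eq ?_
  · rw [← map_sub, norm_U]
    exact norm_nl_sub_le hp hM _ _
  · rw [intervalIntegral.integral_const_mul, abs_mul, abs_of_nonneg (by positivity)]

theorem eq_of_eq_duhamel {p M : ℝ} (hp : 2 ≤ p) (hM : 0 ≤ M) {t₀ : ℝ} {φ : L2 d} {G : ℝ → ℝ}
    (hG : Continuous G) {v w : ℝ → L2 d} {t : ℝ} (hv : ContinuousOn v (Set.uIcc t₀ t))
    (hw : ContinuousOn w (Set.uIcc t₀ t))
    (hv' : ∀ s ∈ Set.uIcc t₀ t, v s = duhamel p M t₀ φ G v s)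
    (hw' : ∀ s ∈ Set.uIcc t₀ t, w s = duhamel p M t₀ φ G w s) : v t = w t := by
  have h := gronwall_two_sided (y := fun s => ‖v s - w s‖) (A := 0) (K := p * M ^ (p - 1))
    (t₀ := t₀) (T := t) (by positivity) (hv.sub hw).norm (fun s _ => norm_nonneg _)
    fun s hs => by
      rw [zero_add]
      have hsub : Set.uIcc t₀ s ⊆ Set.uIcc t₀ t := Set.uIcc_subset_uIcc_left hs
      have := norm_duhamel_sub_le hp hM φ hG (hv.mono hsub) (hw.mono hsub)
      rwa [← hv' s hs, ← hw' s hs] at this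
  rw [mul_zero, zero_mul] at h
  exact sub_eq_zero.1 (norm_le_zero_iff.1 h)

/-- Two solutions agree on the intersection of their intervals of existence. -/
theorem IsSolution.eqOn_inter (hd : d ≤ 3) {p t₀ : ℝ} (hp : 2 ≤ p) {g : ℝ → ℝ} {φ : L2 d}
    {G : ℝ → ℝ} (hG : IsPhase g t₀ G) {I J : Set ℝ} {u v : ℝ → L2 d}
    (hu : IsSolution p g t₀ φ J u) (hv : IsSolution p g t₀ φ I v) : Set.EqOn u v (J ∩ I) := by
  rintro t ⟨htJ, htI⟩
  obtain ⟨M₁, hM₁, hb₁⟩ := hu.exists_ae_bound hd htJ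
  obtain ⟨M₂, hM₂, hb₂⟩ := hv.exists_ae_bound hd htI
  -- Both solutions must satisfy the Duhamel formula with the same truncation level.
  have hM : 0 ≤ max M₁ M₂ := hM₁.trans (le_max_left _ _)
  refine eq_of_eq_duhamel (φ := φ) hp hM hG.continuous (hu.continuousOn.mono (hu.uIcc_subset htJ))
    (hv.continuousOn.mono (hv.uIcc_subset htI)) (fun s hs => ?_) fun s hs => ?_
  · exact hu.eq_duhamel hp hG hM (hu.uIcc_subset htJ hs) fun r hr =>
      (hb₁ r (Set.uIcc_subset_uIcc_left hs hr)).mono fun x hx => hx.trans (le_max_left _ _)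
  · exact hv.eq_duhamel hp hG hM (hv.uIcc_subset htI hs) fun r hr =>
      (hb₂ r (Set.uIcc_subset_uIcc_left hs hr)).mono fun x hx => hx.trans (le_max_right _ _)

/-- Both intervals contain t₀. Since t lies outside B, the points of B on the same side of t₀ as t
lie between t₀ and t, hence in A; so near t the union adds nothing to A. -/
theorem nhdsWithin_union_eq_left {A B : Set ℝ} {t₀ t : ℝ} (hB : B.OrdConnected)
    (h0A : t₀ ∈ A) (hA : A.OrdConnected) (h0B : t₀ ∈ B) (htA : t ∈ A) (htB : t ∉ B) :
    𝓝[A ∪ B] t = 𝓝[A] t := by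
  have hne : t ≠ t₀ := fun h => htB (h ▸ h0B)
  rcases lt_or_gt_of_ne hne with h | h
  · refine nhdsWithin_eq_nhdsWithin (s := Set.Iio t₀) h isOpen_Iio ?_
    ext s
    refine ⟨fun hs => ⟨hs.1.elim id fun hB' => ?_, hs.2⟩, fun hs => ⟨Or.inl hs.1, hs.2⟩⟩
    have : t ≤ s := by
      by_contra! hlt
      exact htB (hB.out hB' h0B ⟨hlt.le, h.le⟩)
    exact hA.out htA h0A ⟨this, le_of_lt hs.2⟩
  · refine nhdsWithin_eq_nhdsWithin (s := Set.Ioi t₀) h isOpen_Ioi ?_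
    ext s
    refine ⟨fun hs => ⟨hs.1.elim id fun hB' => ?_, hs.2⟩, fun hs => ⟨Or.inl hs.1, hs.2⟩⟩
    have : s ≤ t := by
      by_contra! hlt
      exact htB (hB.out h0B hB' ⟨h.le, hlt.le⟩)
    exact hA.out h0A htA ⟨le_of_lt hs.2, this⟩

theorem ordConnected_union_of_mem {A B : Set ℝ} {t₀ : ℝ} (hA : A.OrdConnected)
    (hB : B.OrdConnected) (h0A : t₀ ∈ A) (h0B : t₀ ∈ B) : (A ∪ B).OrdConnected :=
  (IsPreconnected.union t₀ h0A h0B hA.isPreconnected hB.isPreconnected).ordConnected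

/-- Two solutions which agree on the intersection of their intervals of existence can be glued. -/
theorem IsSolution.union (hd : d ≤ 3) {p t₀ : ℝ} (hp : 2 ≤ p) {g : ℝ → ℝ} {φ : L2 d}
    {I J : Set ℝ} {u v w : ℝ → L2 d} (hu : IsSolution p g t₀ φ J u) (hv : IsSolution p g t₀ φ I v)
    (hwu : Set.EqOn w u J) (hwv : Set.EqOn w v I) : IsSolution p g t₀ φ (J ∪ I) w := by
  have hfin : ∀ t ∈ J ∪ I, eH2Norm (w t) < ∞ := by
    rintro t (ht | ht)
    · rw [hwu ht]; exact hu.eH2Norm_lt_top ht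
    · rw [hwv ht]; exact hv.eH2Norm_lt_top ht
  have hcJ : ∀ t ∈ J, Tendsto (fun s => eH2Norm (w s - w t)) (𝓝[J] t) (𝓝 0) := fun t ht =>
    (hu.continuous t ht).congr' (eventually_mem_nhdsWithin.mono fun s hs => by
      simp only [hwu hs, hwu ht])
  have hcI : ∀ t ∈ I, Tendsto (fun s => eH2Norm (w s - w t)) (𝓝[I] t) (𝓝 0) := fun t ht =>
    (hv.continuous t ht).congr' (eventually_mem_nhdsWithin.mono fun s hs => by
      simp only [hwv hs, hwv ht])
  have hdJ : ∀ t ∈ J, ContinuousAt g t → ∀ M, 0 ≤ M → (∀ᵐ x, ‖w t x‖ ≤ M) →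
      HasDerivWithinAt w (Complex.I • ((g t : ℂ) • lap (w t) + nl p M (w t))) J t := by
    intro t ht hg M hM hb
    rw [hwu ht] at hb ⊢
    exact (hu.hasDerivWithinAt hp ht hg hM hb).congr hwu (hwu ht)
  have hdI : ∀ t ∈ I, ContinuousAt g t → ∀ M, 0 ≤ M → (∀ᵐ x, ‖w t x‖ ≤ M) →
      HasDerivWithinAt w (Complex.I • ((g t : ℂ) • lap (w t) + nl p M (w t))) I t := by
    intro t ht hg M hM hb
    rw [hwv ht] at hb ⊢
    exact (hv.hasDerivWithinAt hp ht hg hM hb).congr hwv (hwv ht)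
  have hnI : ∀ t ∈ J, t ∉ I → 𝓝[J ∪ I] t = 𝓝[J] t := fun t ht ht' =>
    nhdsWithin_union_eq_left hv.ordConnected hu.mem hu.ordConnected hv.mem ht ht'
  have hnJ : ∀ t ∈ I, t ∉ J → 𝓝[J ∪ I] t = 𝓝[I] t := fun t ht ht' => by
    rw [Set.union_comm]
    exact nhdsWithin_union_eq_left hu.ordConnected hv.mem hv.ordConnected hu.mem ht ht'
  refine ⟨ordConnected_union_of_mem hu.ordConnected hv.ordConnected hu.mem hv.mem, Or.inl hu.mem,
    (hwu hu.mem).trans hu.initial, fun t ht => (memH2_iff _).2 (hfin t ht), fun t ht => ?_,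
    fun t ht hg => ?_⟩
  · by_cases h1 : t ∈ J <;> by_cases h2 : t ∈ I
    · rw [nhdsWithin_union]
      exact (hcJ t h1).sup (hcI t h2)
    · rw [hnI t h1 h2]; exact hcJ t h1
    · rw [hnJ t h2 h1]; exact hcI t h2
    · exact absurd ht (by simp [h1, h2])
  · have hb : ∃ M : ℝ, 0 ≤ M ∧ ∀ᵐ x, ‖w t x‖ ≤ M := by
      rcases ht with ht | ht
      · obtain ⟨M, hM, hb⟩ := hu.exists_ae_bound hd ht
        exact ⟨M, hM, by rw [hwu ht]; exact hb t Set.right_mem_uIcc⟩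
      · obtain ⟨M, hM, hb⟩ := hv.exists_ae_bound hd ht
        exact ⟨M, hM, by rw [hwv ht]; exact hb t Set.right_mem_uIcc⟩
    obtain ⟨M, hM, hb⟩ := hb
    refine ⟨_, nl p M (w t), ?_, ae_eq_nl hp hM hb, (equation_iff (hfin t ht)).2 rfl⟩
    by_cases h1 : t ∈ J <;> by_cases h2 : t ∈ I
    · exact (hdJ t h1 hg M hM hb).union (hdI t h2 hg M hM hb)
    · have := hdJ t h1 hg M hM hb
      rw [HasDerivWithinAt, HasDerivAtFilter] at this ⊢
      rwa [hnI t h1 h2]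
    · have := hdI t h2 hg M hM hb
      rw [HasDerivWithinAt, HasDerivAtFilter] at this ⊢
      rwa [hnJ t h2 h1]
    · exact absurd ht (by simp [h1, h2])

/-! ### From the Duhamel formula back to the equation. -/

/-- The integral is taken in L²; the bounded operators `mult (wtrunc n)` pass under it, so no
measurability or integrability in H² is required. -/
theorem eH2Norm_integral_le {f : ℝ → L2 d} {a b B : ℝ} (hB : 0 ≤ B)
    (hf : IntervalIntegrable f volume a b)
    (h : ∀ s ∈ Set.uIoc a b, eH2Norm (f s) ≤ ENNReal.ofReal B) :
    eH2Norm (∫ s in a..b, f s) ≤ ENNReal.ofReal (B * |b - a|) := by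
  rw [eH2Norm_le_ofReal_iff _ (by positivity)]
  intro n
  rw [← ContinuousLinearMap.intervalIntegral_comp_comm _ hf]
  exact intervalIntegral.norm_integral_le_of_norm_le_const fun s hs =>
    (eH2Norm_le_ofReal_iff _ hB).1 (h s hs) n

theorem eH2Norm_I_smul (f : L2 d) : eH2Norm (Complex.I • f) = eH2Norm f := by
  rw [eH2Norm_smul, ← ofReal_norm, Complex.norm_I, ENNReal.ofReal_one, one_mul]

theorem continuous_duhamelIntegrand {p M : ℝ} (hp : 2 ≤ p) (hM : 0 ≤ M) {G : ℝ → ℝ}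
    (hG : Continuous G) {v : ℝ → L2 d} (hv : Continuous v) :
    Continuous fun s => U (-G s) (nl p M (v s)) :=
  continuousOn_univ.1 (continuousOn_duhamelIntegrand hp hM hG hv.continuousOn)

theorem hasDerivAt_interaction {p M : ℝ} (hp : 2 ≤ p) (hM : 0 ≤ M) (t₀ : ℝ) (φ : L2 d) {G : ℝ → ℝ}
    (hG : Continuous G) {v : ℝ → L2 d} (hv : Continuous v) (t : ℝ) :
    HasDerivAt (interaction p M t₀ φ G v) (Complex.I • U (-G t) (nl p M (v t))) t := by
  have hc := continuous_duhamelIntegrand hp hM hG hv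
  exact ((intervalIntegral.integral_hasDerivAt_right (hc.intervalIntegrable _ _)
    hc.stronglyMeasurable.stronglyMeasurableAtFilter hc.continuousAt).const_smul
      Complex.I).const_add φ

theorem continuous_duhamel {p M : ℝ} (hp : 2 ≤ p) (hM : 0 ≤ M) (t₀ : ℝ) (φ : L2 d) {G : ℝ → ℝ}
    (hG : Continuous G) {v : ℝ → L2 d} (hv : Continuous v) :
    Continuous (duhamel p M t₀ φ G v) :=
  continuous_iff_continuousAt.2 fun t => tendsto_U_apply (hG.tendsto t)
    (hasDerivAt_interaction hp hM t₀ φ hG hv t).continuousAt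

theorem interaction_sub {p M : ℝ} (hp : 2 ≤ p) (hM : 0 ≤ M) (t₀ : ℝ) (φ : L2 d) {G : ℝ → ℝ}
    (hG : Continuous G) {v : ℝ → L2 d} (hv : Continuous v) (s t : ℝ) :
    interaction p M t₀ φ G v s - interaction p M t₀ φ G v t =
      Complex.I • ∫ r in t..s, U (-G r) (nl p M (v r)) := by
  have hc := continuous_duhamelIntegrand hp hM hG hv
  rw [interaction, interaction, add_sub_add_left_eq_sub, ← smul_sub,
    intervalIntegral.integral_interval_sub_left (hc.intervalIntegrable _ _)
      (hc.intervalIntegrable _ _)]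

/-- Bounded `H²`-valued solutions of the Duhamel formula are solutions of the equation. -/
theorem isSolution_of_eq_duhamel {p M : ℝ} (hp : 2 ≤ p) (hM : 0 ≤ M) {t₀ : ℝ} {φ : L2 d}
    {g G : ℝ → ℝ} (hG : IsPhase g t₀ G) (hφ : eH2Norm φ < ∞) {I : Set ℝ} (hI : I.OrdConnected)
    (h0 : t₀ ∈ I) {v : ℝ → L2 d} (hv : Continuous v) (hb : ∀ t ∈ I, ∀ᵐ x, ‖v t x‖ ≤ M)
    (hB : ∀ R : ℝ, ∃ B : ℝ, 0 ≤ B ∧ ∀ s ∈ I, |s - t₀| ≤ R → eH2Norm (v s) ≤ ENNReal.ofReal B)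
    (heq : ∀ t ∈ I, v t = duhamel p M t₀ φ G v t) : IsSolution p g t₀ φ I v := by
  obtain ⟨C, hC, hnl⟩ := eH2Norm_nl_le (d := d) hp hM
  set W := interaction p M t₀ φ G v with hW
  have hc := continuous_duhamelIntegrand hp hM hG.continuous hv
  -- The integrand is bounded in H², so W is Lipschitz in time with values in H². Continuity of the
  -- nonlinearity in H² is not needed here.
  have hWsub : ∀ R : ℝ, ∃ B : ℝ, 0 ≤ B ∧ ∀ s ∈ I, ∀ t ∈ I, |s - t₀| ≤ R → |t - t₀| ≤ R →
      eH2Norm (W s - W t) ≤ ENNReal.ofReal (B * |s - t|) := by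
    intro R
    obtain ⟨B, hB0, hBR⟩ := hB R
    refine ⟨C * B, by positivity, fun s hs t ht hsR htR => ?_⟩
    rw [hW, interaction_sub hp hM t₀ φ hG.continuous hv, eH2Norm_I_smul]
    refine eH2Norm_integral_le (by positivity) (hc.intervalIntegrable _ _) fun r hr => ?_
    have hr' : r ∈ Set.uIcc t s := Set.uIoc_subset_uIcc hr
    have hrI : r ∈ I := hI.uIcc_subset ht hs hr'
    refine (eH2Norm_U_le _ _).trans (hnl _ _ hB0 (hb r hrI) (hBR r hrI ?_))
    rw [abs_le] at hsR htR ⊢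
    rcases Set.mem_uIcc.1 hr' with h | h
    · exact ⟨by linarith [h.1], by linarith [h.2]⟩
    · exact ⟨by linarith [h.1], by linarith [h.2]⟩
  have hW0 : W t₀ = φ := by simp [hW, interaction]
  have hWfin : ∀ t ∈ I, eH2Norm (W t) < ∞ := by
    intro t ht
    obtain ⟨B, hB0, hBR⟩ := hWsub |t - t₀|
    have h1 := hBR t ht t₀ h0 le_rfl (by simp)
    have h2 := eH2Norm_add_le (W t - W t₀) (W t₀)
    rw [sub_add_cancel, hW0] at h2
    rw [hW0] at h1
    exact h2.trans_lt (ENNReal.add_lt_top.2 ⟨h1.trans_lt ENNReal.ofReal_lt_top, hφ⟩)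
  have hWc : ContinuousOn (fun t => lift (W t)) I := by
    rw [continuousOn_lift_iff hWfin]
    intro t ht
    obtain ⟨B, hB0, hBR⟩ := hWsub (|t - t₀| + 1)
    have hlim : Tendsto (fun s => ENNReal.ofReal (B * |s - t|)) (𝓝[I] t) (𝓝 0) := by
      have : Continuous fun s => ENNReal.ofReal (B * |s - t|) :=
        ENNReal.continuous_ofReal.comp (by fun_prop)
      simpa using (this.tendsto t).mono_left nhdsWithin_le_nhds
    refine tendsto_of_tendsto_of_tendsto_of_le_of_le' tendsto_const_nhds hlim
      (Eventually.of_forall fun _ => zero_le) ?_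
    filter_upwards [eventually_mem_nhdsWithin,
      nhdsWithin_le_nhds (Metric.closedBall_mem_nhds t one_pos)] with s hs hs'
    refine hBR s hs t ht ?_ (by linarith)
    have h1 : |s - t| ≤ 1 := hs'
    have h2 := abs_sub_le s t t₀
    linarith
  have hv' : ∀ t ∈ I, v t = U (G t) (W t) := heq
  have hvfin : ∀ t ∈ I, eH2Norm (v t) < ∞ := fun t ht => by
    rw [hv' t ht]; exact (eH2Norm_U_le _ _).trans_lt (hWfin t ht)
  refine ⟨hI, h0, ?_, fun t ht => (memH2_iff _).2 (hvfin t ht), ?_, fun t ht hg => ?_⟩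
  · rw [hv' t₀ h0, hG.zero, U_zero, hW0]
  · rw [← continuousOn_lift_iff hvfin]
    have h1 : ContinuousOn (fun t => U (G t) (lift (W t))) I := fun t ht =>
      tendsto_U_apply hG.continuous.continuousWithinAt (hWc t ht)
    refine h1.congr fun t ht => ?_
    simp only [hv' t ht, lift_U (hWfin t ht)]
  · refine ⟨_, nl p M (v t), ?_, ae_eq_nl hp hM (hb t ht), (equation_iff (hvfin t ht)).2 rfl⟩
    have h1 := hasDerivWithinAt_U_comp (hG.hasDerivAt t hg)
      (hasDerivAt_interaction hp hM t₀ φ hG.continuous hv t).hasDerivWithinAt (hWfin t ht) (J := I)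
    refine (h1.congr hv' (hv' t ht)).congr_deriv ?_
    rw [map_add, map_smul, map_smul, map_smul, U_U_neg, ← lap_U (hWfin t ht), ← hv' t ht, smul_add,
      smul_comm, add_comm]

/-! ### The profile -/

theorem norm_profile (p t₀ : ℝ) (φ : Space d → ℂ) (t : ℝ) (x : Space d) :
    ‖profile p t₀ φ t x‖ = ‖φ x‖ := by
  rw [profile, norm_mul, _root_.mul_comm Complex.I, Complex.norm_exp_ofReal_mul_I, _root_.mul_one]

theorem coeFn_profileL2 (p t₀ : ℝ) (φ : L2 d) (t : ℝ) :
    profileL2 p t₀ φ t =ᵐ[volume] profile p t₀ φ t := MemLp.coeFn_toLp _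

theorem profileL2_initial (p t₀ : ℝ) (φ : L2 d) : profileL2 p t₀ φ t₀ = φ := by
  refine Lp.ext ?_
  filter_upwards [coeFn_profileL2 p t₀ φ t₀] with x hx
  rw [hx, profile]; simp

theorem norm_profileL2 (p t₀ : ℝ) (φ : L2 d) (t : ℝ) : ‖profileL2 p t₀ φ t‖ = ‖φ‖ := by
  rw [Lp.norm_def, Lp.norm_def]
  congr 1
  refine eLpNorm_congr_norm_ae ?_
  filter_upwards [coeFn_profileL2 p t₀ φ t] with x hx
  rw [hx, norm_profile]

theorem ae_norm_profileL2_le {M : ℝ} {φ : L2 d} (hφ : ∀ᵐ x, ‖φ x‖ ≤ M) (p t₀ t : ℝ) :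
    ∀ᵐ x, ‖profileL2 p t₀ φ t x‖ ≤ M := by
  filter_upwards [hφ, coeFn_profileL2 p t₀ φ t] with x h1 h2
  rwa [h2, norm_profile]

theorem hasDerivAt_profile (p t₀ : ℝ) (φ : Space d → ℂ) (t : ℝ) (x : Space d) :
    HasDerivAt (fun s => profile p t₀ φ s x)
      (Complex.I * (((‖profile p t₀ φ t x‖ ^ (p - 1) : ℝ) : ℂ) * profile p t₀ φ t x)) t := by
  have h1 : HasDerivAt (fun s : ℝ => (s - t₀) * ‖φ x‖ ^ (p - 1)) (1 * ‖φ x‖ ^ (p - 1)) t :=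
    ((hasDerivAt_id t).sub_const t₀).mul_const _
  have h2 := ((h1.ofReal_comp.const_mul Complex.I).cexp).const_mul (φ x)
  refine h2.congr_deriv ?_
  rw [norm_profile, profile]
  push_cast
  ring

theorem profile_taylor (p t₀ : ℝ) (φ : Space d → ℂ) (s t : ℝ) (x : Space d) :
    profile p t₀ φ s x - profile p t₀ φ t x -
        ((s - t : ℝ) : ℂ) * (Complex.I * powNL p (profile p t₀ φ t x)) =
      profile p t₀ φ t x * (Complex.exp (Complex.I * (((s - t) * ‖φ x‖ ^ (p - 1) : ℝ) : ℂ)) - 1 -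
        Complex.I * (((s - t) * ‖φ x‖ ^ (p - 1) : ℝ) : ℂ)) := by
  have e : profile p t₀ φ s x = profile p t₀ φ t x *
      Complex.exp (Complex.I * (((s - t) * ‖φ x‖ ^ (p - 1) : ℝ) : ℂ)) := by
    rw [profile, profile, mul_assoc, ← Complex.exp_add]
    congr 2
    push_cast
    ring
  rw [e, powNL, norm_profile]
  push_cast
  ring

/-- The pointwise Taylor remainder in time is quadratic in s - t, uniformly in x because φ is
bounded; this lifts the pointwise differential equation to L². -/
theorem norm_profileL2_taylor_le {p M : ℝ} (hp : 2 ≤ p) (hM : 0 ≤ M) (t₀ : ℝ) {φ : L2 d}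
    (hφ : ∀ᵐ x, ‖φ x‖ ≤ M) {s t : ℝ} (hst : |s - t| * M ^ (p - 1) ≤ 1) :
    ‖profileL2 p t₀ φ s - profileL2 p t₀ φ t -
        (s - t) • (Complex.I • nl p M (profileL2 p t₀ φ t))‖ ≤
      (M ^ (p - 1)) ^ 2 * (s - t) ^ 2 * ‖φ‖ := by
  have hG : L2Le (fun x => (M ^ (p - 1)) ^ 2 * (s - t) ^ 2 * ‖φ x‖)
      ((M ^ (p - 1)) ^ 2 * (s - t) ^ 2 * ‖φ‖) := (L2Le.of_norm le_rfl).const_mul (by positivity)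
  refine hG.norm_le ?_
  have hb := ae_norm_profileL2_le hφ p t₀ t
  rw [real_smul_eq]
  filter_upwards [Lp.coeFn_sub (profileL2 p t₀ φ s - profileL2 p t₀ φ t)
      (((s - t : ℝ) : ℂ) • (Complex.I • nl p M (profileL2 p t₀ φ t))),
    Lp.coeFn_sub (profileL2 p t₀ φ s) (profileL2 p t₀ φ t),
    Lp.coeFn_smul ((s - t : ℝ) : ℂ) (Complex.I • nl p M (profileL2 p t₀ φ t)),
    Lp.coeFn_smul Complex.I (nl p M (profileL2 p t₀ φ t)), coeFn_nl_of_le hp hM hb,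
    coeFn_profileL2 p t₀ φ s, coeFn_profileL2 p t₀ φ t, hφ] with x h1 h2 h3 h4 h5 h6 h7 h8
  rw [h1, Pi.sub_apply, h2, Pi.sub_apply, h3, Pi.smul_apply, h4, Pi.smul_apply, h5, h6, h7,
    smul_eq_mul, smul_eq_mul, profile_taylor, norm_mul, norm_profile]
  have h9 : ‖φ x‖ ^ (p - 1) ≤ M ^ (p - 1) :=
    Real.rpow_le_rpow (norm_nonneg _) h8 (by linarith)
  have h10 : 0 ≤ ‖φ x‖ ^ (p - 1) := by positivity
  have h11 : ‖Complex.I * (((s - t) * ‖φ x‖ ^ (p - 1) : ℝ) : ℂ)‖ = |s - t| * ‖φ x‖ ^ (p - 1) := by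
    rw [norm_mul, Complex.norm_I, _root_.one_mul, Complex.norm_real, Real.norm_eq_abs, abs_mul,
      abs_of_nonneg h10]
  have h12 : ‖Complex.I * (((s - t) * ‖φ x‖ ^ (p - 1) : ℝ) : ℂ)‖ ≤ |s - t| * M ^ (p - 1) := by
    rw [h11]; gcongr
  refine (mul_le_mul_of_nonneg_left (Complex.norm_exp_sub_one_sub_id_le (h12.trans hst))
    (norm_nonneg _)).trans ?_
  calc ‖φ x‖ * ‖Complex.I * (((s - t) * ‖φ x‖ ^ (p - 1) : ℝ) : ℂ)‖ ^ 2
      ≤ ‖φ x‖ * (|s - t| * M ^ (p - 1)) ^ 2 := by gcongr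
    _ = _ := by rw [mul_pow, sq_abs]; ring

theorem hasDerivAt_profileL2 {p M : ℝ} (hp : 2 ≤ p) (hM : 0 ≤ M) (t₀ : ℝ) {φ : L2 d}
    (hφ : ∀ᵐ x, ‖φ x‖ ≤ M) (t : ℝ) :
    HasDerivAt (profileL2 p t₀ φ) (Complex.I • nl p M (profileL2 p t₀ φ t)) t := by
  rw [hasDerivAt_iff_isLittleO]
  have h1 : (fun s => profileL2 p t₀ φ s - profileL2 p t₀ φ t -
        (s - t) • (Complex.I • nl p M (profileL2 p t₀ φ t))) =O[𝓝 t] fun s => (s - t) ^ 2 := by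
    refine Asymptotics.IsBigO.of_bound ((M ^ (p - 1)) ^ 2 * ‖φ‖) ?_
    have hc : Continuous fun s => |s - t| * M ^ (p - 1) := by fun_prop
    have := (hc.tendsto t).eventually (eventually_le_nhds (b := 1) (by simp))
    filter_upwards [this] with s hs
    refine (norm_profileL2_taylor_le hp hM t₀ hφ hs).trans_eq ?_
    rw [Real.norm_of_nonneg (sq_nonneg _)]; ring
  have h2 : (fun s : ℝ => (s - t) ^ 2) =o[𝓝 t] fun s => s - t := by
    have h3 : Tendsto (fun s : ℝ => s - t) (𝓝 t) (𝓝 0) := by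
      have : Continuous fun s : ℝ => s - t := by fun_prop
      simpa using this.tendsto t
    have h4 := (Asymptotics.isLittleO_pow_id (𝕜 := ℝ) (n := 2) one_lt_two).comp_tendsto h3
    exact h4
  exact h1.trans_isLittleO h2

theorem continuous_profileL2 {p M : ℝ} (hp : 2 ≤ p) (hM : 0 ≤ M) (t₀ : ℝ) {φ : L2 d}
    (hφ : ∀ᵐ x, ‖φ x‖ ≤ M) : Continuous (profileL2 p t₀ φ) :=
  continuous_iff_continuousAt.2 fun t => (hasDerivAt_profileL2 hp hM t₀ hφ t).continuousAt

theorem profileL2_eq_add_integral {p M : ℝ} (hp : 2 ≤ p) (hM : 0 ≤ M) (t₀ : ℝ) {φ : L2 d}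
    (hφ : ∀ᵐ x, ‖φ x‖ ≤ M) (t : ℝ) :
    profileL2 p t₀ φ t = φ + Complex.I • ∫ s in t₀..t, nl p M (profileL2 p t₀ φ s) := by
  have hc : Continuous fun s => nl p M (profileL2 p t₀ φ s) :=
    (continuous_nl hp hM).comp (continuous_profileL2 hp hM t₀ hφ)
  have h := intervalIntegral.integral_eq_sub_of_hasDerivAt (a := t₀) (b := t)
    (fun s _ => hasDerivAt_profileL2 hp hM t₀ hφ s)
    ((hc.const_smul Complex.I).intervalIntegrable _ _)
  rw [intervalIntegral.integral_smul, profileL2_initial] at h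
  rw [h, add_sub_cancel]

theorem profileL2_eq_duhamel {p M : ℝ} (hp : 2 ≤ p) (hM : 0 ≤ M) (t₀ : ℝ) {φ : L2 d}
    (hφ : ∀ᵐ x, ‖φ x‖ ≤ M) (t : ℝ) :
    profileL2 p t₀ φ t = duhamel p M t₀ φ (fun _ => 0) (profileL2 p t₀ φ) t := by
  rw [profileL2_eq_add_integral hp hM t₀ hφ, duhamel, interaction, U_zero]
  simp_rw [neg_zero, U_zero]

/-- Gronwall's inequality for the L² norm of a single second difference, whose constants do not
depend on the step. The factor s² carried by the second differences of φ persists, so H² regularity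
propagates without differentiating the profile. -/
theorem exists_eH2Norm_profileL2_le {p M : ℝ} (hp : 2 ≤ p) (hM : 0 ≤ M) (t₀ : ℝ) {φ : L2 d}
    (hφ : ∀ᵐ x, ‖φ x‖ ≤ M) (hφ2 : eH2Norm φ < ∞) (R : ℝ) : ∃ B : ℝ, 0 ≤ B ∧ ∀ t,
      |t - t₀| ≤ R → eH2Norm (profileL2 p t₀ φ t) ≤ ENNReal.ofReal B := by
  set K := p * M ^ (p - 1) + 12 * (5 * p ^ 2 * M ^ (p - 2)) * M with hK
  have hK0 : 0 ≤ K := by positivity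
  set Q := (eH2Norm φ).toReal with hQ
  have hQ0 : 0 ≤ Q := ENNReal.toReal_nonneg
  have hφQ : eH2Norm φ ≤ ENNReal.ofReal Q := (ENNReal.ofReal_toReal hφ2.ne).ge
  have hu := continuous_profileL2 hp hM t₀ hφ
  have hc : Continuous fun s => nl p M (profileL2 p t₀ φ s) := (continuous_nl hp hM).comp hu
  set A := 2 * Q * Real.exp ((2 * K + 1) * R) with hA
  refine ⟨(1 + d) * A, by positivity, fun t ht => ?_⟩
  have hexp : Real.exp ((2 * K + 1) * |t - t₀|) ≤ Real.exp ((2 * K + 1) * R) := by gcongr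
  have hR : 0 ≤ R := (abs_nonneg _).trans ht
  refine eH2Norm_le_of_secondDiff (by positivity) ?_ fun j => ?_
  · rw [norm_profileL2]
    refine (norm_le_of_eH2Norm_le hQ0 hφQ).trans ?_
    have : 1 ≤ Real.exp ((2 * K + 1) * R) := Real.one_le_exp (by positivity)
    nlinarith
  · refine Eventually.of_forall fun s => ?_
    set h : Space d := s • EuclideanSpace.single j (1 : ℝ) with hh
    have hnorm : ‖h‖ ^ 2 = s ^ 2 := by
      rw [hh, norm_smul, PiLp.norm_single, norm_one, _root_.mul_one, Real.norm_eq_abs, sq_abs]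
    have hg := gronwall_two_sided (y := fun r => ‖secondDiff h (profileL2 p t₀ φ r)‖)
      (t₀ := t₀) (T := t) (A := ‖secondDiff h φ‖) hK0
      (((secondDiff h).continuous.comp hu).norm.continuousOn) (fun _ _ => norm_nonneg _)
      fun r _ => by
        rw [profileL2_eq_add_integral hp hM t₀ hφ r, map_add, map_smul,
          ← ContinuousLinearMap.intervalIntegral_comp_comm _ (hc.intervalIntegrable _ _)]
        refine (norm_add_le _ _).trans ?_
        rw [norm_smul, Complex.norm_I, _root_.one_mul, ← abs_of_nonneg hK0, ← abs_mul,
          ← intervalIntegral.integral_const_mul]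
        refine add_le_add_right (intervalIntegral.norm_integral_le_abs_of_norm_le
          (Eventually.of_forall fun q => norm_secondDiff_nl_le hp hM
            (ae_norm_profileL2_le hφ p t₀ q) h) ?_) _
        exact (((secondDiff h).continuous.comp hu).norm.const_mul K).intervalIntegrable _ _
    refine hg.trans ?_
    have h2 := norm_secondDiff_le hQ0 hφQ h
    rw [hnorm] at h2
    calc 2 * ‖secondDiff h φ‖ * Real.exp ((2 * K + 1) * |t - t₀|)
        ≤ 2 * (s ^ 2 * Q) * Real.exp ((2 * K + 1) * R) := by gcongr
      _ = A * s ^ 2 := by rw [hA]; ring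

theorem isSolution_profileL2 {p M : ℝ} (hp : 2 ≤ p) (hM : 0 ≤ M) (t₀ : ℝ) {φ : L2 d}
    (hφ : ∀ᵐ x, ‖φ x‖ ≤ M) (hφ2 : eH2Norm φ < ∞) :
    IsSolution p (fun _ => 0) t₀ φ Set.univ (profileL2 p t₀ φ) := by
  refine isSolution_of_eq_duhamel hp hM (isPhase_zero t₀) hφ2 Set.ordConnected_univ (Set.mem_univ _)
    (continuous_profileL2 hp hM t₀ hφ) (fun t _ => ae_norm_profileL2_le hφ p t₀ t) (fun R => ?_)
    fun t _ => profileL2_eq_duhamel hp hM t₀ hφ t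
  obtain ⟨B, hB, h⟩ := exists_eH2Norm_profileL2_le hp hM t₀ hφ hφ2 R
  exact ⟨B, hB, fun s _ hs => h s hs⟩

/-! ### Construction of a solution near the profile. -/

/-- Joint continuity of the group together with compactness of S: strong convergence to the identity
is uniform along a compact piece of an H² curve. -/
theorem eventually_eH2Norm_U_sub_le {h : ℝ → L2 d} {S : Set ℝ} (hS : IsCompact S)
    (hfin : ∀ s, eH2Norm (h s) < ∞) (hc : Continuous fun s => lift (h s)) {η : ℝ} (hη : 0 < η) :
    ∀ᶠ τ in 𝓝 (0 : ℝ), ∀ s ∈ S, eH2Norm (U τ (h s) - h s) ≤ ENNReal.ofReal η := by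
  refine hS.eventually_forall_of_forall_eventually fun s _ => ?_
  have h1 : Tendsto (fun z : ℝ × ℝ => U z.1 (lift (h z.2)) - lift (h z.2)) (𝓝 (0, s)) (𝓝 0) := by
    have h2 : Tendsto (fun z : ℝ × ℝ => lift (h z.2)) (𝓝 (0, s)) (𝓝 (lift (h s))) :=
      (hc.comp continuous_snd).tendsto (0, s)
    have h3 := (tendsto_U_apply (continuous_fst.tendsto ((0 : ℝ), s)) h2).sub h2
    rwa [U_zero, sub_self] at h3
  have h4 := h1.norm
  rw [norm_zero] at h4
  filter_upwards [h4.eventually (eventually_le_nhds hη)] with z hz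
  have hU := (eH2Norm_U_le z.1 (h z.2)).trans_lt (hfin z.2)
  refine eH2Norm_le_ofReal_of_norm_lift_le
    ((eH2Norm_sub_le _ _).trans_lt (ENNReal.add_lt_top.2 ⟨hU, hfin _⟩)) ?_
  rwa [lift_sub hU (hfin _), lift_U (hfin _)]

theorem tendsto_eH2Norm_nl_sub (hd : d ≤ 3) {p M : ℝ} (hp : 2 ≤ p) (hM : 0 ≤ M) {ι : Type*}
    {l : Filter ι} {f : ι → L2 d} {f₀ : L2 d} (hb : ∀ i, ∀ᵐ x, ‖f i x‖ ≤ M)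
    (hb₀ : ∀ᵐ x, ‖f₀ x‖ ≤ M) (hf₀ : eH2Norm f₀ < ∞)
    (h : Tendsto (fun i => eH2Norm (f i - f₀)) l (𝓝 0)) :
    Tendsto (fun i => eH2Norm (nl p M (f i) - nl p M f₀)) l (𝓝 0) := by
  obtain ⟨C, hC, hnl⟩ := eH2Norm_nl_sub_le hd hp hM
  obtain ⟨C₁, hC₁, hemb⟩ := ae_norm_le (d := d) hd one_pos
  rw [ENNReal.tendsto_nhds_zero] at h ⊢
  intro η' hη'
  obtain ⟨η, hη, hηη⟩ : ∃ η : ℝ, 0 < η ∧ ENNReal.ofReal η ≤ η' := by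
    obtain ⟨q, hq, hq'⟩ := ENNReal.lt_iff_exists_nnreal_btwn.1 hη'
    exact ⟨q, by simpa using hq, by simpa using hq'.le⟩
  obtain ⟨δ, hδ, hnl'⟩ := hnl (eH2Norm f₀).toReal ENNReal.toReal_nonneg (η / 2) (by positivity)
  obtain ⟨r₁, hr₁, hr₁'⟩ := exists_pos_mul_le hC (half_pos hη)
  obtain ⟨r₂, hr₂, hr₂'⟩ := exists_pos_mul_le (X := 1 + C₁) (by positivity) hδ
  have hr : 0 < min r₁ r₂ := lt_min hr₁ hr₂
  filter_upwards [h (ENNReal.ofReal (min r₁ r₂)) (by simpa using hr)] with i hi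
  refine (hnl' (f i) f₀ _ hr.le (hb i) hb₀ (ENNReal.ofReal_toReal hf₀.ne).ge ?_ hi).trans
    ((ENNReal.ofReal_le_ofReal ?_).trans hηη)
  · filter_upwards [hemb _ _ hr.le hi, Lp.coeFn_sub (f i) f₀] with x hx hx'
    rw [hx', Pi.sub_apply] at hx
    refine hx.trans ?_
    have h1 := norm_le_of_eH2Norm_le hr.le hi
    have h2 : C₁ * ‖f i - f₀‖ ≤ C₁ * min r₁ r₂ := by gcongr
    have h3 : (1 + C₁) * min r₁ r₂ ≤ (1 + C₁) * r₂ := by gcongr; exact min_le_right _ _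
    linarith
  · have : C * min r₁ r₂ ≤ C * r₁ := by gcongr; exact min_le_left _ _
    linarith

theorem continuous_exp_smul (Λ t₀ : ℝ) (y : ℝ →ᵇ L2 d) :
    Continuous fun t => Real.exp (Λ * |t - t₀|) • y t := by
  have h : Continuous fun t => Real.exp (Λ * |t - t₀|) := by fun_prop
  exact h.smul y.continuous

theorem norm_duhamel_sub_le_of_exp {p M : ℝ} (hp : 2 ≤ p) (hM : 0 ≤ M) (t₀ : ℝ) (φ : L2 d)
    {G : ℝ → ℝ} (hG : Continuous G) {Λ : ℝ} (hΛ : 0 < Λ) {v w : ℝ → L2 d} (hv : Continuous v)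
    (hw : Continuous w) {b : ℝ} (hb : 0 ≤ b)
    (h : ∀ t, ‖v t - w t‖ ≤ b * Real.exp (Λ * |t - t₀|)) (t : ℝ) :
    ‖duhamel p M t₀ φ G v t - duhamel p M t₀ φ G w t‖ ≤
      p * M ^ (p - 1) / Λ * b * Real.exp (Λ * |t - t₀|) := by
  refine (norm_duhamel_sub_le hp hM φ hG hv.continuousOn hw.continuousOn).trans ?_
  have h1 := norm_integral_le_of_exp hΛ hb le_rfl (t₀ := t₀) (t := t)
    (f := fun s => ‖v s - w s‖) fun s _ => by rw [norm_norm, add_zero]; exact h s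
  rw [zero_mul, add_zero, Real.norm_eq_abs] at h1
  calc p * M ^ (p - 1) * _ ≤ p * M ^ (p - 1) * (b / Λ * Real.exp (Λ * |t - t₀|)) := by gcongr
    _ = _ := by ring

theorem norm_duhamel_zero_le {p M : ℝ} (hp : 2 ≤ p) (hM : 0 ≤ M) (t₀ : ℝ) (φ : L2 d) (G : ℝ → ℝ)
    (t : ℝ) : ‖duhamel p M t₀ φ G (fun _ => 0) t‖ = ‖φ‖ := by
  rw [duhamel, norm_U, interaction]
  simp [nl_zero hp hM]

theorem norm_weighted_duhamel_le {p M : ℝ} (hp : 2 ≤ p) (hM : 0 ≤ M) (t₀ : ℝ) (φ : L2 d)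
    {G : ℝ → ℝ} (hG : Continuous G) {Λ : ℝ} (hΛ : 0 < Λ) (y : ℝ →ᵇ L2 d) (t : ℝ) :
    ‖(Real.exp (Λ * |t - t₀|))⁻¹ •
      duhamel p M t₀ φ G (fun s => Real.exp (Λ * |s - t₀|) • y s) t‖ ≤
      p * M ^ (p - 1) / Λ * ‖y‖ + ‖φ‖ := by
  have h1 := norm_duhamel_sub_le_of_exp hp hM t₀ φ hG hΛ (continuous_exp_smul Λ t₀ y)
    (continuous_const (y := (0 : L2 d))) (norm_nonneg y) (fun s => by
      rw [sub_zero, norm_smul, Real.norm_of_nonneg (Real.exp_pos _).le, _root_.mul_comm]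
      gcongr
      exact y.norm_coe_le_norm s) t
  have hE : 1 ≤ Real.exp (Λ * |t - t₀|) := Real.one_le_exp (by positivity)
  have h2 := (norm_le_norm_sub_add _ _).trans
    (add_le_add h1 (norm_duhamel_zero_le hp hM t₀ φ G t).le)
  rw [norm_smul, norm_inv, Real.norm_of_nonneg (Real.exp_pos _).le,
    inv_mul_le_iff₀ (Real.exp_pos _)]
  refine h2.trans ?_
  nlinarith [norm_nonneg φ]

/-- The Duhamel operator in an exponentially weighted space of bounded functions. -/
def weightedDuhamel {p M : ℝ} (hp : 2 ≤ p) (hM : 0 ≤ M) (t₀ : ℝ) (φ : L2 d)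
    {G : ℝ → ℝ} (hG : Continuous G) {Λ : ℝ} (hΛ : 0 < Λ) (y : ℝ →ᵇ L2 d) : ℝ →ᵇ L2 d :=
  BoundedContinuousFunction.ofNormedAddCommGroup
    (fun t => (Real.exp (Λ * |t - t₀|))⁻¹ •
      duhamel p M t₀ φ G (fun s => Real.exp (Λ * |s - t₀|) • y s) t)
    (Continuous.smul (Continuous.inv₀ (by fun_prop) fun t => (Real.exp_pos _).ne')
      (continuous_duhamel hp hM t₀ φ hG (continuous_exp_smul Λ t₀ y))) _
    (norm_weighted_duhamel_le hp hM t₀ φ hG hΛ y)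

theorem exp_smul_weightedDuhamel {p M : ℝ} (hp : 2 ≤ p) (hM : 0 ≤ M) (t₀ : ℝ) (φ : L2 d)
    {G : ℝ → ℝ} (hG : Continuous G) {Λ : ℝ} (hΛ : 0 < Λ) (y : ℝ →ᵇ L2 d) (t : ℝ) :
    Real.exp (Λ * |t - t₀|) • weightedDuhamel hp hM t₀ φ hG hΛ y t =
      duhamel p M t₀ φ G (fun s => Real.exp (Λ * |s - t₀|) • y s) t :=
  smul_inv_smul₀ (Real.exp_pos _).ne' _

theorem lipschitzWith_weightedDuhamel {p M : ℝ} (hp : 2 ≤ p) (hM : 0 ≤ M) (t₀ : ℝ) (φ : L2 d)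
    {G : ℝ → ℝ} (hG : Continuous G) {Λ : ℝ} (hΛ : 0 < Λ) :
    LipschitzWith (Real.toNNReal (p * M ^ (p - 1) / Λ)) (weightedDuhamel hp hM t₀ φ hG hΛ) := by
  have hK : 0 ≤ p * M ^ (p - 1) / Λ := by positivity
  refine LipschitzWith.of_dist_le_mul fun y z => ?_
  rw [Real.coe_toNNReal _ hK, BoundedContinuousFunction.dist_le (by positivity)]
  intro t
  have h1 := norm_duhamel_sub_le_of_exp hp hM t₀ φ hG hΛ (continuous_exp_smul Λ t₀ y)
    (continuous_exp_smul Λ t₀ z) (dist_nonneg (x := y) (y := z)) (fun s => by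
      rw [← smul_sub, norm_smul, Real.norm_of_nonneg (Real.exp_pos _).le, _root_.mul_comm,
        ← dist_eq_norm]
      gcongr
      exact BoundedContinuousFunction.dist_coe_le_dist s) t
  rw [← exp_smul_weightedDuhamel hp hM t₀ φ hG hΛ y,
    ← exp_smul_weightedDuhamel hp hM t₀ φ hG hΛ z, ← smul_sub, norm_smul,
    Real.norm_of_nonneg (Real.exp_pos _).le, _root_.mul_comm] at h1
  rw [dist_eq_norm]
  exact le_of_mul_le_mul_right h1 (Real.exp_pos _)

/-- Solutions of the Duhamel formula which satisfy closed constraints that the Duhamel operator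
preserves. -/
theorem exists_eq_duhamel_of_invariant {p M : ℝ} (hp : 2 ≤ p) (hM : 0 ≤ M) (t₀ : ℝ) (φ : L2 d)
    {G : ℝ → ℝ} (hG : Continuous G) {Λ : ℝ} (hΛ : 0 < Λ) (hΛK : p * M ^ (p - 1) < Λ)
    {S : ℝ → Set (L2 d)} (hS : ∀ t, IsClosed (S t)) {w : ℝ → L2 d} (hw : Continuous w) {b : ℝ}
    (hwb : ∀ t, ‖w t‖ ≤ b) (hwS : ∀ t, w t ∈ S t)
    (hinv : ∀ v, Continuous v → (∀ t, v t ∈ S t) → ∀ t, duhamel p M t₀ φ G v t ∈ S t) :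
    ∃ v, Continuous v ∧ (∀ t, v t ∈ S t) ∧ ∀ t, v t = duhamel p M t₀ φ G v t := by
  set F := weightedDuhamel hp hM t₀ φ hG hΛ with hF
  -- The contraction takes place in the weighted L² metric alone; the H² information is carried by a
  -- subset that is closed in this metric, hence complete.
  set Y : Set (ℝ →ᵇ L2 d) := {y | ∀ t, Real.exp (Λ * |t - t₀|) • y t ∈ S t} with hY
  have hYc : IsClosed Y := by
    have : Y = ⋂ t, (fun y : ℝ →ᵇ L2 d => Real.exp (Λ * |t - t₀|) • y t) ⁻¹' S t := by
      ext y; simp [hY]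
    rw [this]
    refine isClosed_iInter fun t => (hS t).preimage ?_
    have hev : Continuous fun y : ℝ →ᵇ L2 d => y t := continuous_eval_const t
    exact hev.const_smul (Real.exp (Λ * |t - t₀|))
  have hmaps : Set.MapsTo F Y Y := fun y hy t => by
    rw [exp_smul_weightedDuhamel]
    exact hinv _ (continuous_exp_smul Λ t₀ y) hy t
  have hcontr : ContractingWith (Real.toNNReal (p * M ^ (p - 1) / Λ)) (hmaps.restrict F Y Y) := by
    refine ⟨?_, ((lipschitzWith_weightedDuhamel hp hM t₀ φ hG hΛ).lipschitzOnWith).mapsToRestrict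
      hmaps⟩
    rw [Real.toNNReal_lt_one, div_lt_one hΛ]
    exact hΛK
  have hbd : ∀ t, ‖(Real.exp (Λ * |t - t₀|))⁻¹ • w t‖ ≤ b := fun t => by
    have hE : 1 ≤ Real.exp (Λ * |t - t₀|) := Real.one_le_exp (by positivity)
    rw [norm_smul, norm_inv, Real.norm_of_nonneg (Real.exp_pos _).le]
    exact (mul_le_of_le_one_left (norm_nonneg _) (inv_le_one_of_one_le₀ hE)).trans (hwb t)
  set y₀ : ℝ →ᵇ L2 d := BoundedContinuousFunction.ofNormedAddCommGroup
    (fun t => (Real.exp (Λ * |t - t₀|))⁻¹ • w t)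
    (Continuous.smul (Continuous.inv₀ (by fun_prop) fun t => (Real.exp_pos _).ne') hw) b hbd
  have hy₀ : y₀ ∈ Y := fun t => by
    change Real.exp (Λ * |t - t₀|) • (Real.exp (Λ * |t - t₀|))⁻¹ • w t ∈ S t
    rw [smul_inv_smul₀ (Real.exp_pos _).ne']
    exact hwS t
  obtain ⟨y, hy, hfix, -⟩ := hcontr.exists_fixedPoint' hYc.isComplete hmaps hy₀ (edist_ne_top _ _)
  refine ⟨fun t => Real.exp (Λ * |t - t₀|) • y t, continuous_exp_smul Λ t₀ y, hy, fun t => ?_⟩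
  rw [← exp_smul_weightedDuhamel hp hM t₀ φ hG hΛ y, ← hF, hfix.eq]

/-- The distance to the profile has three sources: the group acting on φ, the difference of the
nonlinearities transported by the group, and the group acting on the nonlinearity of the profile.
The first and third vanish with the phase. -/
theorem duhamel_sub_profileL2 {p M : ℝ} (hp : 2 ≤ p) (hM : 0 ≤ M) (t₀ : ℝ) {φ : L2 d}
    (hφ : ∀ᵐ x, ‖φ x‖ ≤ M) {G : ℝ → ℝ} (hG : Continuous G) {v : ℝ → L2 d} (hv : Continuous v)
    (t : ℝ) : duhamel p M t₀ φ G v t - profileL2 p t₀ φ t = (U (G t) φ - φ) +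
      Complex.I • ∫ s in t₀..t, (U (G t - G s) (nl p M (v s) - nl p M (profileL2 p t₀ φ s)) +
        (U (G t - G s) (nl p M (profileL2 p t₀ φ s)) - nl p M (profileL2 p t₀ φ s))) := by
  have hc := continuous_duhamelIntegrand hp hM hG hv
  have hc0 : Continuous fun s => nl p M (profileL2 p t₀ φ s) :=
    (continuous_nl hp hM).comp (continuous_profileL2 hp hM t₀ hφ)
  have e : (fun s => U (G t - G s) (nl p M (v s) - nl p M (profileL2 p t₀ φ s)) +
        (U (G t - G s) (nl p M (profileL2 p t₀ φ s)) - nl p M (profileL2 p t₀ φ s))) =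
      fun s => U (G t) (U (-G s) (nl p M (v s))) - nl p M (profileL2 p t₀ φ s) := by
    ext1 s
    rw [map_sub, ← U_add, ← sub_eq_add_neg]
    abel
  have hi : IntervalIntegrable (fun s => U (G t) (U (-G s) (nl p M (v s)))) volume t₀ t :=
    ((U (G t)).continuous.comp hc).intervalIntegrable _ _
  rw [e, intervalIntegral.integral_sub hi (hc0.intervalIntegrable _ _),
    ContinuousLinearMap.intervalIntegral_comp_comm _ (hc.intervalIntegrable _ _),
    profileL2_eq_add_integral hp hM t₀ hφ t, duhamel, interaction, map_add, map_smul, smul_sub]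
  abel

/-- A general multiplier m serves both norms at once: m = 1 gives the L² estimate and m = `wtrunc n`
the H² estimate. It commutes with the isometries `U`. -/
theorem norm_mult_duhamel_sub_le {p M : ℝ} (hp : 2 ≤ p) (hM : 0 ≤ M) (t₀ : ℝ) {φ : L2 d}
    (hφ : ∀ᵐ x, ‖φ x‖ ≤ M) {G : ℝ → ℝ} (hG : Continuous G) {v : ℝ → L2 d} (hv : Continuous v)
    {t Λ : ℝ} (hΛ : 0 < Λ) (m : Space d →ᵇ ℂ) {a b c κ : ℝ} (hb : 0 ≤ b) (hc : 0 ≤ c) (hκ : 0 ≤ κ)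
    (h1 : ‖mult m (U (G t) φ - φ)‖ ≤ a)
    (h2 : ∀ s ∈ Set.uIcc t₀ t, ‖mult m (nl p M (v s) - nl p M (profileL2 p t₀ φ s))‖ ≤
      b * Real.exp (Λ * |s - t₀|) + κ)
    (h3 : ∀ s ∈ Set.uIcc t₀ t, ‖mult m (U (G t - G s) (nl p M (profileL2 p t₀ φ s)) -
      nl p M (profileL2 p t₀ φ s))‖ ≤ c) :
    ‖mult m (duhamel p M t₀ φ G v t - profileL2 p t₀ φ t)‖ ≤
      a + (b / Λ * Real.exp (Λ * |t - t₀|) + (κ + c) * |t - t₀|) := by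
  have hc1 : Continuous fun s => nl p M (v s) := (continuous_nl hp hM).comp hv
  have hc0 : Continuous fun s => nl p M (profileL2 p t₀ φ s) :=
    (continuous_nl hp hM).comp (continuous_profileL2 hp hM t₀ hφ)
  have hcU : ∀ f : ℝ → L2 d, Continuous f → Continuous fun s => U (G t - G s) (f s) :=
    fun f hf => continuous_iff_continuousAt.2 fun s =>
      tendsto_U_apply ((continuous_const.sub hG).tendsto s) (hf.tendsto s)
  have hint : IntervalIntegrable (fun s =>
      U (G t - G s) (nl p M (v s) - nl p M (profileL2 p t₀ φ s)) +
        (U (G t - G s) (nl p M (profileL2 p t₀ φ s)) - nl p M (profileL2 p t₀ φ s)))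
      volume t₀ t :=
    ((hcU _ (hc1.sub hc0)).add ((hcU _ hc0).sub hc0)).intervalIntegrable _ _
  rw [duhamel_sub_profileL2 hp hM t₀ hφ hG hv, map_add, map_smul,
    ← ContinuousLinearMap.intervalIntegral_comp_comm _ hint]
  refine (norm_add_le _ _).trans (add_le_add h1 ?_)
  rw [norm_smul, Complex.norm_I, _root_.one_mul]
  refine norm_integral_le_of_exp hΛ hb (by positivity) fun s hs => ?_
  have hs' := Set.uIoc_subset_uIcc hs
  rw [map_add, ← add_assoc]
  refine (norm_add_le _ _).trans (add_le_add ?_ (h3 s hs'))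
  rw [U, mult_comm, norm_mult_eq _ (norm_schrodingerSymbol _)]
  exact h2 s hs'

/-- The nonlinearity of the profile is a continuous curve in H², so `eventually_eH2Norm_U_sub_le`
applies to it on compact time intervals. -/
theorem continuous_lift_profileL2 {p M : ℝ} (hp : 2 ≤ p) (hM : 0 ≤ M) (t₀ : ℝ) {φ : L2 d}
    (hφ : ∀ᵐ x, ‖φ x‖ ≤ M) (hφ2 : eH2Norm φ < ∞) (hd : d ≤ 3) :
    (∀ s, eH2Norm (nl p M (profileL2 p t₀ φ s)) < ∞) ∧
      Continuous fun s => lift (nl p M (profileL2 p t₀ φ s)) := by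
  have hsol := isSolution_profileL2 hp hM t₀ hφ hφ2
  have hb := fun t => ae_norm_profileL2_le hφ p t₀ t
  have hu : ∀ s, eH2Norm (profileL2 p t₀ φ s) < ∞ := fun s => hsol.eH2Norm_lt_top (Set.mem_univ s)
  obtain ⟨C, hC, hnl⟩ := eH2Norm_nl_le (d := d) hp hM
  have hfin : ∀ s, eH2Norm (nl p M (profileL2 p t₀ φ s)) < ∞ := fun s =>
    (hnl _ _ ENNReal.toReal_nonneg (hb s) (ENNReal.ofReal_toReal (hu s).ne).ge).trans_lt
      ENNReal.ofReal_lt_top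
  refine ⟨hfin, continuousOn_univ.1 ((continuousOn_lift_iff fun s _ => hfin s).2 fun t ht => ?_)⟩
  exact tendsto_eH2Norm_nl_sub hd hp hM hb (hb t) (hu t) (hsol.continuous t ht)

/-- The constraints on the distance to the profile used in the fixed point argument. -/
def nearProfile (p t₀ : ℝ) (φ : L2 d) (R Λ δ δ' t : ℝ) : Set (L2 d) :=
  -- No constraint is imposed beyond distance R from t₀, so the fixed point lives on the whole line,
  -- but H² is claimed only up to R.
  {f | |t - t₀| ≤ R → ‖f - profileL2 p t₀ φ t‖ ≤ δ' * Real.exp (Λ * |t - t₀|) ∧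
    eH2Norm (f - profileL2 p t₀ φ t) ≤ ENNReal.ofReal (δ * Real.exp (Λ * |t - t₀|))}

theorem isClosed_nearProfile (p t₀ : ℝ) (φ : L2 d) (R Λ δ δ' t : ℝ) :
    IsClosed (nearProfile p t₀ φ R Λ δ δ' t) := by
  have hc : Continuous fun f : L2 d => f - profileL2 p t₀ φ t := continuous_id.sub continuous_const
  by_cases h : |t - t₀| ≤ R
  · simp only [nearProfile, h, true_imp_iff]
    exact (isClosed_le hc.norm continuous_const).inter ((isClosed_eH2Norm_le _).preimage hc)
  · simp only [nearProfile, h, false_imp_iff]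
    exact isClosed_univ

/-- The Duhamel operator of a small phase preserves the constraints. -/
theorem duhamel_mem_nearProfile {p M : ℝ} (hp : 2 ≤ p) (hM : 0 ≤ M) (t₀ : ℝ) {φ : L2 d}
    (hφ : ∀ᵐ x, ‖φ x‖ ≤ M) {G : ℝ → ℝ} (hG : Continuous G) {v : ℝ → L2 d} (hv : Continuous v)
    {R Λ δ δ' C κ c t : ℝ} (hΛ : 0 < Λ) (hδ : 0 < δ) (hδ' : 0 < δ') (hC : 0 ≤ C)
    (hκ : 0 < κ) (hc : 0 < c) (hCΛ : 4 * C ≤ Λ) (hKΛ : 4 * (p * M ^ (p - 1)) ≤ Λ)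
    (hκR : 4 * (κ * R) ≤ δ) (hcδ : 4 * c ≤ min δ δ') (hcR : 4 * (c * R) ≤ min δ δ')
    (h1 : ∀ s, |s - t₀| ≤ R → eH2Norm (U (G s) φ - φ) ≤ ENNReal.ofReal c)
    (h2 : ∀ s, |s - t₀| ≤ R →
      eH2Norm (nl p M (v s) - nl p M (profileL2 p t₀ φ s)) ≤
        ENNReal.ofReal (C * (δ * Real.exp (Λ * |s - t₀|)) + κ))
    (h2' : ∀ s, |s - t₀| ≤ R →
      ‖v s - profileL2 p t₀ φ s‖ ≤ δ' * Real.exp (Λ * |s - t₀|))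
    (h3 : ∀ s, |s - t₀| ≤ R → ∀ r, eH2Norm (U (G r - G s) (nl p M (profileL2 p t₀ φ s)) -
      nl p M (profileL2 p t₀ φ s)) ≤ ENNReal.ofReal c) :
    duhamel p M t₀ φ G v t ∈ nearProfile p t₀ φ R Λ δ δ' t := by
  intro ht
  have hR : 0 ≤ R := (abs_nonneg _).trans ht
  have hs : ∀ s ∈ Set.uIcc t₀ t, |s - t₀| ≤ R := fun s hs =>
    (Set.abs_sub_left_of_mem_uIcc hs).trans ht
  have hE : 1 ≤ Real.exp (Λ * |t - t₀|) := Real.one_le_exp (by positivity)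
  have hcδ1 := hcδ.trans (min_le_left _ _)
  have hcδ2 := hcδ.trans (min_le_right _ _)
  have hcR1 := hcR.trans (min_le_left _ _)
  have hcR2 := hcR.trans (min_le_right _ _)
  have hct : c * |t - t₀| ≤ c * R := by gcongr
  have hκt : κ * |t - t₀| ≤ κ * R := by gcongr
  constructor
  · have h := norm_mult_duhamel_sub_le hp hM t₀ hφ hG hv hΛ (1 : Space d →ᵇ ℂ) (t := t)
      (a := c) (b := p * M ^ (p - 1) * δ') (c := c) (κ := 0) (by positivity) hc.le le_rfl
      (by rw [mult_one]; exact norm_le_of_eH2Norm_le hc.le (h1 t ht))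
      (fun s hs' => by
        rw [mult_one, add_zero, mul_assoc]
        exact (norm_nl_sub_le hp hM _ _).trans (by gcongr; exact h2' s (hs s hs')))
      (fun s hs' => by rw [mult_one]; exact norm_le_of_eH2Norm_le hc.le (h3 s (hs s hs') t))
    rw [mult_one] at h
    have h4 : p * M ^ (p - 1) * δ' / Λ ≤ δ' / 4 := by
      rw [div_le_div_iff₀ hΛ (by norm_num)]; nlinarith
    have h5 : p * M ^ (p - 1) * δ' / Λ * Real.exp (Λ * |t - t₀|) ≤
      δ' / 4 * Real.exp (Λ * |t - t₀|) := by gcongr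
    nlinarith
  -- Four quarters of δ, times a weight that is at least 1: the group on φ, the Lipschitz part (by
  -- 4C ≤ Λ), the error κ over time R, and the group on the nonlinearity over time R. The L² part
  -- above has no κ.
  · rw [eH2Norm_le_ofReal_iff _ (by positivity)]
    intro n
    have h := norm_mult_duhamel_sub_le hp hM t₀ hφ hG hv hΛ (wtrunc n : Space d →ᵇ ℂ) (t := t)
      (a := c) (b := C * δ) (c := c) (κ := κ) (by positivity) hc.le hκ.le
      ((eH2Norm_le_ofReal_iff _ hc.le).1 (h1 t ht) n)
      (fun s hs' => by
        rw [mul_assoc]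
        exact (eH2Norm_le_ofReal_iff _ (by positivity)).1 (h2 s (hs s hs')) n)
      (fun s hs' => (eH2Norm_le_ofReal_iff _ hc.le).1 (h3 s (hs s hs') t) n)
    have h4 : C * δ / Λ ≤ δ / 4 := by
      rw [div_le_div_iff₀ hΛ (by norm_num)]; nlinarith
    have h5 : C * δ / Λ * Real.exp (Λ * |t - t₀|) ≤ δ / 4 * Real.exp (Λ * |t - t₀|) := by gcongr
    nlinarith

/-- If the phase is small, there is a solution close to the profile on a given interval. -/
theorem exists_isSolution_near_profileL2 (hd : d ≤ 3) {p : ℝ} (hp : 2 ≤ p) (t₀ : ℝ) {φ : L2 d}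
    (hφ2 : eH2Norm φ < ∞) {R η : ℝ} (hR : 0 < R) (hη : 0 < η) :
    ∃ ω > 0, ∀ g G, IsPhase g t₀ G → (∀ t, |G t| ≤ ω) → ∃ v : ℝ → L2 d,
      IsSolution p g t₀ φ (Set.Icc (t₀ - R) (t₀ + R)) v ∧
        ∀ t ∈ Set.Icc (t₀ - R) (t₀ + R),
          eH2Norm (v t - profileL2 p t₀ φ t) ≤ ENNReal.ofReal η := by
  obtain ⟨M₀, hM₀, hφ₀⟩ : ∃ M₀ : ℝ, 0 ≤ M₀ ∧ ∀ᵐ x, ‖φ x‖ ≤ M₀ := by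
    obtain ⟨C, hC, h⟩ := ae_norm_le (d := d) hd one_pos
    exact ⟨1 * (eH2Norm φ).toReal + C * ‖φ‖, by positivity,
      h φ _ ENNReal.toReal_nonneg (ENNReal.ofReal_toReal hφ2.ne).ge⟩
  -- The extra 1 leaves room for functions at sup distance at most 1 from the profile, for which the
  -- truncation is inactive.
  set M := M₀ + 1 with hMdef
  have hM : 0 ≤ M := by positivity
  have hφ : ∀ᵐ x, ‖φ x‖ ≤ M := hφ₀.mono fun x hx => by linarith
  set u₀ := profileL2 p t₀ φ with hu₀
  have hu₀b : ∀ t, ∀ᵐ x, ‖u₀ t x‖ ≤ M₀ := fun t => ae_norm_profileL2_le hφ₀ p t₀ t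
  have hu₀M : ∀ t, ∀ᵐ x, ‖u₀ t x‖ ≤ M := fun t => ae_norm_profileL2_le hφ p t₀ t
  obtain ⟨C, hC, hnl⟩ := eH2Norm_nl_sub_le hd hp hM
  obtain ⟨Q, hQ, hu₀Q⟩ := exists_eH2Norm_profileL2_le hp hM t₀ hφ hφ2 R
  set K := p * M ^ (p - 1) with hK
  have hK0 : 0 ≤ K := by positivity
  -- Possible because C does not depend on κ: the weight is fixed before any smallness is chosen.
  set Λ := 4 * (C + K + 1) with hΛdef
  have hΛ : 0 < Λ := by positivity
  set X := Real.exp (Λ * R) with hX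
  have hX0 : 0 < X := Real.exp_pos _
  have hEX : ∀ t, |t - t₀| ≤ R → Real.exp (Λ * |t - t₀|) ≤ X := fun t ht => by
    rw [hX]; gcongr
  set δ := η / X with hδdef
  have hδ : 0 < δ := by positivity
  have hδX : δ * X = η := div_mul_cancel₀ _ hX0.ne'
  obtain ⟨κ, hκ, hκR⟩ := exists_pos_mul_le (X := 4 * R) (by positivity) hδ
  obtain ⟨ρ, hρ, hnlρ⟩ := hnl Q hQ κ hκ
  set m := min 1 ρ with hm
  have hm0 : 0 < m := lt_min one_pos hρ
  -- The sup distance must be at most ρ, which depends on κ and hence on η, so H² distance η alone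
  -- does not give it. The Sobolev inequality with the small constant κ₁ uses half of m for the H²
  -- distance, and the L² radius δ' is chosen so that the other half covers the L² term.
  obtain ⟨κ₁, hκ₁, hκ₁η⟩ := exists_pos_mul_le hη.le (half_pos hm0)
  obtain ⟨C₁, hC₁, hemb⟩ := ae_norm_le (d := d) hd hκ₁
  obtain ⟨δ', hδ', hδ'X⟩ := exists_pos_mul_le (X := C₁ * X) (by positivity) (half_pos hm0)
  have hmin : 0 < min δ δ' := lt_min hδ hδ'
  obtain ⟨c, hc, hcR⟩ := exists_pos_mul_le (X := 4 * R + 4) (by positivity) hmin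
  obtain ⟨hnfin, hncont⟩ := continuous_lift_profileL2 hp hM t₀ hφ hφ2 hd
  have hev1 := eventually_eH2Norm_U_sub_le (isCompact_singleton (x := (0 : ℝ)))
    (h := fun _ => φ) (fun _ => hφ2) continuous_const hc
  have hev2 := eventually_eH2Norm_U_sub_le (isCompact_closedBall t₀ R) hnfin hncont hc
  obtain ⟨ω, hω, hball⟩ := Metric.eventually_nhds_iff.1 (hev1.and hev2)
  -- Differences of two phase values also occur; they are at most 2ω/3, still below ω.
  refine ⟨ω / 3, by positivity, fun g G hG hGω => ?_⟩
  have hU1 : ∀ s, eH2Norm (U (G s) φ - φ) ≤ ENNReal.ofReal c := fun s =>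
    (hball (y := G s) (by
      rw [dist_zero_right, Real.norm_eq_abs]; linarith [hGω s])).1 0 rfl
  have hU2 : ∀ s, |s - t₀| ≤ R → ∀ r, eH2Norm (U (G r - G s) (nl p M (u₀ s)) -
      nl p M (u₀ s)) ≤ ENNReal.ofReal c := fun s hs r =>
    (hball (y := G r - G s) (by
      rw [dist_zero_right, Real.norm_eq_abs]
      linarith [hGω s, hGω r, abs_sub (G r) (G s)])).2 s hs
  have hclose : ∀ t f, |t - t₀| ≤ R → f ∈ nearProfile p t₀ φ R Λ δ δ' t →
      ∀ᵐ x, ‖f x - u₀ t x‖ ≤ m := by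
    intro t f ht hf
    obtain ⟨hf1, hf2⟩ := hf ht
    filter_upwards [hemb _ _ (by positivity) hf2, Lp.coeFn_sub f (u₀ t)] with x hx hx'
    rw [hx', Pi.sub_apply] at hx
    refine hx.trans ?_
    have h1 : κ₁ * (δ * Real.exp (Λ * |t - t₀|)) ≤ κ₁ * (δ * X) := by
      gcongr; exact hEX t ht
    have h2 : C₁ * ‖f - u₀ t‖ ≤ C₁ * (δ' * X) := by
      gcongr
      exact hf1.trans (by gcongr; exact hEX t ht)
    rw [hδX] at h1
    nlinarith
  have hbound : ∀ t f, |t - t₀| ≤ R → f ∈ nearProfile p t₀ φ R Λ δ δ' t →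
      ∀ᵐ x, ‖f x‖ ≤ M := by
    intro t f ht hf
    filter_upwards [hclose t f ht hf, hu₀b t] with x h1 h2
    have h3 := norm_le_norm_sub_add (f x) (u₀ t x)
    have h4 : m ≤ 1 := min_le_left _ _
    linarith
  obtain ⟨v, hv, hvS, hveq⟩ := exists_eq_duhamel_of_invariant hp hM t₀ φ hG.continuous hΛ
    (by linarith) (S := nearProfile p t₀ φ R Λ δ δ') (fun t => isClosed_nearProfile ..)
    (continuous_profileL2 hp hM t₀ hφ) (fun t => (norm_profileL2 p t₀ φ t).le)
    (fun t _ => by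
      rw [sub_self, norm_zero]
      refine ⟨by positivity, ?_⟩
      rw [eH2Norm_le_ofReal_iff _ (by positivity)]
      intro n
      rw [map_zero, norm_zero]
      positivity)
    (fun v hv hvS t => duhamel_mem_nearProfile hp hM t₀ hφ hG.continuous hv hΛ hδ hδ' hC hκ hc
      (by linarith) (by linarith) (by linarith) (by nlinarith) (by nlinarith) (fun s _ => hU1 s)
      (fun s hs => hnlρ _ _ _ (by positivity) (hbound s _ hs (hvS s)) (hu₀M s) (hu₀Q s hs)
        ((hclose s _ hs (hvS s)).mono fun x hx => hx.trans (min_le_right _ _)) (hvS s hs).2)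
      (fun s hs => (hvS s hs).1) hU2)
  have hI : ∀ t ∈ Set.Icc (t₀ - R) (t₀ + R), |t - t₀| ≤ R := fun t ht => by
    rw [abs_le]; exact ⟨by linarith [ht.1], by linarith [ht.2]⟩
  have hfinal : ∀ t ∈ Set.Icc (t₀ - R) (t₀ + R), eH2Norm (v t - u₀ t) ≤ ENNReal.ofReal η := by
    intro t ht
    refine (hvS t (hI t ht)).2.trans (ENNReal.ofReal_le_ofReal ?_)
    rw [← hδX]
    gcongr
    exact hEX t (hI t ht)
  refine ⟨v, isSolution_of_eq_duhamel hp hM hG hφ2 Set.ordConnected_Icc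
    ⟨by linarith, by linarith⟩ hv (fun t ht => hbound t _ (hI t ht) (hvS t))
    (fun _ => ⟨η + Q, by positivity, fun s hs _ => ?_⟩) (fun t _ => hveq t), hfinal⟩
  have h1 := eH2Norm_add_le (v s - u₀ s) (u₀ s)
  rw [sub_add_cancel] at h1
  rw [ENNReal.ofReal_add hη.le hQ]
  exact h1.trans (add_le_add (hfinal s hs) (hu₀Q s (hI s hs)))

/-! ### Maximal solutions and the limit ε → 0. -/

/-- A maximal solution extends every other solution. -/
theorem IsMaximalSolution.subset_and_eqOn (hd : d ≤ 3) {p t₀ : ℝ} (hp : 2 ≤ p) {g G : ℝ → ℝ}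
    {φ : L2 d} (hG : IsPhase g t₀ G) {I J : Set ℝ} {u v : ℝ → L2 d}
    (hu : IsMaximalSolution p g t₀ φ J u) (hv : IsSolution p g t₀ φ I v) :
    I ⊆ J ∧ Set.EqOn u v I := by
  classical
  have heq := hu.1.eqOn_inter hd hp hG hv
  -- The glued function solves the equation on J ∪ I, so maximality forces J ∪ I = J.
  set w : ℝ → L2 d := fun t => if t ∈ J then u t else v t with hw
  have hwu : Set.EqOn w u J := fun t ht => if_pos ht
  have hwv : Set.EqOn w v I := fun t ht => by
    by_cases h : t ∈ J
    · rw [hwu h]; exact heq ⟨h, ht⟩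
    · exact if_neg h
  have h := hu.2 (J ∪ I) w (hu.1.union hd hp hv hwu hwv) Set.subset_union_left hwu.symm
  have hsub : I ⊆ J := Set.union_eq_left.1 h
  exact ⟨hsub, fun t ht => heq ⟨hsub ht, ht⟩⟩

/-- For small ε a solution near the profile exists on a symmetric interval around t₀ containing [a,
b], and the maximal solution must extend it; existence on [a, b] and closeness to the profile follow
together. -/
theorem eventually_subset_and_eH2Norm_le (hd : d ≤ 3) {p : ℝ} (hp : 2 ≤ p) {γp γm tp : ℝ}
    (hγp : 0 < γp) (hγm : 0 < γm) (hγ : average (dispersionMap γp γm tp) = 0) (t₀ : ℝ) {φ : L2 d}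
    (hφ : eH2Norm φ < ∞) {J : ℝ → Set ℝ} {u : ℝ → ℝ → L2 d}
    (hu : ∀ ε : ℝ, 0 < ε → IsMaximalSolution p (fun t => dispersionMap γp γm tp (t / ε)) t₀ φ
      (J ε) (u ε)) (a b : ℝ) {η : ℝ} (hη : 0 < η) :
    ∀ᶠ ε in 𝓝[>] (0 : ℝ), Set.Icc a b ⊆ J ε ∧
      ∀ t ∈ Set.Icc a b, eH2Norm (u ε t - profileL2 p t₀ φ t) ≤ ENNReal.ofReal η := by
  set R := max |a - t₀| |b - t₀| + 1 with hR
  have hR0 : 0 < R := by positivity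
  have hsub : Set.Icc a b ⊆ Set.Icc (t₀ - R) (t₀ + R) := by
    refine Set.Icc_subset_Icc ?_ ?_
    · have := (neg_abs_le (a - t₀)).trans' (neg_le_neg (le_max_left |a - t₀| |b - t₀|))
      linarith
    · have := (le_abs_self (b - t₀)).trans (le_max_right |a - t₀| |b - t₀|)
      linarith
  obtain ⟨ω, hω, hnear⟩ := exists_isSolution_near_profileL2 hd hp t₀ hφ hR0 hη
  obtain ⟨ε₀, hε₀, hε₀ω⟩ := exists_pos_mul_le (X := 2 * (γp + γm)) (by positivity) hω
  filter_upwards [Ioc_mem_nhdsGT hε₀] with ε hε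
  obtain ⟨G, hG, hGε⟩ := exists_isPhase_dispersionMap hγp hγm hγ t₀ hε.1
  obtain ⟨v, hv, hvη⟩ := hnear _ G hG fun t => (hGε t).trans <| hε₀ω.trans' <| by
    have := hε.2
    gcongr
  obtain ⟨h1, h2⟩ := (hu ε hε.1).subset_and_eqOn hd hp hG hv
  exact ⟨hsub.trans h1, fun t ht => by rw [h2 (hsub ht)]; exact hvη t (hsub ht)⟩

end DispersionNLS

end

theorem corollary4p4 (d : ℕ) (hd : d ≤ 3) (p : ℝ) (hp : 2 ≤ p)
    (γp γm tp : ℝ) (hγp : 0 < γp) (hγm : 0 < γm) (htp : tp ∈ Set.Ioo (0 : ℝ) 1)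
    (hγ : DispersionNLS.average (DispersionNLS.dispersionMap γp γm tp) = 0)
    (t₀ : ℝ) (φ : DispersionNLS.L2 d) (hφ : DispersionNLS.MemH2 φ)
    (J : ℝ → Set ℝ) (u : ℝ → ℝ → DispersionNLS.L2 d)
    (hu : ∀ ε : ℝ, 0 < ε → DispersionNLS.IsMaximalSolution p
      (fun t => DispersionNLS.dispersionMap γp γm tp (t / ε)) t₀ φ (J ε) (u ε)) :
    (∀ a b : ℝ,
      (∀ᶠ ε in 𝓝[>] (0 : ℝ), Set.Icc a b ⊆ J ε) ∧
      Tendsto (fun ε : ℝ => ⨆ t ∈ Set.Icc a b,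
          DispersionNLS.eH2Norm (u ε t - DispersionNLS.profileL2 p t₀ φ t))
        (𝓝[>] (0 : ℝ)) (𝓝 0)) ∧
    DispersionNLS.IsSolution p (fun _ => 0) t₀ φ Set.univ (DispersionNLS.profileL2 p t₀ φ) ∧
    (∀ x : DispersionNLS.Space d,
      DispersionNLS.profile p t₀ φ t₀ x = φ x ∧
      ∀ t : ℝ, DifferentiableAt ℝ (fun s => DispersionNLS.profile p t₀ φ s x) t ∧
        Complex.I * deriv (fun s => DispersionNLS.profile p t₀ φ s x) t
          + ((‖DispersionNLS.profile p t₀ φ t x‖ ^ (p - 1) : ℝ) : ℂ)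
            * DispersionNLS.profile p t₀ φ t x = 0) := by
  have hφ2 := (DispersionNLS.memH2_iff φ).1 hφ
  have key := fun (a b η : ℝ) (hη : 0 < η) => DispersionNLS.eventually_subset_and_eH2Norm_le hd hp
    hγp hγm hγ t₀ hφ2 hu a b hη
  refine ⟨fun a b => ⟨(key a b 1 one_pos).mono fun ε h => h.1, ?_⟩, ?_, fun x => ⟨?_, fun t => ?_⟩⟩
  · rw [ENNReal.tendsto_nhds_zero]
    intro η' hη'
    obtain ⟨η, hη, hηη'⟩ := ENNReal.lt_iff_exists_nnreal_btwn.1 hη'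
    filter_upwards [key a b η (by simpa using hη)] with ε h
    refine iSup₂_le fun t ht => (h.2 t ht).trans ?_
    rw [ENNReal.ofReal_coe_nnreal]
    exact hηη'.le
  · obtain ⟨C, hC, hb⟩ := DispersionNLS.ae_norm_le (d := d) hd one_pos
    exact DispersionNLS.isSolution_profileL2 (M := 1 * (DispersionNLS.eH2Norm φ).toReal + C * ‖φ‖)
      hp (by positivity) t₀
      (hb φ _ ENNReal.toReal_nonneg (ENNReal.ofReal_toReal hφ2.ne).ge) hφ2
  · simp [DispersionNLS.profile]
  · have h := DispersionNLS.hasDerivAt_profile p t₀ φ t x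
    refine ⟨h.differentiableAt, ?_⟩
    rw [h.deriv, ← mul_assoc, Complex.I_mul_I]
    ring
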